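/- Conventions. A $\Pi W$-pretopos is a locally cartesian closed pretopos (exact and lextensive category with finite limits) in which every polynomial functor $P_f = \Sigma_A \Pi_f (B \times -)$, $f : B \to A$, has an initial algebra. A map is a cover if it factors through no proper subobject of its codomain. A commutative square with top $q : D \to B$, left side $g : D \to C$, right side $f : B \to A$ and bottom $p : C \to A$ is covering if $p$ and $D \to C \times_A B$ are covers; it is a collection square if in the internal logic, for every $c \in C$ and every cover $e : Y \to D_c$, there are $c' \in C$ with $p(c) = p(c')$ and a map $h : D_{c'} \to D_c$ over $B$ that factors through $e$; it is a strong collection square if $h$ can be chosen to be a cover. A (strong) predicative topos is a $\Pi W$-pretopos in which every map is the right side of a square that is both covering and (strong) collection. Let $\mathbb C$ be an internal category with object of objects $C_0$ and object of arrows $C_1$. A site $(\mathbb C, \mathrm{Cov})$ is a commutative square with top $m : \underline{\mathrm{Cov}} \to C_1$, left side $\phi : \underline{\mathrm{Cov}} \to \mathrm{Cov}$, right side $\mathrm{cod} : C_1 \to C_0$ and bottom $n : \mathrm{Cov} \to C_0$ (so that each $U \in \mathrm{Cov}$ gives a covering family $(m(i))_{i \in \underline{\mathrm{Cov}}_U}$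 of $n(U)$) such that internally: (C) for every covering family $(\alpha_i)_i$ of $C$ and every $f : D \to C$ there is a covering family $(\beta_j)_j$ of $D$ such that every $f\beta_j$ factors through some $\alpha_i$. It is a Grothendieck site if internally: (M) every object $C$ has a covering family with $\mathrm{id}_C$ as a member; (L) for every covering family $(\alpha_i : C_i \to C)_i$ and covering families $(\beta_{ij})_j$ of $C_i$, given for every $i$, there is a covering family of $C$ each of whose members factors through some $\alpha_i \beta_{ij}$. It is a (strong) collection site if its square is a (strong) collection square. An internal presheaf $P$ on $\mathbb C$ is a sheaf if internally every compatible family for every covering family has a unique amalgamation. Two sites on $\mathbb C$ are called equivalent if they have the same sheaves (hence equivalent categories of sheaves). Theorem. Let $\mathcal E$ be a (strong) predicative topos and $\mathbb C$ an internal category in $\mathcal E$. (1) Every site $(\mathbb C, \mathrm{Cov})$ is equivalent to a (strong) collection site on $\mathbb C$. (2) For every site $(\mathbb C, \mathrm{Cov})$, the endofunctor of $\mathcal E / C_0$ given by $$(FX)_C = 1 + \sum_{U \in \mathrm{Cov}(C)} \ \prod_{i \in \underline{\mathrm{Cov}}_U} X_{\mathrm{dom}(m(i))}$$ is a dependent polynomial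 functor, i.e. isomorphic to $\Sigma_t \Pi_f s^*$ for some diagram $C_0 \xleftarrow{s} B \xrightarrow{f} A \xrightarrow{t} C_0$. If $(\mathbb C, \mathrm{Cov})$ is a (strong) collection site, there is an equivalent Grothendieck (strong) collection site $(\mathbb C, \mathrm{COV})$, with square $M : \underline{\mathrm{COV}} \to C_1$, $\underline{\mathrm{COV}} \to \mathrm{COV} \to C_0$, such that $\mathrm{COV} \to C_0$ carries the structure of an initial $F$-algebra and, writing the elements of $\mathrm{COV}$ as $*_C$ ($C \in C_0$) and $\sup_U(t)$ ($U \in \mathrm{Cov}$, $t$ a function with $t(i) \in \mathrm{COV}(\mathrm{dom}(m(i)))$ for $i \in \underline{\mathrm{Cov}}_U$), $$\underline{\mathrm{COV}}_{*_C} = 1, \qquad \underline{\mathrm{COV}}_{\sup_U(t)} = \sum_{i \in \underline{\mathrm{Cov}}_U} \underline{\mathrm{COV}}_{t(i)},$$ where $M$ sends the unique element of $\underline{\mathrm{COV}}_{*_C}$ to $\mathrm{id}_C$ and $(i,k) \in \underline{\mathrm{COV}}_{\sup_U(t)}$ to $m(i) \circ M(k)$. (3) Consequently, every site $(\mathbb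 C, \mathrm{Cov})$ is equivalent to a Grothendieck (strong) collection site on $\mathbb C$. Throughout, the bracketed word "strong" is either read everywhere or omitted everywhere. -/

import Mathlib

open CategoryTheory CategoryTheory.Limits

universe v u

noncomputable section

namespace PredTopos

/-! ### ΠW-pretoposes -/

section Pretopos

variable {E : Type u} [Category.{v} E]

/-- Covers: maps into `A` that factor through no proper subobject of `A`.  In a category with
finite limits such a map is automatically epic, so this is Mathlib's `ExtremalEpi`. -/
abbrev IsCover {X Y : E} (f : X ⟶ Y) : Prop := ExtremalEpi f

/-- The fork `R ⇉ X ⟶ Q` is exact: `R` is the kernel pair of `q`, and `q` is the coequaliser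
of `r₀` and `r₁`. -/
def IsExactFork {R X Q : E} (r₀ r₁ : R ⟶ X) (q : X ⟶ Q) : Prop :=
  IsKernelPair q r₀ r₁ ∧ ∃ w : r₀ ≫ q = r₁ ≫ q, Nonempty (IsColimit (Cofork.ofπ q w))

/-- A fork is stably exact if it is exact and each of its pullbacks
`P ×_Q R ⇉ P ×_Q X ⟶ P` along a map `p : P ⟶ Q` is exact too. -/
def IsStablyExactFork [HasPullbacks E] {R X Q : E} (r₀ r₁ : R ⟶ X) (q : X ⟶ Q) : Prop :=
  IsExactFork r₀ r₁ q ∧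
    ∃ w : r₀ ≫ q = r₁ ≫ q, ∀ ⦃P : E⦄ (p : P ⟶ Q),
      IsExactFork
        (pullback.lift (pullback.fst p (r₀ ≫ q)) (pullback.snd p (r₀ ≫ q) ≫ r₀)
          (by rw [pullback.condition, Category.assoc]) :
          pullback p (r₀ ≫ q) ⟶ pullback p q)
        (pullback.lift (pullback.fst p (r₀ ≫ q)) (pullback.snd p (r₀ ≫ q) ≫ r₁)
          (by simp only [Category.assoc, ← w, pullback.condition]))
        (pullback.fst p q)

/-- Exact categories: regular, and every equivalence relation fits into a stably exact fork. -/
class Exact (E : Type u) [Category.{v} E] : Prop extends Regular E where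
  exists_quotient : ∀ ⦃R X : E⦄ (r₀ r₁ : R ⟶ X), IsEquivalenceRelation r₀ r₁ →
    ∃ (Q : E) (q : X ⟶ Q), IsStablyExactFork r₀ r₁ q

/-- Pretoposes: exact and (with all finite limits) lextensive, i.e. finite sums exist and are
disjoint and stable under pullback. -/
class Pretopos (E : Type u) [Category.{v} E] : Prop extends Exact E, FinitaryExtensive E

/-- Every pullback functor `f^*` has a right adjoint. -/
class LCC (E : Type u) [Category.{v} E] [HasFiniteLimits E] : Prop where
  isLeftAdjoint : ∀ ⦃X Y : E⦄ (f : X ⟶ Y), (Over.pullback f).IsLeftAdjoint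

attribute [instance] LCC.isLeftAdjoint

/-- The right adjoint `Π_f` of the pullback functor `f^*`. -/
def Pi [HasFiniteLimits E] [LCC E] {B A : E} (f : B ⟶ A) : Over B ⥤ Over A :=
  Functor.rightAdjoint (Over.pullback f)

/-- The adjunction `f^* ⊣ Π_f`. -/
def pullbackPiAdj [HasFiniteLimits E] [LCC E] {B A : E} (f : B ⟶ A) :
    Over.pullback f ⊣ Pi f :=
  Adjunction.ofIsLeftAdjoint (Over.pullback f)

/-- The polynomial functor `X ↦ Σ_{a ∈ A} X ^ {B_a}` of a map `f : B ⟶ A`. -/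
def poly [HasFiniteLimits E] [LCC E] {B A : E} (f : B ⟶ A) : E ⥤ E :=
  Over.star B ⋙ Pi f ⋙ Over.forget A

/-- The dependent polynomial functor `Σ_t Π_f s^*` of a diagram `I ⟵ B ⟶ A ⟶ J`. -/
def depPoly [HasFiniteLimits E] [LCC E] {I B A J : E} (s : B ⟶ I) (f : B ⟶ A) (t : A ⟶ J) :
    Over I ⥤ Over J :=
  Over.pullback s ⋙ Pi f ⋙ Over.map t

/-- ΠW-pretoposes: locally cartesian closed pretoposes with all W-types, i.e. with initial
algebras for all polynomial functors. -/
class PiWPretopos (E : Type u) [Category.{v} E] : Prop extends Pretopos E, LCC E where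
  hasWTypes : ∀ ⦃B A : E⦄ (f : B ⟶ A), HasInitial (Endofunctor.Algebra (poly f))

/-!
### Collection squares and the axiom of multiple choice

Statements in the internal logic are written out by their Kripke–Joyal semantics, through
generalised elements `T ⟶ X`: an existential quantifier is witnessed after passing to a cover
of the stage `T`. In all squares `q` is the top, `g` the left, `f` the right and `p` the
bottom side. For `c : T ⟶ C` the fibre `D_c` of `g : D ⟶ C` is `pullback c g`, over `T`.
-/

variable [HasPullbacks E]

/-- Covering squares: `p` and the canonical map `D ⟶ C ×_A B` are covers. -/
def IsCoveringSquare {D B C A : E} (q : D ⟶ B) (g : D ⟶ C) (f : B ⟶ A) (p : C ⟶ A) : Prop :=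
  IsCover p ∧ ∃ w : g ≫ p = q ≫ f, IsCover (pullback.lift g q w : D ⟶ pullback p f)

/-- Collection squares: for every `c ∈ C` and every cover `e : Y ↠ D_c` there is `c' ∈ C` with
`p c = p c'` and a map `h : D_{c'} ⟶ D_c` over `B` that factors through `e`. -/
def IsCollectionSquare {D B C A : E} (q : D ⟶ B) (g : D ⟶ C) (f : B ⟶ A) (p : C ⟶ A) : Prop :=
  g ≫ p = q ≫ f ∧
  ∀ ⦃T : E⦄ (c : T ⟶ C) ⦃Y : E⦄ (e : Y ⟶ pullback c g), IsCover e →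
    ∃ (T' : E) (r : T' ⟶ T) (c' : T' ⟶ C) (h : pullback c' g ⟶ pullback c g),
      IsCover r ∧ c' ≫ p = r ≫ c ≫ p ∧
      pullback.fst c' g ≫ r = h ≫ pullback.fst c g ∧
      h ≫ pullback.snd c g ≫ q = pullback.snd c' g ≫ q ∧
      ∃ k : pullback c' g ⟶ Y, k ≫ e = h

/-- Strong collection squares: the same, where `h` can be chosen to be a cover. At the stage
`T'` this says that the map induced by `h` from `D_{c'}` to the fibre `T' ×_T D_c` of `g` over
`c` restricted to `T'` is a cover. -/
def IsStrongCollectionSquare {D B C A : E} (q : D ⟶ B) (g : D ⟶ C) (f : B ⟶ A) (p : C ⟶ A) :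
    Prop :=
  g ≫ p = q ≫ f ∧
  ∀ ⦃T : E⦄ (c : T ⟶ C) ⦃Y : E⦄ (e : Y ⟶ pullback c g), IsCover e →
    ∃ (T' : E) (r : T' ⟶ T) (c' : T' ⟶ C) (h : pullback c' g ⟶ pullback c g),
      IsCover r ∧ c' ≫ p = r ≫ c ≫ p ∧
      (∃ w : pullback.fst c' g ≫ r = h ≫ pullback.fst c g,
        IsCover (pullback.lift (pullback.fst c' g) h w :
          pullback c' g ⟶ pullback r (pullback.fst c g))) ∧
      h ≫ pullback.snd c g ≫ q = pullback.snd c' g ≫ q ∧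
      ∃ k : pullback c' g ⟶ Y, k ≫ e = h

/-- The Axiom of Multiple Choice. -/
def AMC (E : Type u) [Category.{v} E] [HasPullbacks E] : Prop :=
  ∀ ⦃B A : E⦄ (f : B ⟶ A), ∃ (D C : E) (q : D ⟶ B) (g : D ⟶ C) (p : C ⟶ A),
    IsCoveringSquare q g f p ∧ IsCollectionSquare q g f p

/-- The Strong Axiom of Multiple Choice. -/
def SAMC (E : Type u) [Category.{v} E] [HasPullbacks E] : Prop :=
  ∀ ⦃B A : E⦄ (f : B ⟶ A), ∃ (D C : E) (q : D ⟶ B) (g : D ⟶ C) (p : C ⟶ A),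
    IsCoveringSquare q g f p ∧ IsStrongCollectionSquare q g f p

end Pretopos

/-- Predicative toposes. -/
class PredicativeTopos (E : Type u) [Category.{v} E] : Prop extends PiWPretopos E where
  amc : AMC E

/-- Strong predicative toposes. -/
class StrongPredicativeTopos (E : Type u) [Category.{v} E] : Prop extends PiWPretopos E where
  samc : SAMC E

/-! ### Internal categories and presheaves -/

/-- Internal categories; `compose` sends `(g, f)` with `dom g = cod f` to `g ∘ f`. -/
structure InternalCategory (E : Type u) [Category.{v} E] [HasPullbacks E] where
  Ob : E
  Ar : E
  dom : Ar ⟶ Ob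
  cod : Ar ⟶ Ob
  ident : Ob ⟶ Ar
  compose : pullback dom cod ⟶ Ar
  ident_dom : ident ≫ dom = 𝟙 Ob
  ident_cod : ident ≫ cod = 𝟙 Ob
  compose_dom : compose ≫ dom = pullback.snd dom cod ≫ dom
  compose_cod : compose ≫ cod = pullback.fst dom cod ≫ cod
  ident_comp : ∀ ⦃T : E⦄ (f : T ⟶ Ar),
    pullback.lift (f ≫ cod ≫ ident) f (by simp [ident_dom]) ≫ compose = f
  comp_ident : ∀ ⦃T : E⦄ (f : T ⟶ Ar),
    pullback.lift f (f ≫ dom ≫ ident) (by simp [ident_cod]) ≫ compose = f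
  assoc : ∀ ⦃T : E⦄ (h g f : T ⟶ Ar) (w : h ≫ dom = g ≫ cod) (w' : g ≫ dom = f ≫ cod),
    pullback.lift (pullback.lift h g w ≫ compose) f
        (by rw [Category.assoc, compose_dom, pullback.lift_snd_assoc, w']) ≫ compose =
      pullback.lift h (pullback.lift g f w' ≫ compose)
        (by rw [Category.assoc, compose_cod, pullback.lift_fst_assoc, w]) ≫ compose

variable {E : Type u} [Category.{v} E] [HasPullbacks E]

/-- For generalised elements `g f d` of the object of arrows: `g ∘ f` is defined and equals
`d`. -/
def InternalCategory.IsComp (C : InternalCategory E) {T : E} (g f d : T ⟶ C.Ar) : Prop :=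
  ∃ w : g ≫ C.dom = f ≫ C.cod, pullback.lift g f w ≫ C.compose = d

/-- Internal presheaves; `act` sends `(x, f)` with `π x = cod f` to `x · f`. -/
structure Presheaf (C : InternalCategory E) where
  X : E
  π : X ⟶ C.Ob
  act : pullback π C.cod ⟶ X
  act_π : act ≫ π = pullback.snd π C.cod ≫ C.dom
  act_ident : ∀ ⦃T : E⦄ (x : T ⟶ X),
    pullback.lift x (x ≫ π ≫ C.ident) (by simp [C.ident_cod]) ≫ act = x
  act_comp : ∀ ⦃T : E⦄ (x : T ⟶ X) (f g : T ⟶ C.Ar) (w : x ≫ π = f ≫ C.cod)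
    (w' : f ≫ C.dom = g ≫ C.cod),
    pullback.lift (pullback.lift x f w ≫ act) g
        (by rw [Category.assoc, act_π, pullback.lift_snd_assoc, w']) ≫ act =
      pullback.lift x (pullback.lift f g w' ≫ C.compose)
        (by rw [Category.assoc, C.compose_cod, pullback.lift_fst_assoc, w]) ≫ act

namespace Presheaf

variable {C : InternalCategory E}

/-- For generalised elements: `x · f` is defined and equals `y`. -/
def IsAct (P : Presheaf C) {T : E} (x : T ⟶ P.X) (f : T ⟶ C.Ar) (y : T ⟶ P.X) : Prop :=
  ∃ w : x ≫ P.π = f ≫ C.cod, pullback.lift x f w ≫ P.act = y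

/-- Morphisms of internal presheaves. -/
@[ext]
structure Hom (P Q : Presheaf C) where
  map : P.X ⟶ Q.X
  map_π : map ≫ Q.π = P.π
  map_act : ∀ ⦃T : E⦄ (x : T ⟶ P.X) (f : T ⟶ C.Ar) (y : T ⟶ P.X),
    P.IsAct x f y → Q.IsAct (x ≫ map) f (y ≫ map)

instance : Category (Presheaf C) where
  Hom P Q := Hom P Q
  id P := ⟨𝟙 _, by simp, by simp⟩
  comp a b := ⟨a.map ≫ b.map, by rw [Category.assoc, b.map_π, a.map_π], fun _ x f y h => by
    simpa using b.map_act _ _ _ (a.map_act x f y h)⟩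
  id_comp a := by ext; simp
  comp_id a := by ext; simp
  assoc a b c := by ext; simp

end Presheaf

/-! ### Internal sites and sheaves -/

/-- Internal sites on the internal category `C`: a commutative square
```
  Fam --m--> C.Ar
   |          |
   φ         cod
   v          v
  Cov --n--> C.Ob
```
(`Cov` is the object of covering families, `n U` the object covered by `U`, `Fam_U` the index set
of `U`, and `m` gives the members of the families) for which the following holds in the internal
logic: for any covering family `U` and any arrow `f` into `n U` there is a family `V` covering the
domain of `f` such that for each member `β` of `V` the composite `f ∘ β` factors as `α ∘ h`
for some member `α` of `U`. -/
structure Site (C : InternalCategory E) where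
  Cov : E
  Fam : E
  φ : Fam ⟶ Cov
  n : Cov ⟶ C.Ob
  m : Fam ⟶ C.Ar
  comm : m ≫ C.cod = φ ≫ n
  stable : ∀ ⦃T : E⦄ (U : T ⟶ Cov) (f : T ⟶ C.Ar), f ≫ C.cod = U ≫ n →
    ∃ (T' : E) (r : T' ⟶ T) (V : T' ⟶ Cov), IsCover r ∧ V ≫ n = r ≫ f ≫ C.dom ∧
      ∀ ⦃S : E⦄ (s : S ⟶ T') (j : S ⟶ Fam), j ≫ φ = s ≫ V →
        ∃ (S' : E) (r' : S' ⟶ S) (i : S' ⟶ Fam) (h d : S' ⟶ C.Ar), IsCover r' ∧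
          i ≫ φ = r' ≫ s ≫ r ≫ U ∧
          C.IsComp (r' ≫ s ≫ r ≫ f) (r' ≫ j ≫ m) d ∧ C.IsComp (i ≫ m) h d

namespace Site

variable {C : InternalCategory E}

/-- `x` is a compatible family for the covering family `U` (at stage `T`): it assigns to every
index `i` of `U` an element `x_i` of `P` over the domain of `α_i = m i`, such that
`x_i · f = x_j · g` whenever `α_i ∘ f = α_j ∘ g`. -/
def IsCompatible (S : Site C) (P : Presheaf C) {T : E} (U : T ⟶ S.Cov)
    (x : pullback U S.φ ⟶ P.X) : Prop :=
  x ≫ P.π = pullback.snd U S.φ ≫ S.m ≫ C.dom ∧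
  ∀ ⦃T' : E⦄ (i j : T' ⟶ pullback U S.φ) (f g d : T' ⟶ C.Ar) (y z : T' ⟶ P.X),
    i ≫ pullback.fst U S.φ = j ≫ pullback.fst U S.φ →
    C.IsComp (i ≫ pullback.snd U S.φ ≫ S.m) f d →
    C.IsComp (j ≫ pullback.snd U S.φ ≫ S.m) g d →
    P.IsAct (i ≫ x) f y → P.IsAct (j ≫ x) g z → y = z

/-- `p` is an amalgamation of the family `x`: `p` lies over the covered object, and
`p · α_i = x_i` for every index `i` of `U`. -/
def IsAmalgamation (S : Site C) (P : Presheaf C) {T : E} (U : T ⟶ S.Cov)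
    (x : pullback U S.φ ⟶ P.X) (p : T ⟶ P.X) : Prop :=
  p ≫ P.π = U ≫ S.n ∧
  P.IsAct (pullback.fst U S.φ ≫ p) (pullback.snd U S.φ ≫ S.m) x

/-- Sheaves: every compatible family has a unique amalgamation. -/
def IsSheaf (S : Site C) : ObjectProperty (Presheaf C) := fun P =>
  ∀ ⦃T : E⦄ (U : T ⟶ S.Cov) (x : pullback U S.φ ⟶ P.X), S.IsCompatible P U x →
    ∃! p : T ⟶ P.X, S.IsAmalgamation P U x p

/-- The category of internal sheaves, a full subcategory of the internal presheaves. -/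
abbrev Sheaves (S : Site C) : Type (max u v) := S.IsSheaf.FullSubcategory

/-- Equivalence of two sites on the same internal category: they have the same sheaves, and (so)
equivalent categories of sheaves. -/
def Equivalent (S S' : Site C) : Prop :=
  (∀ P : Presheaf C, S.IsSheaf P ↔ S'.IsSheaf P) ∧ Nonempty (S.Sheaves ≌ S'.Sheaves)

/-- Grothendieck sites.
(M): every object has a covering family with the identity among its members.
(L): for any covering family `(α_i)_i` of an object `C`, and for any function that assigns to
every `i` a family `V_i` covering the domain of `α_i`, there is a family `W` covering `C`
each of whose members factors through some `α_i ∘ β` with `β` a member of `V_i`. -/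
structure IsGrothendieck (S : Site C) : Prop where
  maximal : ∀ ⦃T : E⦄ (c : T ⟶ C.Ob),
    ∃ (T' : E) (r : T' ⟶ T) (U : T' ⟶ S.Cov) (i : T' ⟶ S.Fam), IsCover r ∧
      U ≫ S.n = r ≫ c ∧ i ≫ S.φ = U ∧ i ≫ S.m = r ≫ c ≫ C.ident
  isLocal : ∀ ⦃T : E⦄ (U : T ⟶ S.Cov) (V : pullback U S.φ ⟶ S.Cov),
    V ≫ S.n = pullback.snd U S.φ ≫ S.m ≫ C.dom →
    ∃ (T' : E) (r : T' ⟶ T) (W : T' ⟶ S.Cov), IsCover r ∧ W ≫ S.n = r ≫ U ≫ S.n ∧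
      ∀ ⦃Q : E⦄ (s : Q ⟶ T') (l : Q ⟶ S.Fam), l ≫ S.φ = s ≫ W →
        ∃ (Q' : E) (r' : Q' ⟶ Q) (i : Q' ⟶ pullback U S.φ) (j : Q' ⟶ S.Fam)
          (h d : Q' ⟶ C.Ar), IsCover r' ∧
          i ≫ pullback.fst U S.φ = r' ≫ s ≫ r ∧ j ≫ S.φ = i ≫ V ∧
          C.IsComp (i ≫ pullback.snd U S.φ ≫ S.m) (j ≫ S.m) d ∧
          C.IsComp d h (r' ≫ l ≫ S.m)

/-- Collection sites. -/
def IsCollection (S : Site C) : Prop := IsCollectionSquare S.m S.φ C.cod S.n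

/-- Strong collection sites. -/
def IsStrongCollection (S : Site C) : Prop := IsStrongCollectionSquare S.m S.φ C.cod S.n

end Site

/-! ### The inductively generated covering families -/

section Generated

variable {E : Type u} [Category.{v} E] [PiWPretopos E] {C : InternalCategory E}

/-- The functor `X ↦ Σ_{U ∈ Cov} Π_{i ∈ Fam_U} X_{dom (m i)}` into the slice over `Cov`: its value at
`X` is the object of pairs `(U, t)` where `U ∈ Cov` and `t` is a function assigning to every
`i ∈ Fam_U` an element `t i` of `X` over `dom (m i)`, with structure map `(U, t) ↦ U`. -/
def Site.Trees (S : Site C) : Over C.Ob ⥤ Over S.Cov :=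
  Over.pullback (S.m ≫ C.dom) ⋙ Pi S.φ

/-- The endofunctor `(F X)_c = 1 + Σ_{U ∈ Cov(c)} Π_{i ∈ Fam_U} X_{dom (m i)}` (`c ∈ C.Ob`) of the
slice over `C.Ob`. -/
def Site.coverFunctor (S : Site C) : Over C.Ob ⥤ Over C.Ob where
  obj X := Over.mk (coprod.desc (𝟙 C.Ob) ((S.Trees.obj X).hom ≫ S.n))
  map a := Over.homMk (coprod.map (𝟙 C.Ob) (S.Trees.map a).left)

/-- The evaluation `((U, t), i) ↦ t i`. -/
def Site.eval (S : Site C) (X : Over C.Ob) : pullback (S.Trees.obj X).hom S.φ ⟶ X.left :=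
  Over.Hom.left (((pullbackPiAdj S.φ).counit.app ((Over.pullback (S.m ≫ C.dom)).obj X) :
    (Over.pullback S.φ).obj (S.Trees.obj X) ⟶ (Over.pullback (S.m ≫ C.dom)).obj X)) ≫
    pullback.fst X.hom (S.m ≫ C.dom)

/-- The site `S'` is inductively generated from `S`: its object of covering families is an initial
algebra for `S.coverFunctor`, with structure maps written `*` and `(U, t) ↦ sup_U t`; its index
sets satisfy the recursion equations `Fam'_* = 1` and `Fam'_{sup_U t} = Σ_{i ∈ Fam_U} Fam'_{t i}`
(the two pullback squares); and in these terms its members are given by the recursion equations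
`m' = id` on `Fam'_*` and `m' (i, k) = m i ∘ m' k` on `Fam'_{sup_U t}`. -/
def Site.IsGeneratedBy (S' S : Site C) : Prop :=
  ∃ str : S.coverFunctor.obj (Over.mk S'.n) ⟶ Over.mk S'.n,
    Nonempty (IsInitial (⟨Over.mk S'.n, str⟩ : Endofunctor.Algebra S.coverFunctor)) ∧
    (∃ unit : C.Ob ⟶ S'.Fam,
      IsPullback unit (𝟙 C.Ob) S'.φ
        ((coprod.inl : C.Ob ⟶ C.Ob ⨿ (S.Trees.obj (Over.mk S'.n)).left) ≫ str.left) ∧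
      unit ≫ S'.m = C.ident) ∧
    (∃ pair : pullback (S.eval (Over.mk S'.n)) S'.φ ⟶ S'.Fam,
      IsPullback pair
        (pullback.fst (S.eval (Over.mk S'.n)) S'.φ ≫
          pullback.fst (S.Trees.obj (Over.mk S'.n)).hom S.φ)
        S'.φ
        ((coprod.inr : (S.Trees.obj (Over.mk S'.n)).left ⟶
          C.Ob ⨿ (S.Trees.obj (Over.mk S'.n)).left) ≫ str.left) ∧
      C.IsComp
        (pullback.fst (S.eval (Over.mk S'.n)) S'.φ ≫
          pullback.snd (S.Trees.obj (Over.mk S'.n)).hom S.φ ≫ S.m)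
        (pullback.snd (S.eval (Over.mk S'.n)) S'.φ ≫ S'.m)
        (pair ≫ S'.m))

/-- `F` is (isomorphic to) a dependent polynomial functor. -/
def IsDepPoly {I J : E} (F : Over I ⥤ Over J) : Prop :=
  ∃ (B A : E) (s : B ⟶ I) (f : B ⟶ A) (t : A ⟶ J), Nonempty (F ≅ depPoly s f t)

end Generated

end PredTopos

end

noncomputable section

namespace PredTopos

attribute [local simp] pullback.lift_fst pullback.lift_snd pullback.lift_fst_assoc
  pullback.lift_snd_assoc

/-! ### Covers in regular categories -/

section Covers

variable {E : Type u} [Category.{v} E] [Regular E]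

/-! Part (1) is a change of indexing. Multiple choice, applied to `φ : Fam ⟶ Cov`, gives a covering
collection square with right side `φ`, and its left side indexes the same families with repetitions
(`Site.reindexed`). The collection property survives composition with `m` and `n`. Sites whose
families refine each other have the same sheaves (`Site.IsRefinedBy.isSheaf`), and repetitions do
not affect refinement.

For (2), the functor `1 + Σ Π` is a single `Σ Π`, taken along `φ` followed by a coproduct inclusion:
the fibres over the added summand are empty, so there is exactly one function on each of them
(`nonempty_sumFunctor_iso`). The W-types assumed to exist are the nondependent ones; initial
algebras of dependent polynomial functors are cut out of them as the trees whose indices match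
(`WType.exists_wellIndexed`, `hasInitial_depPoly_aux`). The members of the generated families form a
second such initial algebra, of branches through trees, and extensivity turns its constructors into
the two recursion equations (`nonempty_generatedFamilies`).

The remaining claims are proved by induction on trees. Induction holds for predicates on generalised
elements that are represented by a subobject, so each predicate must be shown `Definable`. The
difficulty lies in the step for `sup`: the induction hypothesis gives, for every `i` in the index
set of `U`, the mere existence of a suitable family, whereas `sup` needs a function of `i`. This is
what the collection property is for: `U` is replaced by a `U'` covering the same object, with a map
of index sets to that of `U` preserving members, over which the choice becomes a function
(`covers_trans`). Conditions (C) and (L) follow (`covers_pullbackSieve`, `covers_compositeSieve`);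
the families `*` give (M).

The collection property of the generated families quantifies over all covers of a fibre, which is
not a definable condition as it stands. Multiple choice for the generated map `G.φ` supplies one
internal family of covers that suffices for testing (`BoundedCollectsAt`), and this reformulation is
definable.

For the sheaves, separatedness with respect to the generated families is proved by induction.
Amalgamations are then unique, so their existence is definable as well, and a second induction
amalgamates first over each `t i` and then over `U`; the point is that the partial amalgamations are
compatible (`isCompatible_of_amalgamates`). Conversely `sup_U` of the constant function `*` refines
`U`. Part (3) combines (1) and (2). The plain and strong versions are treated together, through a
proposition `b` that switches the surjectivity clause on. -/

theorem isCover_iff_strongEpi {X Y : E} {f : X ⟶ Y} : IsCover f ↔ StrongEpi f :=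
  extremalEpi_iff_strongEpi_of_hasPullbacks f

theorem IsCover.of_isIso {X Y : E} (f : X ⟶ Y) [IsIso f] : IsCover f :=
  isCover_iff_strongEpi.2 inferInstance

theorem IsCover.comp {X Y Z : E} {f : X ⟶ Y} {g : Y ⟶ Z} (hf : IsCover f) (hg : IsCover g) :
    IsCover (f ≫ g) := by
  rw [isCover_iff_strongEpi] at *
  exact strongEpi_comp f g

theorem IsCover.of_comp {X Y Z : E} {f : X ⟶ Y} {g : Y ⟶ Z} (h : IsCover (f ≫ g)) :
    IsCover g := by
  rw [isCover_iff_strongEpi] at *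
  exact strongEpi_of_strongEpi f g

theorem IsCover.of_fac {X Y Z : E} {f : X ⟶ Y} {g : Y ⟶ Z} {h : X ⟶ Z} (hh : IsCover h)
    (w : f ≫ g = h) : IsCover g := by
  subst w; exact hh.of_comp

theorem IsCover.isRegularEpi {X Y : E} {f : X ⟶ Y} (hf : IsCover f) : IsRegularEpi f := by
  have : ExtremalEpi f := hf
  infer_instance

theorem IsCover.of_isRegularEpi {X Y : E} (f : X ⟶ Y) [IsRegularEpi f] : IsCover f :=
  isCover_iff_strongEpi.2 inferInstance

theorem IsCover.pullback_fst {X Y Z : E} (f : X ⟶ Z) {g : Y ⟶ Z} (hg : IsCover g) :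
    IsCover (pullback.fst f g) := by
  have := hg.isRegularEpi
  exact IsCover.of_isRegularEpi _

/-- Covers are left orthogonal to monomorphisms. -/
theorem IsCover.exists_lift {T' T X Z : E} {r : T' ⟶ T} (hr : IsCover r) {i : Z ⟶ X} [Mono i]
    {x : T ⟶ X} {z : T' ⟶ Z} (w : z ≫ i = r ≫ x) : ∃ z' : T ⟶ Z, z' ≫ i = x := by
  have := isCover_iff_strongEpi.1 hr
  exact ⟨(CommSq.mk w : CommSq z r i x).lift, by simp⟩

/-- Maps descend along covers. -/
theorem IsCover.exists_desc {T' T Y : E} {r : T' ⟶ T} (hr : IsCover r) (y : T' ⟶ Y)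
    (h : ∀ ⦃S : E⦄ (a b : S ⟶ T'), a ≫ r = b ≫ r → a ≫ y = b ≫ y) :
    ∃ y' : T ⟶ Y, r ≫ y' = y := by
  have := hr.isRegularEpi
  let s := IsRegularEpi.getStruct r
  exact ⟨s.desc' y (h _ _ s.w) |>.1, (s.desc' y (h _ _ s.w)).2⟩

/-- Covers are the locally surjective maps. -/
theorem isCover_of_locally_lift {X Y : E} {f : X ⟶ Y}
    (h : ∃ (T : E) (r : T ⟶ Y) (x : T ⟶ X), IsCover r ∧ x ≫ f = r) : IsCover f := by
  obtain ⟨T, r, x, hr, hx⟩ := h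
  exact hr.of_fac hx

theorem exists_image {X Y : E} (f : X ⟶ Y) :
    ∃ (I : E) (e : X ⟶ I) (i : I ⟶ Y), IsCover e ∧ Mono i ∧ e ≫ i = f :=
  let F := Regular.strongEpiMonoFactorisation f
  ⟨F.I, F.e, F.m, IsCover.of_isRegularEpi _, inferInstance, F.fac⟩

end Covers

/-! ### Elements of `Π_f` -/

section PiElements

variable {E : Type u} [Category.{v} E]

/-- Base change of a fibre. -/
def reindex [HasPullbacks E] {T' T A B : E} (r : T' ⟶ T) (a : T ⟶ A) (f : B ⟶ A) :
    pullback (r ≫ a) f ⟶ pullback a f :=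
  pullback.lift (pullback.fst _ _ ≫ r) (pullback.snd _ _)
    (by rw [Category.assoc, pullback.condition])

section
variable [HasPullbacks E] {T' T A B : E} (r : T' ⟶ T) (a : T ⟶ A) (f : B ⟶ A)

@[simp]
theorem reindex_fst : reindex r a f ≫ pullback.fst a f = pullback.fst _ _ ≫ r := by
  simp [reindex]

@[simp]
theorem reindex_fst_assoc {Z : E} (h : T ⟶ Z) :
    reindex r a f ≫ pullback.fst a f ≫ h = pullback.fst _ _ ≫ r ≫ h := by
  rw [← Category.assoc, reindex_fst, Category.assoc]

@[simp]
theorem reindex_snd : reindex r a f ≫ pullback.snd a f = pullback.snd _ _ := by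
  simp [reindex]

@[simp]
theorem reindex_snd_assoc {Z : E} (h : B ⟶ Z) :
    reindex r a f ≫ pullback.snd a f ≫ h = pullback.snd _ _ ≫ h := by
  rw [← Category.assoc, reindex_snd]

theorem comp_lift {S X Y Z : E} {g : X ⟶ Z} {h : Y ⟶ Z} (q : S ⟶ T) (x : T ⟶ X) (y : T ⟶ Y)
    (w : x ≫ g = y ≫ h) :
    q ≫ pullback.lift x y w =
      pullback.lift (q ≫ x) (q ≫ y) (by rw [Category.assoc, w, Category.assoc]) := by
  apply pullback.hom_ext <;> simp

end

variable [HasFiniteLimits E] [LCC E] {A B : E} {f : B ⟶ A} {Y : Over B}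

/-- The element of `Π_f Y` over `a` given by a section `k` of `Y` over the fibre of `a`. -/
def piLift {T : E} (a : T ⟶ A) (k : pullback a f ⟶ Y.left) (hk : k ≫ Y.hom = pullback.snd a f) :
    T ⟶ ((Pi f).obj Y).left :=
  ((pullbackPiAdj f).homEquiv (Over.mk a) Y
    (Over.homMk (U := (Over.pullback f).obj (Over.mk a)) k hk)).left

variable (f Y) in
/-- Evaluation of elements of `Π_f Y`. -/
def piEv : pullback ((Pi f).obj Y).hom f ⟶ Y.left :=
  ((pullbackPiAdj f).counit.app Y).left

@[simp]
theorem piEv_hom : piEv f Y ≫ Y.hom = pullback.snd _ _ :=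
  Over.w ((pullbackPiAdj f).counit.app Y)

@[simp]
theorem piLift_hom {T : E} (a : T ⟶ A) (k : pullback a f ⟶ Y.left)
    (hk : k ≫ Y.hom = pullback.snd a f) : piLift a k hk ≫ ((Pi f).obj Y).hom = a :=
  Over.w ((pullbackPiAdj f).homEquiv (Over.mk a) Y
    (Over.homMk (U := (Over.pullback f).obj (Over.mk a)) k hk))

/-- The counit formula for transposes. It reduces the computation rule and the extensionality of
`Π_f` to the fact that transposition is a bijection. -/
theorem homEquiv_symm_left {T : E} (a : T ⟶ A) (z : T ⟶ ((Pi f).obj Y).left)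
    (h : z ≫ ((Pi f).obj Y).hom = a) :
    (((pullbackPiAdj f).homEquiv (Over.mk a) Y).symm (Over.homMk z h)).left =
      pullback.lift (pullback.fst a f ≫ z) (pullback.snd a f)
        (by rw [Category.assoc, h, pullback.condition]) ≫ piEv f Y := by
  rw [Adjunction.homEquiv_counit]
  rfl

theorem lift_piLift_piEv {T : E} (a : T ⟶ A) (k : pullback a f ⟶ Y.left)
    (hk : k ≫ Y.hom = pullback.snd a f) :
    pullback.lift (pullback.fst a f ≫ piLift a k hk) (pullback.snd a f)
        (by rw [Category.assoc, piLift_hom, pullback.condition]) ≫ piEv f Y = k := by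
  rw [← homEquiv_symm_left a (piLift a k hk) (piLift_hom a k hk)]
  have : (Over.homMk (piLift a k hk) (piLift_hom a k hk) : Over.mk a ⟶ (Pi f).obj Y) =
    (pullbackPiAdj f).homEquiv (Over.mk a) Y
      (Over.homMk (U := (Over.pullback f).obj (Over.mk a)) k hk) := by
    ext; rfl
  rw [this, Equiv.symm_apply_apply]
  rfl

/-- Elements of `Π_f Y` over `a` are determined by their values. -/
theorem pi_ext {T : E} (a : T ⟶ A) {z z' : T ⟶ ((Pi f).obj Y).left}
    (h : z ≫ ((Pi f).obj Y).hom = a) (h' : z' ≫ ((Pi f).obj Y).hom = a)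
    (e : pullback.lift (pullback.fst a f ≫ z) (pullback.snd a f)
        (by rw [Category.assoc, h, pullback.condition]) ≫ piEv f Y =
      pullback.lift (pullback.fst a f ≫ z') (pullback.snd a f)
        (by rw [Category.assoc, h', pullback.condition]) ≫ piEv f Y) : z = z' := by
  rw [← homEquiv_symm_left a z h, ← homEquiv_symm_left a z' h'] at e
  have := ((pullbackPiAdj f).homEquiv (Over.mk a) Y).symm.injective (Over.OverMorphism.ext e)
  exact congrArg (fun t => t.left) this

/-- Naturality of the counit, read on elements. -/
theorem lift_map_piEv {Y' : Over B} (g : Y ⟶ Y') {T : E} (z : T ⟶ ((Pi f).obj Y).left)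
    (b : T ⟶ B) (w : z ≫ ((Pi f).obj Y).hom = b ≫ f) :
    pullback.lift (z ≫ ((Pi f).map g).left) b (by rw [Category.assoc, Over.w, w]) ≫ piEv f Y' =
      pullback.lift z b w ≫ piEv f Y ≫ g.left := by
  have := congrArg (fun t => pullback.lift z b w ≫ t.left)
    ((pullbackPiAdj f).counit.naturality g)
  refine Eq.trans ?_ this
  dsimp [piEv]
  refine Eq.trans ?_ (Category.assoc _ _ _)
  congr 1
  apply pullback.hom_ext
  · simp
  · simp

theorem lift_piLift_piEv' {T S : E} (a : T ⟶ A) (k : pullback a f ⟶ Y.left)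
    (hk : k ≫ Y.hom = pullback.snd a f) (r : S ⟶ T) (b : S ⟶ B) (w : r ≫ a = b ≫ f) :
    pullback.lift (r ≫ piLift a k hk) b (by rw [Category.assoc, piLift_hom, w]) ≫ piEv f Y =
      pullback.lift r b w ≫ k := by
  conv_rhs => rw [← lift_piLift_piEv a k hk]
  refine Eq.trans ?_ (Category.assoc _ _ _)
  congr 1
  apply pullback.hom_ext <;> simp

theorem piLift_map {T : E} (a : T ⟶ A) (k : pullback a f ⟶ Y.left)
    (hk : k ≫ Y.hom = pullback.snd a f) {Y' : Over B} (g : Y ⟶ Y') :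
    piLift a k hk ≫ ((Pi f).map g).left = piLift a (k ≫ g.left) (by simp [hk]) := by
  apply pi_ext a (by simp) (by simp)
  rw [lift_piLift_piEv]
  have := lift_map_piEv g (pullback.fst a f ≫ piLift a k hk) (pullback.snd a f) (by simp [pullback.condition])
  simp only [Category.assoc] at this
  rw [this, ← Category.assoc, lift_piLift_piEv]

end PiElements

/-! ### Elements of `Π_φ s^* X`: indexed functions -/

section SectionElements

variable {E : Type u} [Category.{v} E] [HasFiniteLimits E] [LCC E] {I A B : E}

/-- The object of pairs `(a, t)` with `t` a function assigning to every `b` in the fibre of `φ` over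
`a` an element `t b` of `X` over `s b`. -/
abbrev secObj (φ : B ⟶ A) (s : B ⟶ I) (X : Over I) : Over A :=
  (Pi φ).obj ((Over.pullback s).obj X)

variable {φ : B ⟶ A} {s : B ⟶ I} {X : Over I}

def secMk {T : E} (a : T ⟶ A) (t : pullback a φ ⟶ X.left)
    (ht : t ≫ X.hom = pullback.snd a φ ≫ s) : T ⟶ (secObj φ s X).left :=
  piLift a (Y := (Over.pullback s).obj X) (pullback.lift t (pullback.snd a φ) ht)
    (pullback.lift_snd _ _ _)

variable (φ s X) in
def secEv : pullback (secObj φ s X).hom φ ⟶ X.left :=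
  piEv φ _ ≫ pullback.fst X.hom s

/-- Application of a section to an element of the fibre. -/
def secApp {T : E} (z : T ⟶ (secObj φ s X).left) (b : T ⟶ B)
    (w : z ≫ (secObj φ s X).hom = b ≫ φ) : T ⟶ X.left :=
  pullback.lift z b w ≫ secEv φ s X

@[simp]
theorem secMk_hom {T : E} (a : T ⟶ A) (t : pullback a φ ⟶ X.left)
    (ht : t ≫ X.hom = pullback.snd a φ ≫ s) : secMk a t ht ≫ (secObj φ s X).hom = a :=
  piLift_hom _ _ _

@[simp]
theorem secMk_hom_assoc {T : E} (a : T ⟶ A) (t : pullback a φ ⟶ X.left)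
    (ht : t ≫ X.hom = pullback.snd a φ ≫ s) {Z : E} (h : A ⟶ Z) :
    secMk a t ht ≫ (secObj φ s X).hom ≫ h = a ≫ h := by
  rw [← Category.assoc, secMk_hom]

theorem secEv_hom : secEv φ s X ≫ X.hom = pullback.snd _ _ ≫ s := by
  have : piEv φ ((Over.pullback s).obj X) ≫ pullback.snd X.hom s = pullback.snd _ _ :=
    piEv_hom (f := φ) (Y := (Over.pullback s).obj X)
  rw [secEv, Category.assoc, pullback.condition, ← Category.assoc, this]

@[simp]
theorem secApp_hom {T : E} (z : T ⟶ (secObj φ s X).left) (b : T ⟶ B)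
    (w : z ≫ (secObj φ s X).hom = b ≫ φ) : secApp z b w ≫ X.hom = b ≫ s := by
  simp [secApp, secEv_hom]

theorem comp_secApp {S T : E} (r : S ⟶ T) (z : T ⟶ (secObj φ s X).left) (b : T ⟶ B)
    (w : z ≫ (secObj φ s X).hom = b ≫ φ) :
    r ≫ secApp z b w = secApp (r ≫ z) (r ≫ b) (by simp [w]) := by
  simp only [secApp]
  rw [← Category.assoc, comp_lift]

theorem secApp_secMk {S T : E} (a : T ⟶ A) (t : pullback a φ ⟶ X.left)
    (ht : t ≫ X.hom = pullback.snd a φ ≫ s) (r : S ⟶ T) (b : S ⟶ B) (w : r ≫ a = b ≫ φ) :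
    secApp (r ≫ secMk a t ht) b (by simp [w]) = pullback.lift r b w ≫ t := by
  have := congrArg (fun k => k ≫ pullback.fst X.hom s)
    (lift_piLift_piEv' a (Y := (Over.pullback s).obj X) (pullback.lift t (pullback.snd a φ) ht)
    (pullback.lift_snd _ _ _) r b w)
  dsimp at this
  simp only [secApp, secEv]
  rw [Category.assoc] at this
  refine this.trans ?_
  simp

theorem secApp_secMk_self {T : E} (a : T ⟶ A) (t : pullback a φ ⟶ X.left)
    (ht : t ≫ X.hom = pullback.snd a φ ≫ s) :
    secApp (pullback.fst a φ ≫ secMk a t ht) (pullback.snd a φ)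
      (by simp [pullback.condition]) = t := by
  rw [secApp_secMk _ _ _ _ _ pullback.condition]
  convert! Category.id_comp t
  apply pullback.hom_ext <;> simp

theorem sec_ext {T : E} (a : T ⟶ A) {z z' : T ⟶ (secObj φ s X).left}
    (h : z ≫ (secObj φ s X).hom = a) (h' : z' ≫ (secObj φ s X).hom = a)
    (e : secApp (pullback.fst a φ ≫ z) (pullback.snd a φ) (by simp [h, pullback.condition]) =
      secApp (pullback.fst a φ ≫ z') (pullback.snd a φ) (by simp [h', pullback.condition])) :
    z = z' := by
  refine pi_ext a h h' (pullback.hom_ext (f := X.hom) (g := s) ?_ ?_)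
  · simpa [secApp, secEv] using e
  · have : piEv φ ((Over.pullback s).obj X) ≫ pullback.snd X.hom s = pullback.snd _ _ :=
      piEv_hom (f := φ) (Y := (Over.pullback s).obj X)
    simp only [Category.assoc, this]
    simp

theorem secMk_eta {T : E} (a : T ⟶ A) (z : T ⟶ (secObj φ s X).left)
    (h : z ≫ (secObj φ s X).hom = a) :
    secMk a (secApp (pullback.fst a φ ≫ z) (pullback.snd a φ)
      (by simp [h, pullback.condition])) (by simp) = z :=
  sec_ext a (by simp) h (secApp_secMk_self _ _ _)

/-- Applied to the identity of `secObj φ s X`, this presents the universal element in the form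
`secMk`, so that equations between maps out of `secObj φ s X` need only be checked on such elements.
-/
theorem exists_eq_secMk {T : E} (z : T ⟶ (secObj φ s X).left) :
    ∃ (a : T ⟶ A) (t : pullback a φ ⟶ X.left) (ht : t ≫ X.hom = pullback.snd a φ ≫ s),
      z = secMk a t ht :=
  ⟨_, _, _, (secMk_eta _ z rfl).symm⟩

theorem comp_secMk {S T : E} (a : T ⟶ A) (t : pullback a φ ⟶ X.left)
    (ht : t ≫ X.hom = pullback.snd a φ ≫ s) (r : S ⟶ T) :
    r ≫ secMk a t ht = secMk (r ≫ a) (reindex r a φ ≫ t) (by simp [ht]) := by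
  apply sec_ext (r ≫ a) (by simp) (by simp)
  rw [secApp_secMk_self]
  have := secApp_secMk a t ht (pullback.fst (r ≫ a) φ ≫ r) (pullback.snd _ _)
    (by simp [pullback.condition])
  simp only [Category.assoc] at this
  exact this

theorem secMk_map {T : E} (a : T ⟶ A) (t : pullback a φ ⟶ X.left)
    (ht : t ≫ X.hom = pullback.snd a φ ≫ s) {X' : Over I} (g : X ⟶ X') :
    secMk a t ht ≫ ((Pi φ).map ((Over.pullback s).map g)).left =
      secMk a (t ≫ g.left) (by simp [ht]) := by
  rw [secMk, piLift_map]
  unfold secMk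
  congr 1
  apply pullback.hom_ext (f := X'.hom) (g := s) <;> simp

end SectionElements

/-! ### Elements of nondependent polynomial functors -/

section PolyElements

variable {E : Type u} [Category.{v} E] [HasFiniteLimits E] {B X : E}

/-- The element of `B^* X` with components `b` and `x`. -/
def starLift {T : E} (b : T ⟶ B) (x : T ⟶ X) : T ⟶ ((Over.star B).obj X).left :=
  prod.lift b x

variable (B X) in
def starSnd : ((Over.star B).obj X).left ⟶ X := (prod.snd : B ⨯ X ⟶ X)

theorem star_hom : ((Over.star B).obj X).hom = (prod.fst : B ⨯ X ⟶ B) := by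
  exact (Over.star_obj_hom B X).trans (prod.lift_fst _ _)

@[simp]
theorem starLift_hom {T : E} (b : T ⟶ B) (x : T ⟶ X) :
    starLift b x ≫ ((Over.star B).obj X).hom = b := by
  rw [star_hom]; exact prod.lift_fst _ _

@[simp]
theorem starLift_snd {T : E} (b : T ⟶ B) (x : T ⟶ X) : starLift b x ≫ starSnd B X = x :=
  prod.lift_snd _ _

theorem star_ext {T : E} {y y' : T ⟶ ((Over.star B).obj X).left}
    (h : y ≫ ((Over.star B).obj X).hom = y' ≫ ((Over.star B).obj X).hom)
    (h' : y ≫ starSnd B X = y' ≫ starSnd B X) : y = y' := by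
  rw [star_hom] at h
  exact Limits.prod.hom_ext h h'

theorem star_map_snd {X' : E} (g : X ⟶ X') :
    ((Over.star B).map g).left ≫ starSnd B X' = starSnd B X ≫ g := by
  refine Eq.trans ?_ (prod.map_snd (𝟙 B) g)
  exact congrArg (fun t => t ≫ (prod.snd : B ⨯ X' ⟶ X')) (Over.star_map_left B g)

variable [LCC E] {A : E} {f : B ⟶ A}

/-- The element of `poly f X` with label `a` and function `τ`. -/
def polyMk {T : E} (a : T ⟶ A) (τ : pullback a f ⟶ X) : T ⟶ (poly f).obj X :=
  piLift a (starLift (pullback.snd a f) τ) (starLift_hom _ _)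

def polyRoot (f : B ⟶ A) (X : E) : (poly f).obj X ⟶ A := ((Pi f).obj ((Over.star B).obj X)).hom

def polyEv (f : B ⟶ A) (X : E) : pullback (polyRoot f X) f ⟶ X :=
  piEv f ((Over.star B).obj X) ≫ starSnd B X

@[simp]
theorem polyMk_root {T : E} (a : T ⟶ A) (τ : pullback a f ⟶ X) :
    polyMk a τ ≫ polyRoot f X = a :=
  piLift_hom _ _ _

@[simp]
theorem polyMk_root_assoc {T : E} (a : T ⟶ A) (τ : pullback a f ⟶ X) {Z : E} (h : A ⟶ Z) :
    polyMk a τ ≫ polyRoot f X ≫ h = a ≫ h := by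
  rw [← Category.assoc, polyMk_root]

theorem lift_polyMk_polyEv {S T : E} (a : T ⟶ A) (τ : pullback a f ⟶ X) (r : S ⟶ T) (b : S ⟶ B)
    (w : r ≫ a = b ≫ f) :
    pullback.lift (r ≫ polyMk a τ) b (by simp [w]) ≫ polyEv f X = pullback.lift r b w ≫ τ := by
  have := congrArg (fun k => k ≫ starSnd B X)
    (lift_piLift_piEv' a (starLift (pullback.snd a f) τ) (starLift_hom _ _) r b w)
  refine ((Category.assoc _ _ _).symm.trans this).trans ?_
  simp

theorem poly_ext {T : E} (a : T ⟶ A) {z z' : T ⟶ (poly f).obj X} (h : z ≫ polyRoot f X = a)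
    (h' : z' ≫ polyRoot f X = a)
    (e : pullback.lift (pullback.fst a f ≫ z) (pullback.snd a f)
        (by rw [Category.assoc, h, pullback.condition]) ≫ polyEv f X =
      pullback.lift (pullback.fst a f ≫ z') (pullback.snd a f)
        (by rw [Category.assoc, h', pullback.condition]) ≫ polyEv f X) : z = z' := by
  refine pi_ext (Y := (Over.star B).obj X) a h h' (star_ext ?_ ?_)
  · simp only [Category.assoc, piEv_hom]
    exact (pullback.lift_snd _ _ _).trans (pullback.lift_snd _ _ _).symm
  · exact (Category.assoc _ _ _).trans (e.trans (Category.assoc _ _ _).symm)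

theorem polyMk_ev {T : E} (a : T ⟶ A) (τ : pullback a f ⟶ X) :
    pullback.lift (pullback.fst a f ≫ polyMk a τ) (pullback.snd a f)
      (by simp [pullback.condition]) ≫ polyEv f X = τ := by
  rw [lift_polyMk_polyEv _ _ _ _ pullback.condition]
  convert! Category.id_comp τ
  apply pullback.hom_ext <;> simp

theorem polyMk_injective {T : E} (a : T ⟶ A) {τ τ' : pullback a f ⟶ X}
    (h : polyMk a τ = polyMk a τ') : τ = τ' := by
  rw [← polyMk_ev a τ, ← polyMk_ev a τ']
  simp only [h]

theorem polyMk_eta {T : E} (z : T ⟶ (poly f).obj X) :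
    polyMk (z ≫ polyRoot f X) (reindex z (polyRoot f X) f ≫ polyEv f X) = z :=
  poly_ext (z ≫ polyRoot f X) (by simp) rfl (polyMk_ev _ _)

theorem comp_polyMk {S T : E} (a : T ⟶ A) (τ : pullback a f ⟶ X) (r : S ⟶ T) :
    r ≫ polyMk a τ = polyMk (r ≫ a) (reindex r a f ≫ τ) := by
  apply poly_ext (r ≫ a) (by simp) (by simp)
  rw [polyMk_ev]
  have := lift_polyMk_polyEv a τ (pullback.fst (r ≫ a) f ≫ r) (pullback.snd _ _)
    (by simp [pullback.condition])
  simp only [Category.assoc] at this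
  exact this

theorem polyMk_map {T X' : E} (a : T ⟶ A) (τ : pullback a f ⟶ X) (g : X ⟶ X') :
    polyMk a τ ≫ (poly f).map g = polyMk a (τ ≫ g) := by
  refine (piLift_map a (starLift (pullback.snd a f) τ) (starLift_hom _ _) ((Over.star B).map g)).trans ?_
  unfold polyMk
  congr 1
  apply star_ext
  · rw [Category.assoc, Over.w, starLift_hom, starLift_hom]
  · rw [Category.assoc, star_map_snd, ← Category.assoc, starLift_snd, starLift_snd]

end PolyElements

/-! ### Definable predicates on generalised elements -/

section Definable

variable {E : Type u} [Category.{v} E]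

/-- Predicates on generalised elements. -/
abbrev ElemPred (X : E) := ∀ ⦃T : E⦄, (T ⟶ X) → Prop

/-- A predicate is definable if it is represented by a subobject. -/
def Definable {X : E} (ψ : ElemPred X) : Prop :=
  ∃ (Z : E) (i : Z ⟶ X), Mono i ∧ ∀ ⦃T : E⦄ (x : T ⟶ X), ψ x ↔ ∃ z : T ⟶ Z, z ≫ i = x

theorem Definable.congr {X : E} {ψ ψ' : ElemPred X} (h : Definable ψ)
    (e : ∀ ⦃T : E⦄ (x : T ⟶ X), ψ' x ↔ ψ x) : Definable ψ' := by
  obtain ⟨Z, i, hi, hz⟩ := h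
  exact ⟨Z, i, hi, fun T x => (e x).trans (hz x)⟩

theorem Definable.precomp {X : E} {ψ : ElemPred X} (h : Definable ψ) {S T : E} (r : S ⟶ T)
    {x : T ⟶ X} (hx : ψ x) : ψ (r ≫ x) := by
  obtain ⟨Z, i, hi, hz⟩ := h
  obtain ⟨z, rfl⟩ := (hz x).1 hx
  exact (hz _).2 ⟨r ≫ z, by simp⟩

theorem Definable.comp [HasPullbacks E] {X Y : E} {ψ : ElemPred X} (h : Definable ψ) (a : Y ⟶ X) :
    Definable (fun _ y => ψ (y ≫ a) : ElemPred Y) := by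
  obtain ⟨Z, i, hi, hz⟩ := h
  refine ⟨pullback a i, pullback.fst a i, inferInstance, fun T y => (hz _).trans ⟨?_, ?_⟩⟩
  · rintro ⟨z, hz⟩
    exact ⟨pullback.lift y z hz.symm, by simp⟩
  · rintro ⟨z, rfl⟩
    exact ⟨z ≫ pullback.snd a i, by simp [pullback.condition]⟩

theorem Definable.eq [HasEqualizers E] {X Y : E} (a b : X ⟶ Y) :
    Definable (fun _ x => x ≫ a = x ≫ b : ElemPred X) := by
  refine ⟨equalizer a b, equalizer.ι a b, inferInstance, fun T x => ⟨?_, ?_⟩⟩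
  · intro h
    exact ⟨equalizer.lift x h, by simp⟩
  · rintro ⟨z, rfl⟩
    rw [Category.assoc, Category.assoc, equalizer.condition]

theorem Definable.and [HasPullbacks E] {X : E} {ψ χ : ElemPred X} (h : Definable ψ)
    (h' : Definable χ) : Definable (fun _ x => ψ x ∧ χ x : ElemPred X) := by
  obtain ⟨Z, i, hi, hz⟩ := h
  obtain ⟨Z', i', hi', hz'⟩ := h'
  refine ⟨pullback i i', pullback.fst i i' ≫ i, mono_comp _ _, fun T x => ⟨?_, ?_⟩⟩
  · rintro ⟨h, h'⟩
    obtain ⟨z, rfl⟩ := (hz x).1 h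
    obtain ⟨z', h'⟩ := (hz' _).1 h'
    exact ⟨pullback.lift z z' h'.symm, by simp⟩
  · rintro ⟨z, rfl⟩
    exact ⟨(hz _).2 ⟨z ≫ pullback.fst i i', by simp⟩,
      (hz' _).2 ⟨z ≫ pullback.snd i i', by simp [pullback.condition]⟩⟩

/-- Definability of the values of partial operations. -/
theorem Definable.op [HasFiniteLimits E] {X Y V D Γ : E} (p : X ⟶ D) (q : Y ⟶ D)
    (m : pullback p q ⟶ V) (a : Γ ⟶ X) (b : Γ ⟶ Y) (c : Γ ⟶ V) :
    Definable (fun _ γ => ∃ w : (γ ≫ a) ≫ p = (γ ≫ b) ≫ q,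
      pullback.lift (γ ≫ a) (γ ≫ b) w ≫ m = γ ≫ c : ElemPred Γ) := by
  -- The locus where the partial operation is defined; the equation is then imposed inside it.
  let e := equalizer.ι (a ≫ p) (b ≫ q)
  have he : (e ≫ a) ≫ p = (e ≫ b) ≫ q := by simpa using equalizer.condition (a ≫ p) (b ≫ q)
  obtain ⟨Z, i, hi, hz⟩ := Definable.eq (pullback.lift (e ≫ a) (e ≫ b) he ≫ m) (e ≫ c)
  have key : ∀ {T : E} (y : T ⟶ _) (w : ((y ≫ e) ≫ a) ≫ p = ((y ≫ e) ≫ b) ≫ q),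
      pullback.lift ((y ≫ e) ≫ a) ((y ≫ e) ≫ b) w =
        y ≫ pullback.lift (e ≫ a) (e ≫ b) he := by
    intro T y w
    apply pullback.hom_ext <;> simp
  refine ⟨Z, i ≫ e, mono_comp _ _, fun T γ => ⟨?_, ?_⟩⟩
  · rintro ⟨w, h⟩
    obtain ⟨y, rfl⟩ : ∃ y, y ≫ e = γ :=
      ⟨equalizer.lift γ (by simpa using w), by simp [e]⟩
    rw [key] at h
    obtain ⟨z, rfl⟩ := (hz y).1 (by simpa using h)
    exact ⟨z, by simp⟩
  · rintro ⟨z, rfl⟩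
    have h := (hz (z ≫ i)).2 ⟨z, rfl⟩
    have w : (((z ≫ i) ≫ e) ≫ a) ≫ p = (((z ≫ i) ≫ e) ≫ b) ≫ q := by
      simp only [Category.assoc] at he ⊢
      rw [he]
    have := key (z ≫ i) w
    simp only [Category.assoc] at this h w
    refine ⟨by simpa using w, ?_⟩
    simp only [Category.assoc]
    rw [this]
    simpa using h

/-- The representing subobject is `Π_f` of the one for `θ`; it is a subobject because elements of
`Π_f` are determined by their values. The quantification over `r` is the Kripke–Joyal clause for a
universal quantifier. -/
theorem Definable.all [HasFiniteLimits E] [LCC E] {X Y : E} (f : Y ⟶ X) {θ : ElemPred Y}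
    (h : Definable θ) :
    Definable (fun T x => ∀ ⦃T' : E⦄ (r : T' ⟶ T) (y : T' ⟶ Y), y ≫ f = r ≫ x → θ y :
      ElemPred X) := by
  obtain ⟨Z, i, hi, hz⟩ := h
  have sub : ∀ {T : E} (x : T ⟶ X) (z z' : T ⟶ ((Pi f).obj (Over.mk i)).left),
      z ≫ ((Pi f).obj (Over.mk i)).hom = x → z' ≫ ((Pi f).obj (Over.mk i)).hom = x → z = z' := by
    intro T x z z' hx hx'
    refine pi_ext x hx hx' ((cancel_mono i).1 ?_)
    have := piEv_hom (f := f) (Y := Over.mk i)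
    dsimp at this
    simp [this]
  refine ⟨((Pi f).obj (Over.mk i)).left, ((Pi f).obj (Over.mk i)).hom,
    ⟨fun z z' e => sub _ z z' rfl e.symm⟩, fun T x => ⟨?_, ?_⟩⟩
  · intro hx
    obtain ⟨k, hk⟩ := (hz _).1 (hx (pullback.fst x f) (pullback.snd x f) pullback.condition.symm)
    exact ⟨piLift (Y := Over.mk i) x k hk, piLift_hom _ _ _⟩
  · rintro ⟨z, rfl⟩ T' r y hy
    refine (hz y).2 ⟨pullback.lift (r ≫ z) y (by simp [hy]) ≫ piEv f (Over.mk i), ?_⟩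
    have := piEv_hom (f := f) (Y := Over.mk i)
    dsimp at this
    simp [this]

/-- The representing subobject is the image along `f`. Witnesses exist only after passing to a
cover, and orthogonality of covers and monomorphisms brings membership in the image back down. -/
theorem Definable.ex [Regular E] {X Y : E} (f : Y ⟶ X) {θ : ElemPred Y} (h : Definable θ) :
    Definable (fun T x => ∃ (T' : E) (r : T' ⟶ T) (y : T' ⟶ Y), IsCover r ∧ y ≫ f = r ≫ x ∧ θ y :
      ElemPred X) := by
  obtain ⟨Z, i, hi, hz⟩ := h
  obtain ⟨J, e, j, he, hj, hej⟩ := exists_image (i ≫ f)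
  refine ⟨J, j, hj, fun T x => ⟨?_, ?_⟩⟩
  · rintro ⟨T', r, y, hr, hy, hθ⟩
    obtain ⟨z, rfl⟩ := (hz y).1 hθ
    exact hr.exists_lift (z := z ≫ e) (by simpa [hej] using hy)
  · rintro ⟨z, rfl⟩
    refine ⟨pullback z e, pullback.fst z e, pullback.snd z e ≫ i, he.pullback_fst z, ?_,
      (hz _).2 ⟨_, rfl⟩⟩
    rw [Category.assoc, ← hej, ← Category.assoc, ← pullback.condition, Category.assoc]

/-- If the witness is unique, the composite to `X` is already a monomorphism; no image is needed,
and the witness exists at the given stage. -/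
theorem Definable.exUnique [HasPullbacks E] {X Y : E} (f : Y ⟶ X) {θ : ElemPred Y}
    (h : Definable θ)
    (hu : ∀ ⦃T : E⦄ (y y' : T ⟶ Y), θ y → θ y' → y ≫ f = y' ≫ f → y = y') :
    Definable (fun T x => ∃ y : T ⟶ Y, y ≫ f = x ∧ θ y : ElemPred X) := by
  obtain ⟨Z, i, hi, hz⟩ := h
  refine ⟨Z, i ≫ f, ⟨fun z z' e => ?_⟩, fun T x => ⟨?_, ?_⟩⟩
  · exact (cancel_mono i).1 (hu _ _ ((hz _).2 ⟨_, rfl⟩) ((hz _).2 ⟨_, rfl⟩) (by simpa using e))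
  · rintro ⟨y, rfl, hθ⟩
    obtain ⟨z, rfl⟩ := (hz y).1 hθ
    exact ⟨z, by simp⟩
  · rintro ⟨z, rfl⟩
    exact ⟨z ≫ i, by simp, (hz _).2 ⟨z, rfl⟩⟩

/-- An implication is a universal quantification along the inclusion of the subobject of its
premise. -/
theorem Definable.imp [HasFiniteLimits E] [LCC E] {X : E} {θ χ : ElemPred X} (h : Definable θ)
    (h' : Definable χ) :
    Definable (fun T x => ∀ ⦃T' : E⦄ (r : T' ⟶ T), θ (r ≫ x) → χ (r ≫ x) : ElemPred X) := by
  obtain ⟨Z, i, hi, hz⟩ := h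
  refine (Definable.all i (h'.comp i)).congr fun T x => ⟨?_, ?_⟩
  · intro H T' r z hzx
    rw [hzx]
    exact H r ((hz _).2 ⟨z, hzx⟩)
  · intro H T' r hθ
    obtain ⟨z, hzx⟩ := (hz _).1 hθ
    rw [← hzx]
    exact H r z hzx

end Definable

theorem lift_fst_snd_comp {E : Type u} [Category.{v} E] [HasPullbacks E] {X Y Z V : E} {f : X ⟶ Z}
    {g : Y ⟶ Z} (k : pullback f g ⟶ V) (w : pullback.fst f g ≫ f = pullback.snd f g ≫ g) :
    pullback.lift (pullback.fst f g) (pullback.snd f g) w ≫ k = k := by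
  have e : pullback.lift (pullback.fst f g) (pullback.snd f g) w = 𝟙 _ := by
    apply pullback.hom_ext <;> simp
  rw [e, Category.id_comp]

/-! ### W-types -/

section WType

variable {E : Type u} [Category.{v} E] [HasFiniteLimits E] [LCC E]

section

variable {A B : E} {f : B ⟶ A} {X : E}

theorem polyMk_congr {T : E} {a a' : T ⟶ A} (h : a = a') (τ : pullback a f ⟶ X)
    (τ' : pullback a' f ⟶ X)
    (hτ : ∀ {S : E} (r : S ⟶ T) (b : S ⟶ B) (w : r ≫ a = b ≫ f),
      pullback.lift r b w ≫ τ = pullback.lift r b (by rw [← h, w]) ≫ τ') :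
    polyMk a τ = polyMk a' τ' := by
  subst h
  congr 1
  have := hτ (pullback.fst a f) (pullback.snd a f) pullback.condition
  have e : pullback.lift (pullback.fst a f) (pullback.snd a f) pullback.condition = 𝟙 _ := by
    apply pullback.hom_ext <;> simp
  simpa [e] using this

theorem exists_eq_polyMk {T : E} (z : T ⟶ (poly f).obj X) :
    ∃ (a : T ⟶ A) (τ : pullback a f ⟶ X), z = polyMk a τ :=
  ⟨_, _, (polyMk_eta z).symm⟩

variable {𝒲 : Endofunctor.Algebra (poly f)} (h : IsInitial 𝒲)
include h

theorem WType.exists_rec {X : E} (x : (poly f).obj X ⟶ X) :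
    ∃ g : 𝒲.a ⟶ X, ∀ ⦃T : E⦄ (a : T ⟶ A) (τ : pullback a f ⟶ 𝒲.a),
      polyMk a τ ≫ 𝒲.str ≫ g = polyMk a (τ ≫ g) ≫ x := by
  refine ⟨(h.to ⟨X, x⟩).f, fun T a τ => ?_⟩
  have := (h.to ⟨X, x⟩).h
  rw [← this, ← Category.assoc, polyMk_map]

theorem WType.cases {T : E} (w : T ⟶ 𝒲.a) :
    ∃ (a : T ⟶ A) (τ : pullback a f ⟶ 𝒲.a), w = polyMk a τ ≫ 𝒲.str := by
  have := Endofunctor.Algebra.Initial.str_isIso h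
  obtain ⟨a, τ, e⟩ := exists_eq_polyMk (w ≫ inv 𝒲.str)
  exact ⟨a, τ, by rw [← e]; simp⟩

theorem WType.str_injective {T : E} {z z' : T ⟶ (poly f).obj 𝒲.a} (e : z ≫ 𝒲.str = z' ≫ 𝒲.str) :
    z = z' := by
  have := Endofunctor.Algebra.Initial.str_isIso h
  exact (cancel_mono 𝒲.str).1 e

/-- Dependent elimination. -/
theorem WType.exists_section {H : E} (π : H ⟶ 𝒲.a) (step : (poly f).obj H ⟶ H)
    (w : step ≫ π = (poly f).map π ≫ 𝒲.str) :
    ∃ σ : 𝒲.a ⟶ H, σ ≫ π = 𝟙 _ ∧ 𝒲.str ≫ σ = (poly f).map σ ≫ step := by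
  let p : (⟨H, step⟩ : Endofunctor.Algebra (poly f)) ⟶ 𝒲 := ⟨π, w.symm⟩
  refine ⟨(h.to ⟨H, step⟩).f, ?_, (h.to ⟨H, step⟩).h.symm⟩
  exact congrArg (fun t => t.f) (h.hom_ext (h.to _ ≫ p) (𝟙 _))

/-- The subobject representing `ψ` carries an algebra structure, and by initiality its inclusion has
a section. In `step`, `ψ τ` at the stage `pullback a f` says that all subtrees satisfy `ψ`. -/
theorem WType.induction {ψ : ElemPred 𝒲.a} (hψ : Definable ψ)
    (step : ∀ ⦃T : E⦄ (a : T ⟶ A) (τ : pullback a f ⟶ 𝒲.a), ψ τ → ψ (polyMk a τ ≫ 𝒲.str))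
    {T : E} (w : T ⟶ 𝒲.a) : ψ w := by
  obtain ⟨Z, i, hi, hz⟩ := hψ
  -- The generic node all of whose subtrees satisfy `ψ`.
  obtain ⟨a, τ, e⟩ := exists_eq_polyMk (𝟙 ((poly f).obj Z))
  have e' : (poly f).map i = polyMk a (τ ≫ i) := by
    rw [← polyMk_map, ← e, Category.id_comp]
  obtain ⟨z, hz'⟩ := (hz _).1 (step a (τ ≫ i) ((hz _).2 ⟨τ, rfl⟩))
  obtain ⟨σ, hσ, -⟩ := WType.exists_section h i z (by rw [hz', e'])
  exact (hz w).2 ⟨w ≫ σ, by rw [Category.assoc, hσ, Category.comp_id]⟩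

end

/-! ### Dependent W-types -/

section Exponential

variable {I X : E}

variable (I X) in
/-- The exponential `X ^ I`. -/
abbrev expObj : E := (poly (terminal.from I)).obj X

def expApp {T : E} (e : T ⟶ expObj I X) (i : T ⟶ I) : T ⟶ X :=
  pullback.lift e i (Subsingleton.elim _ _) ≫ polyEv (terminal.from I) X

def expLam {T : E} (k : pullback (terminal.from T) (terminal.from I) ⟶ X) : T ⟶ expObj I X :=
  polyMk (terminal.from T) k

theorem expApp_expLam {S T : E} (k : pullback (terminal.from T) (terminal.from I) ⟶ X)
    (r : S ⟶ T) (i : S ⟶ I) :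
    expApp (r ≫ expLam k) i = pullback.lift r i (Subsingleton.elim _ _) ≫ k :=
  lift_polyMk_polyEv (terminal.from T) k r i (Subsingleton.elim _ _)

theorem comp_expApp {S T : E} (r : S ⟶ T) (e : T ⟶ expObj I X) (i : T ⟶ I) :
    r ≫ expApp e i = expApp (r ≫ e) (r ≫ i) := by
  simp only [expApp]
  rw [← Category.assoc, comp_lift]

end Exponential

section DepW

variable {I A B : E} (f : B ⟶ A)

variable (I) in
/-- The map with fibre `B_a` over `(a, i)`. -/
abbrev decorated : pullback (prod.fst : A ⨯ I ⟶ A) f ⟶ A ⨯ I := pullback.fst _ _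

variable {f} {X : E}

/-- The arity of `(a, i)` is that of `a`; the pullback map identifies the two fibres. -/
def polyMk₂ {T : E} (a : T ⟶ A) (i : T ⟶ I) (τ : pullback a f ⟶ X) :
    T ⟶ (poly (decorated I f)).obj X :=
  polyMk (prod.lift a i) (pullback.lift (pullback.fst _ _) (pullback.snd _ _ ≫ pullback.snd _ _)
    (by rw [Category.assoc, ← pullback.condition (f := (prod.fst : A ⨯ I ⟶ A)) (g := f),
      ← Category.assoc, ← pullback.condition, Category.assoc, prod.lift_fst]) ≫ τ)

theorem polyMk₂_root {T : E} (a : T ⟶ A) (i : T ⟶ I) (τ : pullback a f ⟶ X) :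
    polyMk₂ a i τ ≫ polyRoot _ _ = prod.lift a i :=
  polyMk_root _ _

theorem polyMk₂_injective {T : E} (a : T ⟶ A) (i : T ⟶ I) {τ τ' : pullback a f ⟶ X}
    (h : polyMk₂ a i τ = polyMk₂ a i τ') : τ = τ' := by
  have h := polyMk_injective _ h
  have w : pullback.fst a f ≫ prod.lift a i =
      pullback.lift (pullback.fst a f ≫ prod.lift a i) (pullback.snd a f)
        (by rw [Category.assoc, prod.lift_fst, pullback.condition]) ≫ decorated I f := by simp
  have := congrArg (fun k => pullback.lift (pullback.fst a f) _ w ≫ k) h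
  simp only [← Category.assoc, comp_lift] at this
  have e : ∀ w', pullback.lift (f := a) (g := f) (pullback.fst a f) (pullback.snd a f) w' = 𝟙 _ := by
    intro w'
    apply pullback.hom_ext <;> simp
  simpa [e] using this

theorem polyMk₂_congr {T : E} {a a' : T ⟶ A} {i i' : T ⟶ I} (h : a = a') (hi : i = i')
    (τ : pullback a f ⟶ X) (τ' : pullback a' f ⟶ X)
    (hτ : pullback.lift (pullback.fst a f) (pullback.snd a f)
      (by rw [← h, pullback.condition]) ≫ τ' = τ) :
    polyMk₂ a i τ = polyMk₂ a' i' τ' := by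
  subst h hi hτ
  congr 1
  rw [lift_fst_snd_comp]

theorem comp_polyMk₂ {S T : E} (a : T ⟶ A) (i : T ⟶ I) (τ : pullback a f ⟶ X) (r : S ⟶ T) :
    r ≫ polyMk₂ a i τ = polyMk₂ (r ≫ a) (r ≫ i) (reindex r a f ≫ τ) := by
  unfold polyMk₂
  rw [comp_polyMk]
  apply polyMk_congr
  rotate_left
  · apply Limits.prod.hom_ext <;> simp [prod.lift_fst, prod.lift_snd]
  · intro S r' b w
    simp only [← Category.assoc]
    congr 1
    apply pullback.hom_ext <;> simp

theorem polyMk_comp_polyMk₂ {T : E} (a : T ⟶ A) (τ : pullback a f ⟶ X) (j : (poly f).obj X ⟶ I) :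
    polyMk a τ ≫ polyMk₂ (polyRoot f X) j (polyEv f X) = polyMk₂ a (polyMk a τ ≫ j) τ := by
  rw [comp_polyMk₂]
  refine polyMk₂_congr (by simp) rfl _ _ ?_
  exact (lift_polyMk_polyEv a τ (pullback.fst _ _) (pullback.snd _ _)
    (by rw [← pullback.condition, polyMk_root])).symm

variable {𝒲 : Endofunctor.Algebra (poly f)} (h : IsInitial 𝒲)
  {𝒱 : Endofunctor.Algebra (poly (decorated I f))}
include h

/-- This decoration labels each node with the index that the node has. -/
theorem WType.exists_decoration (t : A ⟶ I) : ∃ α : 𝒲.a ⟶ 𝒱.a,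
    ∀ ⦃T : E⦄ (a : T ⟶ A) (τ : pullback a f ⟶ 𝒲.a),
      polyMk a τ ≫ 𝒲.str ≫ α = polyMk₂ a (a ≫ t) (τ ≫ α) ≫ 𝒱.str := by
  obtain ⟨α, hα⟩ := WType.exists_rec h
    (polyMk₂ (polyRoot f 𝒱.a) (polyRoot f 𝒱.a ≫ t) (polyEv f 𝒱.a) ≫ 𝒱.str)
  refine ⟨α, fun T a τ => ?_⟩
  rw [hα, ← Category.assoc, polyMk_comp_polyMk₂, polyMk_root_assoc]

/-- This decoration labels each node with the index that its parent demands. The demand comes from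
above while recursion proceeds from below, hence the values in an exponential: the label of the root
is an argument. -/
theorem WType.exists_prescribed_decoration (s : B ⟶ I) : ∃ β : 𝒲.a ⟶ expObj I 𝒱.a,
    ∀ ⦃T : E⦄ (a : T ⟶ A) (τ : pullback a f ⟶ 𝒲.a) (i : T ⟶ I),
      expApp (polyMk a τ ≫ 𝒲.str ≫ β) i =
        polyMk₂ a i (expApp (τ ≫ β) (pullback.snd _ _ ≫ s)) ≫ 𝒱.str := by
  obtain ⟨β, hβ⟩ := WType.exists_rec h (expLam
    (polyMk₂ (pullback.fst (terminal.from ((poly f).obj (expObj I 𝒱.a))) (terminal.from I) ≫ polyRoot f (expObj I 𝒱.a))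
      (pullback.snd (terminal.from ((poly f).obj (expObj I 𝒱.a))) (terminal.from I))
      (expApp (reindex _ (polyRoot f (expObj I 𝒱.a)) f ≫ polyEv f _) (pullback.snd _ _ ≫ s)) ≫
        𝒱.str))
  refine ⟨β, fun T a τ i => ?_⟩
  rw [hβ, expApp_expLam, ← Category.assoc, comp_polyMk₂]
  congr 1
  refine polyMk₂_congr (by simp) (by simp) _ _ ?_
  rw [comp_expApp, comp_expApp]
  congr 1
  · rw [← lift_polyMk_polyEv a (τ ≫ β) _ _ (by rw [← pullback.condition]; simp)]
    simp only [← Category.assoc]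
    congr 1
    apply pullback.hom_ext <;> simp
  · simp

/-- The subobject of trees whose indices match. -/
theorem WType.exists_wellIndexed (h' : IsInitial 𝒱) (s : B ⟶ I) (t : A ⟶ I) :
    ∃ (Z : E) (ι : Z ⟶ 𝒲.a) (rt : 𝒲.a ⟶ I), Mono ι ∧
      (∀ ⦃T : E⦄ (a : T ⟶ A) (τ : pullback a f ⟶ 𝒲.a), polyMk a τ ≫ 𝒲.str ≫ rt = a ≫ t) ∧
      ∀ ⦃T : E⦄ (a : T ⟶ A) (τ : pullback a f ⟶ 𝒲.a),
        (∃ z : T ⟶ Z, z ≫ ι = polyMk a τ ≫ 𝒲.str) ↔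
          ∃ y : pullback a f ⟶ Z, y ≫ ι = τ ∧ y ≫ ι ≫ rt = pullback.snd _ _ ≫ s := by
  have := Endofunctor.Algebra.Initial.str_isIso h
  obtain ⟨α, hα⟩ := WType.exists_decoration h (𝒱 := 𝒱) t
  obtain ⟨β, hβ⟩ := WType.exists_prescribed_decoration h (𝒱 := 𝒱) s
  let rt : 𝒲.a ⟶ I := inv 𝒲.str ≫ polyRoot f 𝒲.a ≫ t
  have hrt : ∀ ⦃T : E⦄ (a : T ⟶ A) (τ : pullback a f ⟶ 𝒲.a),
      polyMk a τ ≫ 𝒲.str ≫ rt = a ≫ t := fun T a τ => by simp [rt]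
  -- A tree is well-indexed when the two decorations agree, the root being given its own index. This
  -- makes the hereditary condition a single equation.
  have good : ∀ {T : E} (w : T ⟶ 𝒲.a), (∃ z : T ⟶ equalizer α (expApp β rt),
      z ≫ equalizer.ι α (expApp β rt) = w) ↔ w ≫ α = expApp (w ≫ β) (w ≫ rt) := by
    intro T w
    constructor
    · rintro ⟨z, rfl⟩
      rw [Category.assoc, equalizer.condition, comp_expApp, comp_expApp]
      simp
    · intro e
      exact ⟨equalizer.lift w (by rw [e, comp_expApp]), equalizer.lift_ι _ _⟩
  -- Agreement of the decorations includes agreement of the labels at the root.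
  have idx : ∀ {T : E} (w : T ⟶ 𝒲.a) (i : T ⟶ I), w ≫ α = expApp (w ≫ β) i → w ≫ rt = i := by
    intro T w i e
    obtain ⟨a, τ, rfl⟩ := WType.cases h w
    simp only [Category.assoc] at e ⊢
    rw [hα, hβ] at e
    have := congrArg (fun k => k ≫ polyRoot _ _ ≫ prod.snd) (WType.str_injective h' e)
    simp only [← Category.assoc, polyMk₂_root, prod.lift_snd] at this
    rw [hrt, this]
  refine ⟨equalizer α (expApp β rt), equalizer.ι _ _, rt, inferInstance, hrt, fun T a τ => ?_⟩
  rw [good]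
  simp only [Category.assoc]
  rw [hα, hβ, hrt]
  constructor
  · intro e
    have e := polyMk₂_injective _ _ (WType.str_injective h' e)
    have i := idx _ _ e
    rw [← i] at e
    obtain ⟨y, rfl⟩ := (good τ).2 e
    exact ⟨y, rfl, by simpa using i⟩
  · rintro ⟨y, rfl, hy⟩
    have e := (good _).1 ⟨y, rfl⟩
    rw [e, ← hy, ← Category.assoc y]

end DepW

end WType

/-! ### Initial algebras of dependent polynomial functors -/

section DepInitial

variable {E : Type u} [Category.{v} E] [HasFiniteLimits E] [LCC E] {I A B : E} {f : B ⟶ A}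
  {s : B ⟶ I} {t : A ⟶ I}

theorem secMk_congr {X : Over I} {T : E} {a a' : T ⟶ A} (h : a = a') (k : pullback a f ⟶ X.left)
    (hk : k ≫ X.hom = pullback.snd a f ≫ s) (k' : pullback a' f ⟶ X.left)
    (hk' : k' ≫ X.hom = pullback.snd a' f ≫ s)
    (e : pullback.lift (pullback.fst a f) (pullback.snd a f)
      (by rw [← h, pullback.condition]) ≫ k' = k) :
    secMk a k hk = secMk a' k' hk' := by
  subst h e
  congr 1
  rw [lift_fst_snd_comp]

theorem secApp_congr {X : Over I} {T : E} {z z' : T ⟶ (secObj f s X).left} {b b' : T ⟶ B}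
    (h : z = z') (h' : b = b') (w : z ≫ (secObj f s X).hom = b ≫ f)
    (w' : z' ≫ (secObj f s X).hom = b' ≫ f) : secApp z b w = secApp z' b' w' := by
  subst h h'; rfl

/-- Forgetting indices. -/
def secToPoly (f : B ⟶ A) (s : B ⟶ I) (X : Over I) : (secObj f s X).left ⟶ (poly f).obj X.left :=
  polyMk (secObj f s X).hom (secEv f s X)

theorem secMk_toPoly {X : Over I} {T : E} (a : T ⟶ A) (k : pullback a f ⟶ X.left)
    (hk : k ≫ X.hom = pullback.snd a f ≫ s) :
    secMk a k hk ≫ secToPoly f s X = polyMk a k := by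
  rw [secToPoly, comp_polyMk]
  refine polyMk_congr (by simp) _ _ fun r b w => ?_
  have := secApp_secMk a k hk r b (by simpa using w)
  rw [← this, ← Category.assoc]
  simp only [secApp]
  congr 1
  apply pullback.hom_ext <;> simp

/-- The structure map of an algebra for a dependent polynomial functor. -/
def depStr (X : Endofunctor.Algebra (depPoly s f t)) : (secObj f s X.a).left ⟶ X.a.left :=
  X.str.left

theorem depStr_hom (X : Endofunctor.Algebra (depPoly s f t)) :
    depStr X ≫ X.a.hom = (secObj f s X.a).hom ≫ t :=
  Over.w X.str

theorem map_depStr {X Y : Endofunctor.Algebra (depPoly s f t)} (g : X ⟶ Y) :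
    ((Pi f).map ((Over.pullback s).map g.f)).left ≫ depStr Y = depStr X ≫ g.f.left :=
  congrArg (fun m => m.left) g.h

variable {𝒲 : Endofunctor.Algebra (poly f)} (h : IsInitial 𝒲) {Z : E}
    (ι : Z ⟶ 𝒲.a) (rt : 𝒲.a ⟶ I)
    (hrt : ∀ ⦃T : E⦄ (a : T ⟶ A) (τ : pullback a f ⟶ 𝒲.a), polyMk a τ ≫ 𝒲.str ≫ rt = a ≫ t)
    (hι : ∀ ⦃T : E⦄ (a : T ⟶ A) (τ : pullback a f ⟶ 𝒲.a),
      (∃ z : T ⟶ Z, z ≫ ι = polyMk a τ ≫ 𝒲.str) ↔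
        ∃ y : pullback a f ⟶ Z, y ≫ ι = τ ∧ y ≫ ι ≫ rt = pullback.snd _ _ ≫ s)

include hι in
theorem exists_wellIndexed_str :
    ∃ mo : (secObj f s (Over.mk (ι ≫ rt))).left ⟶ Z, ∀ ⦃T : E⦄ (a : T ⟶ A)
      (k : pullback a f ⟶ Z) (hk : k ≫ ι ≫ rt = pullback.snd a f ≫ s),
      secMk (X := Over.mk (ι ≫ rt)) a k hk ≫ mo ≫ ι = polyMk a (k ≫ ι) ≫ 𝒲.str := by
  obtain ⟨mo, e⟩ := (hι (secObj f s (Over.mk (ι ≫ rt))).hom (secEv f s (Over.mk (ι ≫ rt)) ≫ ι)).2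
    ⟨secEv f s (Over.mk (ι ≫ rt)), rfl, secEv_hom⟩
  refine ⟨mo, fun T a k hk => ?_⟩
  have := secMk_toPoly (X := Over.mk (ι ≫ rt)) a k hk
  rw [e, ← polyMk_map, ← polyMk_map, ← this]
  simp only [Category.assoc]
  rfl

variable (mo : (secObj f s (Over.mk (ι ≫ rt))).left ⟶ Z)
  (hmo : ∀ ⦃T : E⦄ (a : T ⟶ A) (k : pullback a f ⟶ Z) (hk : k ≫ ι ≫ rt = pullback.snd a f ≫ s),
      secMk (X := Over.mk (ι ≫ rt)) a k hk ≫ mo ≫ ι = polyMk a (k ≫ ι) ≫ 𝒲.str)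

include hrt hmo in
theorem wellIndexed_str_hom : mo ≫ ι ≫ rt = (secObj f s (Over.mk (ι ≫ rt))).hom ≫ t := by
  obtain ⟨a, k, hk, e⟩ := exists_eq_secMk (𝟙 (secObj f s (Over.mk (ι ≫ rt))).left)
  rw [← Category.id_comp mo, e, Category.assoc, ← Category.assoc mo, ← Category.assoc, hmo,
    Category.assoc, hrt, ← Category.id_comp (secObj f s (Over.mk (ι ≫ rt))).hom, e, secMk_hom]

variable [Mono ι]

include h hι hmo in
-- Induction over all trees `w`, for the definable statement that `g₁` and `g₂` agree at every
-- well-indexed `z` lying over `w`.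
theorem wellIndexed_hom_ext {X : Over I} (x : (secObj f s X).left ⟶ X.left) {g₁ g₂ : Z ⟶ X.left}
    (hg₁ : g₁ ≫ X.hom = ι ≫ rt) (hg₂ : g₂ ≫ X.hom = ι ≫ rt)
    (e₁ : ∀ {T : E} (a : T ⟶ A) (k : pullback a f ⟶ Z) (hk : k ≫ ι ≫ rt = pullback.snd a f ≫ s),
        secMk (X := Over.mk (ι ≫ rt)) a k hk ≫ mo ≫ g₁ =
          secMk (X := X) a (k ≫ g₁) (by rw [Category.assoc, hg₁, hk]) ≫ x)
    (e₂ : ∀ {T : E} (a : T ⟶ A) (k : pullback a f ⟶ Z) (hk : k ≫ ι ≫ rt = pullback.snd a f ≫ s),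
        secMk (X := Over.mk (ι ≫ rt)) a k hk ≫ mo ≫ g₂ =
          secMk (X := X) a (k ≫ g₂) (by rw [Category.assoc, hg₂, hk]) ≫ x) : g₁ = g₂ := by
  have ind : ∀ {T : E} (w : T ⟶ 𝒲.a) ⦃T' : E⦄ (r : T' ⟶ T) (z : T' ⟶ Z), z ≫ ι = r ≫ w →
      z ≫ g₁ = z ≫ g₂ := by
    intro T w
    refine WType.induction h ((Definable.eq g₁ g₂).all ι) ?_ w
    intro T a τ ih T' r z hz
    rw [← Category.assoc, comp_polyMk] at hz
    obtain ⟨y, hy, hy'⟩ := (hι _ _).1 ⟨z, hz⟩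
    have hzy : z = secMk (X := Over.mk (ι ≫ rt)) (r ≫ a) y hy' ≫ mo := by
      rw [← cancel_mono ι, hz, Category.assoc, hmo, hy]
    have hg := ih _ _ hy
    rw [hzy, Category.assoc, Category.assoc, e₁, e₂]
    congr 1
    exact secMk_congr rfl _ _ _ _ (by rw [lift_fst_snd_comp, hg])
  simpa using ind ι (𝟙 _) (𝟙 _) rfl

include h hrt hι hmo in
-- Recursion is available for all trees, not for the well-indexed ones. So to a tree `w` is assigned
-- a function from the well-indexed `z` over `w` to values in `X`; for an ill-indexed `w` this is
-- the empty function.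
theorem wellIndexed_exists_rec {X : Over I} (x : (secObj f s X).left ⟶ X.left)
    (hx : x ≫ X.hom = (secObj f s X).hom ≫ t) :
    ∃ (g : Z ⟶ X.left) (hg : g ≫ X.hom = ι ≫ rt),
      ∀ {T : E} (a : T ⟶ A) (k : pullback a f ⟶ Z) (hk : k ≫ ι ≫ rt = pullback.snd a f ≫ s),
        secMk (X := Over.mk (ι ≫ rt)) a k hk ≫ mo ≫ g =
          secMk (X := X) a (k ≫ g) (by rw [Category.assoc, hg, hk]) ≫ x := by
  let H := secObj ι (ι ≫ rt) X
  let P := (poly f).obj H.left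
  let w₀ : P ⟶ 𝒲.a := polyMk (polyRoot f H.left) (polyEv f H.left ≫ H.hom) ≫ 𝒲.str
  -- On `pullback w₀ ι` the tree assembled from the base points is well-indexed, hence so are its
  -- subtrees `y`. The functions obtained for the subtrees may therefore be applied to `y`, which
  -- gives `ξ`.
  obtain ⟨y, hy, hy'⟩ := (hι (pullback.fst w₀ ι ≫ polyRoot f H.left)
    (reindex (pullback.fst w₀ ι) _ f ≫ polyEv f H.left ≫ H.hom)).1
    ⟨pullback.snd w₀ ι, by rw [← comp_polyMk, ← pullback.condition, Category.assoc]⟩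
  let ξ : pullback (pullback.fst w₀ ι ≫ polyRoot f H.left) f ⟶ X.left :=
    secApp (φ := ι) (s := (ι ≫ rt)) (X := X) (reindex (pullback.fst w₀ ι) _ f ≫ polyEv f H.left) y
      (by rw [Category.assoc]; exact hy.symm)
  have hξ : ξ ≫ X.hom = pullback.snd _ _ ≫ s := (secApp_hom _ _ _).trans hy'
  let x₀ : pullback w₀ ι ⟶ X.left :=
    secMk (pullback.fst w₀ ι ≫ polyRoot f H.left) ξ hξ ≫ x
  have hx₀ : x₀ ≫ X.hom = pullback.snd w₀ ι ≫ (ι ≫ rt) := by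
    have e1 : w₀ ≫ rt = polyRoot f H.left ≫ t := by
      simp only [w₀, Category.assoc]
      exact hrt _ _
    calc x₀ ≫ X.hom = (pullback.fst w₀ ι ≫ polyRoot f H.left) ≫ t := by
          simp only [x₀, Category.assoc, hx, secMk_hom_assoc]
      _ = pullback.fst w₀ ι ≫ w₀ ≫ rt := by rw [Category.assoc, e1]
      _ = _ := by rw [← Category.assoc, pullback.condition, Category.assoc]
  obtain ⟨σ, hσ, hσ'⟩ := WType.exists_section h H.hom (secMk (X := X) w₀ x₀ hx₀) (by
    rw [secMk_hom]
    conv_rhs => rw [← Category.id_comp ((poly f).map H.hom)]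
    obtain ⟨a, τ, e⟩ := exists_eq_polyMk (𝟙 P)
    have e1 : polyMk (polyRoot f H.left) (polyEv f H.left) = 𝟙 P := by
      have := polyMk_eta (𝟙 P)
      rw [← this]
      refine polyMk_congr (by simp) _ _ fun r b w => ?_
      rw [← Category.assoc]
      congr 1
      apply pullback.hom_ext <;> simp
    rw [← e1, polyMk_map])
  have hgw : (ι ≫ σ) ≫ H.hom = 𝟙 Z ≫ ι := by
    rw [Category.assoc, hσ]; simp
  -- The function assigned to the tree `ι z`, evaluated at `z` itself.
  let g : Z ⟶ X.left := secApp (φ := ι) (s := (ι ≫ rt)) (X := X) (ι ≫ σ) (𝟙 Z) hgw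
  have hg : g ≫ X.hom = (ι ≫ rt) := (secApp_hom _ _ _).trans (Category.id_comp _)
  have key : ∀ {T : E} (a : T ⟶ A) (k : pullback a f ⟶ Z)
      (hk : k ≫ ι ≫ rt = pullback.snd a f ≫ s),
      secMk (X := Over.mk (ι ≫ rt)) a k hk ≫ mo ≫ g = secMk (X := X) a (k ≫ g) (by
        rw [Category.assoc, hg, hk]) ≫ x := by
    intro T a k hk
    set m := secMk (X := Over.mk (ι ≫ rt)) a k hk ≫ mo with hm
    have hmι : m ≫ ι = polyMk a (k ≫ ι) ≫ 𝒲.str := by rw [hm, Category.assoc, hmo]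
    have hmσ : m ≫ ι ≫ σ = polyMk a (k ≫ ι ≫ σ) ≫ secMk (X := X) w₀ x₀ hx₀ := by
      rw [← Category.assoc, hmι, Category.assoc, hσ', ← Category.assoc, polyMk_map,
        Category.assoc]
    have hw₀ : polyMk a (k ≫ ι ≫ σ) ≫ w₀ = m ≫ ι := by
      rw [← Category.assoc, comp_polyMk, hmι]
      congr 1
      refine polyMk_congr (by simp) _ _ fun r b w => ?_
      have := lift_polyMk_polyEv a (k ≫ ι ≫ σ) r b (by simpa using w)
      have e2 : pullback.lift r b w ≫ reindex (polyMk a (k ≫ ι ≫ σ)) (polyRoot f H.left) f =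
        pullback.lift (r ≫ polyMk a (k ≫ ι ≫ σ)) b (by simpa using w) := by
        apply pullback.hom_ext <;> simp
      rw [← Category.assoc, e2, ← Category.assoc, this]
      simp [hσ]
    have e1 : m ≫ g = pullback.lift (polyMk a (k ≫ ι ≫ σ)) m hw₀ ≫ x₀ := by
      rw [← secApp_secMk w₀ x₀ hx₀ _ m hw₀, comp_secApp]
      congr 1
      simp
    rw [← Category.assoc]
    refine e1.trans ?_
    simp only [x₀]
    rw [← Category.assoc, comp_secMk]
    congr 1
    refine secMk_congr (by simp) _ _ _ _ ?_
    set q := pullback.lift (polyMk a (k ≫ ι ≫ σ)) m hw₀ with hq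
    have hb : q ≫ pullback.fst w₀ ι ≫ polyRoot f H.left = a := by simp [hq]
    have e3 : reindex q (pullback.fst w₀ ι ≫ polyRoot f H.left) f ≫
        reindex (pullback.fst w₀ ι) (polyRoot f H.left) f ≫ polyEv f H.left =
        pullback.lift (pullback.fst _ f) (pullback.snd _ f)
          (by rw [← hb, pullback.condition]) ≫ k ≫ ι ≫ σ := by
      rw [← lift_polyMk_polyEv a (k ≫ ι ≫ σ) _ _ (by rw [← hb, pullback.condition])]
      simp only [← Category.assoc]
      congr 1
      apply pullback.hom_ext <;> simp [hq]
    -- The subtrees `y` are the given ones `k`, since `ι` is monic and both have the same underlying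
    -- trees.
    have e4 : reindex q (pullback.fst w₀ ι ≫ polyRoot f H.left) f ≫ y =
        pullback.lift (pullback.fst _ f) (pullback.snd _ f)
          (by rw [← hb, pullback.condition]) ≫ k := by
      have := congrArg (fun m => m ≫ H.hom) e3
      simp only [Category.assoc, hσ] at this
      rw [← cancel_mono ι, Category.assoc, hy, this]
      simp
    refine (?_ : _ = secApp (φ := ι) (s := ι ≫ rt) (X := X) _ _ (by
      rw [← e3, ← e4]; simp only [Category.assoc, hy]; rfl)).trans
      ((secApp_congr e3 e4 _ _).symm.trans (comp_secApp _ _ _ _).symm)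
    simp only [g, comp_secApp, Category.assoc]
    exact secApp_congr rfl (by simp only [Category.assoc, Category.comp_id]; rfl) _ _
  exact ⟨g, hg, key⟩

include h hrt hι in
/-- Dependent polynomial endofunctors have initial algebras if the underlying nondependent ones
do. -/
theorem hasInitial_depPoly_aux : HasInitial (Endofunctor.Algebra (depPoly s f t)) := by
  obtain ⟨mo, hmo⟩ := exists_wellIndexed_str ι rt hι
  have hmo' := wellIndexed_str_hom ι rt hrt mo hmo
  let D : Over I := Over.mk (ι ≫ rt)
  let str : (depPoly s f t).obj D ⟶ D := Over.homMk mo hmo'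
  have comp : ∀ {X : Endofunctor.Algebra (depPoly s f t)}
      (g : (⟨D, str⟩ : Endofunctor.Algebra (depPoly s f t)) ⟶ X) {T : E} (a : T ⟶ A)
      (k : pullback a f ⟶ Z) (hk : k ≫ ι ≫ rt = pullback.snd a f ≫ s),
      secMk (X := D) a k hk ≫ mo ≫ g.f.left =
        secMk (X := X.a) a (k ≫ g.f.left) ((Category.assoc _ _ _).trans
          ((congrArg (fun m => k ≫ m) (Over.w g.f)).trans hk)) ≫ depStr X := by
    intro X g T a k hk
    have h1 : ((Pi f).map ((Over.pullback s).map g.f)).left ≫ depStr X = mo ≫ g.f.left :=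
      map_depStr g
    rw [← h1, ← Category.assoc]
    exact congrArg (fun m => m ≫ depStr X) (secMk_map a k hk g.f)
  have hex : ∀ X : Endofunctor.Algebra (depPoly s f t),
      Nonempty ((⟨D, str⟩ : Endofunctor.Algebra (depPoly s f t)) ⟶ X) := by
    intro X
    obtain ⟨g, hg, key⟩ := wellIndexed_exists_rec h ι rt hrt hι mo hmo (depStr X) (depStr_hom X)
    refine ⟨⟨Over.homMk g hg, ?_⟩⟩
    ext
    obtain ⟨a, k, hk, e⟩ := exists_eq_secMk (𝟙 (secObj f s D).left)
    change ((Pi f).map ((Over.pullback s).map (Over.homMk g hg))).left ≫ depStr X = mo ≫ g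
    have e2 := key a k hk
    rw [← e, Category.id_comp] at e2
    rw [e2]
    congr 1
    refine Eq.trans ?_ (secMk_map a k hk (Over.homMk g hg))
    rw [← e]
    exact (Category.id_comp _).symm
  exact IsInitial.hasInitial (X := ⟨D, str⟩) (IsInitial.ofUniqueHom (fun X => (hex X).some)
    fun X m => by
      ext
      exact wellIndexed_hom_ext h ι rt hι mo hmo (depStr X) (Over.w m.f) (Over.w _)
        (comp m) (comp _))

theorem hasInitial_depPoly {E : Type u} [Category.{v} E] [PiWPretopos E] {I A B : E} (s : B ⟶ I)
    (f : B ⟶ A) (t : A ⟶ I) : HasInitial (Endofunctor.Algebra (depPoly s f t)) := by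
  have := PiWPretopos.hasWTypes f
  have := PiWPretopos.hasWTypes (decorated I f)
  obtain ⟨Z, ι, rt, hι, hrt, hgood⟩ := WType.exists_wellIndexed
    (initialIsInitial (C := Endofunctor.Algebra (poly f)))
    (initialIsInitial (C := Endofunctor.Algebra (poly (decorated I f)))) s t
  exact hasInitial_depPoly_aux initialIsInitial ι rt hrt hgood

end DepInitial

/-! ### Dependent polynomial functors with an additional nullary constructor -/

section Sum

variable {E : Type u} [Category.{v} E]

theorem vanKampen_of_isIso [FinitaryExtensive E] {X Y Z : E} (a : X ⟶ Z) (b : Y ⟶ Z)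
    [IsIso (coprod.desc a b)] : IsVanKampenColimit (BinaryCofan.mk a b) := by
  refine FinitaryExtensive.vanKampen _ ?_
  let e : X ⨿ Y ≅ Z := asIso (coprod.desc a b)
  refine IsColimit.ofIsoColimit (coprodIsCoprod X Y) (Cocone.ext e ?_)
  rintro ⟨⟨⟩⟩
  · exact coprod.inl_desc _ _
  · exact coprod.inr_desc _ _

/-- One half of the van Kampen property: a map between coproducts that respects the summands
restricts to them by pullback. -/
theorem isPullback_of_isIso_desc [FinitaryExtensive E] {X Y Z X' Y' Z' : E} (a : X ⟶ Z) (b : Y ⟶ Z)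
    [IsIso (coprod.desc a b)] (a' : X' ⟶ Z') (b' : Y' ⟶ Z') [IsIso (coprod.desc a' b')]
    (x : X' ⟶ X) (y : Y' ⟶ Y) (z : Z' ⟶ Z) (hx : x ≫ a = a' ≫ z) (hy : y ≫ b = b' ≫ z) :
    IsPullback a' x z a ∧ IsPullback b' y z b := by
  refine ((BinaryCofan.isVanKampen_iff _).1 (vanKampen_of_isIso a b) (BinaryCofan.mk a' b') x y z
    hx hy).1 ⟨?_⟩
  let e : X' ⨿ Y' ≅ Z' := asIso (coprod.desc a' b')
  refine IsColimit.ofIsoColimit (coprodIsCoprod X' Y') (Cocone.ext e ?_)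
  rintro ⟨⟨⟩⟩
  · exact coprod.inl_desc _ _
  · exact coprod.inr_desc _ _

/-- The other half: a coproduct decomposition pulls back to one. -/
theorem isIso_desc_of_isPullback [FinitaryExtensive E] {X Y Z X' Y' Z' : E} (a : X ⟶ Z) (b : Y ⟶ Z)
    [IsIso (coprod.desc a b)] (a' : X' ⟶ Z') (b' : Y' ⟶ Z')
    (x : X' ⟶ X) (y : Y' ⟶ Y) (z : Z' ⟶ Z)
    (h : IsPullback a' x z a) (h' : IsPullback b' y z b) : IsIso (coprod.desc a' b') := by
  obtain ⟨hc⟩ := ((BinaryCofan.isVanKampen_iff _).1 (vanKampen_of_isIso a b) (BinaryCofan.mk a' b')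
    x y z h.w.symm h'.w.symm).2 ⟨h, h'⟩
  let e : X' ⨿ Y' ≅ Z' := (coprodIsCoprod X' Y').coconePointUniqueUpToIso hc
  have : coprod.desc a' b' = e.hom := by
    apply coprod.hom_ext
    · rw [coprod.inl_desc]
      exact ((coprodIsCoprod X' Y').comp_coconePointUniqueUpToIso_hom hc ⟨WalkingPair.left⟩).symm
    · rw [coprod.inr_desc]
      exact ((coprodIsCoprod X' Y').comp_coconePointUniqueUpToIso_hom hc ⟨WalkingPair.right⟩).symm
  rw [this]
  infer_instance

instance isIso_desc_inl_inr [HasBinaryCoproducts E] (X Y : E) :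
    IsIso (coprod.desc (coprod.inl : X ⟶ X ⨿ Y) coprod.inr) := by
  rw [coprod.desc_inl_inr]
  infer_instance

theorem isPullback_initial_inl_inr [FinitaryExtensive E] (X Y : E) :
    IsPullback (initial.to X) (initial.to Y) (coprod.inl : X ⟶ X ⨿ Y) coprod.inr :=
  FinitaryExtensive.isPullback_initial_to_binaryCofan
    (c := BinaryCofan.mk coprod.inl coprod.inr) (coprodIsCoprod X Y)

instance mono_coprod_inr [FinitaryExtensive E] (X Y : E) : Mono (coprod.inr : Y ⟶ X ⨿ Y) :=
  FinitaryExtensive.mono_inr_of_isColimit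
    (c := BinaryCofan.mk coprod.inl coprod.inr) (coprodIsCoprod X Y)

/-- The initial object is strict, so an object mapping to it is itself initial. -/
theorem hom_ext_of_empty [FinitaryExtensive E] {X Y : E} (h : Nonempty (X ⟶ ⊥_ E)) (f g : X ⟶ Y) :
    f = g := by
  obtain ⟨h⟩ := h
  rw [← cancel_epi (inv h)]
  exact initialIsInitial.hom_ext _ _

theorem empty_fibre [FinitaryExtensive E] [HasPullbacks E] {A B A₀ : E} (φ : B ⟶ A) {T : E}
    (c : T ⟶ A₀) :
    Nonempty (pullback (c ≫ (coprod.inl : A₀ ⟶ A₀ ⨿ A)) (φ ≫ coprod.inr) ⟶ ⊥_ E) :=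
  ⟨(isPullback_initial_inl_inr A₀ A).lift (pullback.fst _ _ ≫ c) (pullback.snd _ _ ≫ φ)
    (by simpa using pullback.condition)⟩

theorem sumFibre_lift [FinitaryExtensive E] [HasPullbacks E] {A B A₀ : E} (φ : B ⟶ A) {T : E}
    (a : T ⟶ A) :
    pullback.fst (a ≫ coprod.inr) (φ ≫ (coprod.inr : A ⟶ A₀ ⨿ A)) ≫ a = pullback.snd _ _ ≫ φ := by
  rw [← cancel_mono (coprod.inr : A ⟶ A₀ ⨿ A)]
  simpa using pullback.condition

variable [HasFiniteLimits E] [LCC E] [FinitaryExtensive E] {I A B A₀ : E}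

/-- The functor `X ↦ A₀ + Σ_a Π_{b ∈ B_a} X_{s b}`. -/
def sumFunctor (φ : B ⟶ A) (s : B ⟶ I) (t₀ : A₀ ⟶ I) (t₁ : A ⟶ I) : Over I ⥤ Over I where
  obj X := Over.mk (coprod.desc t₀ ((secObj φ s X).hom ≫ t₁))
  map {X X'} a := Over.homMk (U := Over.mk (coprod.desc t₀ ((secObj φ s X).hom ≫ t₁)))
    (V := Over.mk (coprod.desc t₀ ((secObj φ s X').hom ≫ t₁)))
    (coprod.map (𝟙 A₀) ((Pi φ).map ((Over.pullback s).map a)).left)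

variable (φ : B ⟶ A) (s : B ⟶ I) (X : Over I)

variable (A₀) in
-- The only function on an empty fibre. The `pullback.lift` merely exchanges `coprod.inl` for `𝟙 A₀
-- ≫ coprod.inl`.
def sumInl : A₀ ⟶ (secObj (φ ≫ (coprod.inr : A ⟶ A₀ ⨿ A)) s X).left :=
  secMk coprod.inl (pullback.lift (𝟙 _ ≫ pullback.fst _ _) (pullback.snd _ _)
      (by simpa using pullback.condition) ≫ (empty_fibre φ (𝟙 A₀)).some ≫ initial.to _)
    (hom_ext_of_empty ⟨pullback.lift (𝟙 _ ≫ pullback.fst _ _) (pullback.snd _ _)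
      (by simpa using pullback.condition) ≫ (empty_fibre φ (𝟙 A₀)).some⟩ _ _)

variable (A₀) in
def sumInr : (secObj φ s X).left ⟶ (secObj (φ ≫ (coprod.inr : A ⟶ A₀ ⨿ A)) s X).left :=
  secMk ((secObj φ s X).hom ≫ coprod.inr)
    (pullback.lift (pullback.fst _ _) (pullback.snd _ _) (sumFibre_lift φ _) ≫ secEv φ s X)
    (by rw [Category.assoc, secEv_hom]; simp)

theorem isPullback_sumInl : IsPullback (sumInl A₀ φ s X) (𝟙 A₀)
    (secObj (φ ≫ (coprod.inr : A ⟶ A₀ ⨿ A)) s X).hom coprod.inl := by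
  refine ⟨⟨by simp [sumInl]⟩, ⟨PullbackCone.IsLimit.mk _ (fun c => c.snd) (fun c => ?_)
    (by simp) (fun c m _ h => by simpa using h)⟩⟩
  refine sec_ext (c.snd ≫ coprod.inl) (by simp [sumInl]) c.condition ?_
  exact hom_ext_of_empty (empty_fibre φ c.snd) _ _

theorem secMk_sumInr {T : E} (a : T ⟶ A) (t : pullback a φ ⟶ X.left)
    (ht : t ≫ X.hom = pullback.snd a φ ≫ s) :
    secMk a t ht ≫ sumInr A₀ φ s X = secMk (a ≫ coprod.inr)
      (pullback.lift (pullback.fst _ _) (pullback.snd _ _) (sumFibre_lift φ _) ≫ t)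
      (by simp [ht]) := by
  rw [sumInr, comp_secMk]
  refine secMk_congr (by simp) _ _ _ _ ?_
  have h := secApp_secMk a t ht (pullback.fst _ _) (pullback.snd _ _) (sumFibre_lift (A₀ := A₀) φ a)
  rw [secApp] at h
  rw [← h]
  simp only [← Category.assoc]
  congr 1
  apply pullback.hom_ext <;> simp

/-- Since `coprod.inr` is monic, the fibre of `φ ≫ coprod.inr` over `coprod.inr a` is the fibre of
`φ` over `a`, so the functions on the two fibres correspond. -/
theorem isPullback_sumInr : IsPullback (sumInr A₀ φ s X) (secObj φ s X).hom
    (secObj (φ ≫ (coprod.inr : A ⟶ A₀ ⨿ A)) s X).hom coprod.inr := by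
  have inv : ∀ {T : E} (a : T ⟶ A), pullback.lift (pullback.fst a φ) (pullback.snd a φ)
      (by simp only [← Category.assoc, pullback.condition]) ≫
      pullback.lift (pullback.fst (a ≫ coprod.inr) (φ ≫ (coprod.inr : A ⟶ A₀ ⨿ A)))
        (pullback.snd _ _) (sumFibre_lift φ a) = 𝟙 _ := by
    intro T a
    apply pullback.hom_ext <;> simp
  have inv' : ∀ {T Y : E} (a : T ⟶ A)
      (k : pullback (a ≫ coprod.inr) (φ ≫ (coprod.inr : A ⟶ A₀ ⨿ A)) ⟶ Y),
      pullback.lift (pullback.fst (a ≫ coprod.inr) (φ ≫ (coprod.inr : A ⟶ A₀ ⨿ A)))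
        (pullback.snd _ _) (sumFibre_lift φ a) ≫
      pullback.lift (pullback.fst a φ) (pullback.snd a φ)
      (by simp only [← Category.assoc, pullback.condition]) ≫ k = k := by
    intro T Y a k
    rw [← Category.assoc]
    convert! Category.id_comp k
    apply pullback.hom_ext <;> simp
  have ex : ∀ {T : E} (z : T ⟶ (secObj (φ ≫ (coprod.inr : A ⟶ A₀ ⨿ A)) s X).left) (a : T ⟶ A),
      z ≫ (secObj (φ ≫ (coprod.inr : A ⟶ A₀ ⨿ A)) s X).hom = a ≫ coprod.inr →
      ∃ y : T ⟶ (secObj φ s X).left, y ≫ sumInr A₀ φ s X = z ∧ y ≫ (secObj φ s X).hom = a := by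
    intro T z a hz
    have e := secMk_eta _ z hz
    refine ⟨secMk a (pullback.lift (pullback.fst a φ) (pullback.snd a φ)
      (by simp only [← Category.assoc, pullback.condition]) ≫
        secApp (pullback.fst (a ≫ coprod.inr) (φ ≫ (coprod.inr : A ⟶ A₀ ⨿ A)) ≫ z)
          (pullback.snd _ _) (by rw [Category.assoc, hz, pullback.condition]))
      (by rw [Category.assoc, secApp_hom, pullback.lift_snd_assoc]), ?_, secMk_hom _ _ _⟩
    rw [secMk_sumInr]
    refine (secMk_congr rfl _ _ _ _ ?_).trans e
    rw [lift_fst_snd_comp]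
    exact (inv' a _).symm
  have uniq : ∀ {T : E} (y y' : T ⟶ (secObj φ s X).left) (a : T ⟶ A),
      y ≫ sumInr A₀ φ s X = y' ≫ sumInr A₀ φ s X → y ≫ (secObj φ s X).hom = a →
      y' ≫ (secObj φ s X).hom = a → y = y' := by
    intro T y y' a h ha ha'
    rw [← secMk_eta a y ha, ← secMk_eta a y' ha'] at h ⊢
    rw [secMk_sumInr, secMk_sumInr] at h
    refine secMk_congr rfl _ _ _ _ ?_
    rw [lift_fst_snd_comp]
    -- `secApp` takes a proof about its section; bundling the section with that proof in a subtype
    -- allows rewriting along `h`.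
    have h2 := fun w => congrArg (fun z => secApp (pullback.fst (a ≫ (coprod.inr : A ⟶ A₀ ⨿ A))
      (φ ≫ coprod.inr) ≫ z.1) (pullback.snd _ _) (by rw [Category.assoc, z.2, pullback.condition]))
      ((Subtype.mk.injEq (p := fun z : T ⟶ (secObj (φ ≫ (coprod.inr : A ⟶ A₀ ⨿ A)) s X).left =>
        z ≫ (secObj (φ ≫ (coprod.inr : A ⟶ A₀ ⨿ A)) s X).hom = a ≫ coprod.inr) _ (secMk_hom _ _ _)
        _ w).mpr h)
    have h3 := h2 (secMk_hom _ _ _)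
    simp only [secApp_secMk_self] at h3
    have := congrArg (fun k => pullback.lift (pullback.fst a φ) (pullback.snd a φ)
      (by simp only [← Category.assoc, pullback.condition]) ≫ k) h3
    simp only [← Category.assoc, inv] at this
    simpa using this.symm
  refine ⟨⟨by simp [sumInr]⟩, ⟨PullbackCone.IsLimit.mk _
    (fun c => (ex c.fst c.snd c.condition).choose)
    (fun c => (ex c.fst c.snd c.condition).choose_spec.1)
    (fun c => (ex c.fst c.snd c.condition).choose_spec.2) (fun c m h h' => ?_)⟩⟩
  exact uniq _ _ c.snd (h.trans (ex c.fst c.snd c.condition).choose_spec.1.symm) h'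
    (ex c.fst c.snd c.condition).choose_spec.2

instance : IsIso (coprod.desc (sumInl A₀ φ s X) (sumInr A₀ φ s X)) :=
  isIso_desc_of_isPullback coprod.inl coprod.inr _ _ _ _ _ (isPullback_sumInl φ s X)
    (isPullback_sumInr φ s X)

/-- The section object over `A₀ ⨿ A` pulls back to `A₀` and to `secObj φ s X` over the summands, so
by extensivity it is their coproduct. -/
theorem nonempty_sumFunctor_iso (t₀ : A₀ ⟶ I) (t₁ : A ⟶ I) :
    Nonempty (sumFunctor φ s t₀ t₁ ≅ depPoly s (φ ≫ coprod.inr) (coprod.desc t₀ t₁)) := by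
  let e (X : Over I) : A₀ ⨿ (secObj φ s X).left ≅
      (secObj (φ ≫ (coprod.inr : A ⟶ A₀ ⨿ A)) s X).left :=
    asIso (coprod.desc (sumInl A₀ φ s X) (sumInr A₀ φ s X))
  refine ⟨NatIso.ofComponents (fun X => Over.isoMk (e X) ?_) ?_⟩
  · change coprod.desc (sumInl A₀ φ s X) (sumInr A₀ φ s X) ≫ (secObj _ s X).hom ≫
      coprod.desc t₀ t₁ = coprod.desc t₀ ((secObj φ s X).hom ≫ t₁)
    apply coprod.hom_ext
    · simp [sumInl, coprod.inl_desc]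
    · simp [sumInr, coprod.inr_desc]
  · intro X Y g
    ext
    change coprod.map (𝟙 A₀) ((Pi φ).map ((Over.pullback s).map g)).left ≫
      coprod.desc (sumInl A₀ φ s Y) (sumInr A₀ φ s Y) =
      coprod.desc (sumInl A₀ φ s X) (sumInr A₀ φ s X) ≫
        ((Pi (φ ≫ coprod.inr)).map ((Over.pullback s).map g)).left
    apply coprod.hom_ext
    · simp only [coprod.inl_map_assoc, coprod.inl_desc, coprod.inl_desc_assoc, Category.id_comp]
      rw [sumInl, sumInl, secMk_map]
      refine secMk_congr rfl _ _ _ _ (hom_ext_of_empty ?_ _ _)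
      simpa using empty_fibre φ (𝟙 A₀)
    · simp only [coprod.inr_map_assoc, coprod.inr_desc, coprod.inr_desc_assoc]
      obtain ⟨a, t, ht, e⟩ := exists_eq_secMk (𝟙 (secObj φ s X).left)
      rw [← Category.id_comp (_ ≫ sumInr A₀ φ s Y), ← Category.id_comp (sumInr A₀ φ s X ≫ _), e,
        ← Category.assoc, secMk_map, secMk_sumInr]
      refine Eq.trans ?_ (Category.assoc _ _ _)
      rw [secMk_sumInr]
      refine Eq.trans (secMk_congr rfl _ _ _ _ ?_) (secMk_map _ _ _ g).symm
      rw [lift_fst_snd_comp, Category.assoc]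

end Sum

/-! ### Recursion and induction with an additional nullary constructor -/

section SumInitial

variable {E : Type u} [Category.{v} E] [PiWPretopos E] {I A B A₀ : E}
  {φ : B ⟶ A} {s : B ⟶ I} {t₀ : A₀ ⟶ I} {t₁ : A ⟶ I}

theorem hasInitial_sumFunctor (φ : B ⟶ A) (s : B ⟶ I) (t₀ : A₀ ⟶ I) (t₁ : A ⟶ I) :
    HasInitial (Endofunctor.Algebra (sumFunctor φ s t₀ t₁)) := by
  obtain ⟨e⟩ := nonempty_sumFunctor_iso φ s t₀ t₁
  have := hasInitial_depPoly s (φ ≫ coprod.inr) (coprod.desc t₀ t₁)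
  exact (initialIsInitial.isInitialObj (Endofunctor.Algebra.equivOfNatIso e).inverse _).hasInitial

theorem exists_isInitial_sumFunctor (φ : B ⟶ A) (s : B ⟶ I) (t₀ : A₀ ⟶ I) (t₁ : A ⟶ I) :
    ∃ (W : E) (w : W ⟶ I) (str : (sumFunctor φ s t₀ t₁).obj (Over.mk w) ⟶ Over.mk w),
      Nonempty (IsInitial (⟨Over.mk w, str⟩ : Endofunctor.Algebra (sumFunctor φ s t₀ t₁))) := by
  have := hasInitial_sumFunctor φ s t₀ t₁
  exact ⟨_, _, (⊥_ Endofunctor.Algebra (sumFunctor φ s t₀ t₁)).str, ⟨initialIsInitial⟩⟩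

variable {W : Over I} (str : (sumFunctor φ s t₀ t₁).obj W ⟶ W)

def sumStr : A₀ ⨿ (secObj φ s W).left ⟶ W.left := str.left

def sumLeaf : A₀ ⟶ W.left := coprod.inl ≫ sumStr str

def sumNode : (secObj φ s W).left ⟶ W.left := coprod.inr ≫ sumStr str

theorem desc_sumLeaf_sumNode : coprod.desc (sumLeaf str) (sumNode str) = sumStr str := by
  apply coprod.hom_ext
  · exact coprod.inl_desc _ _
  · exact coprod.inr_desc _ _

theorem sumStr_hom : sumStr str ≫ W.hom = coprod.desc t₀ ((secObj φ s W).hom ≫ t₁) :=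
  Over.w str

theorem exists_sumStr_eq {Y : Over I} (l : A₀ ⟶ Y.left) (nd : (secObj φ s Y).left ⟶ Y.left)
    (hl : l ≫ Y.hom = t₀) (hnd : nd ≫ Y.hom = (secObj φ s Y).hom ≫ t₁) :
    ∃ str : (sumFunctor φ s t₀ t₁).obj Y ⟶ Y, sumStr str = coprod.desc l nd := by
  have h : coprod.desc l nd ≫ Y.hom = coprod.desc t₀ ((secObj φ s Y).hom ≫ t₁) := by
    apply coprod.hom_ext
    · rw [coprod.inl_desc_assoc, coprod.inl_desc, hl]
    · rw [coprod.inr_desc_assoc, coprod.inr_desc, hnd]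
  exact ⟨Over.homMk (U := (sumFunctor φ s t₀ t₁).obj Y) (coprod.desc l nd) h, rfl⟩

@[simp]
theorem sumLeaf_hom : sumLeaf str ≫ W.hom = t₀ := by
  rw [sumLeaf, Category.assoc, sumStr_hom]
  exact coprod.inl_desc _ _

@[simp]
theorem sumNode_hom : sumNode str ≫ W.hom = (secObj φ s W).hom ≫ t₁ := by
  rw [sumNode, Category.assoc, sumStr_hom]
  exact coprod.inr_desc _ _

variable {str}
variable (h : IsInitial (⟨W, str⟩ : Endofunctor.Algebra (sumFunctor φ s t₀ t₁)))
include h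

theorem isIso_desc_sumLeaf_sumNode : IsIso (coprod.desc (sumLeaf str) (sumNode str)) := by
  rw [desc_sumLeaf_sumNode]
  have := Endofunctor.Algebra.Initial.str_isIso h
  exact inferInstanceAs (IsIso ((Over.forget I).map str))

theorem sum_exists_rec {Y : Over I} (l : A₀ ⟶ Y.left) (nd : (secObj φ s Y).left ⟶ Y.left)
    (hl : l ≫ Y.hom = t₀) (hnd : nd ≫ Y.hom = (secObj φ s Y).hom ≫ t₁) :
    ∃ (g : W.left ⟶ Y.left) (hg : g ≫ Y.hom = W.hom), sumLeaf str ≫ g = l ∧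
      ∀ ⦃T : E⦄ (a : T ⟶ A) (t : pullback a φ ⟶ W.left) (ht : t ≫ W.hom = pullback.snd a φ ≫ s),
        secMk a t ht ≫ sumNode str ≫ g = secMk a (t ≫ g) (by simp [hg, ht]) ≫ nd := by
  obtain ⟨y, hy⟩ := exists_sumStr_eq l nd hl hnd
  let Yalg : Endofunctor.Algebra (sumFunctor φ s t₀ t₁) := ⟨Y, y⟩
  let g := h.to Yalg
  have hg : coprod.map (𝟙 A₀) ((Pi φ).map ((Over.pullback s).map g.f)).left ≫ sumStr y =
      sumStr str ≫ g.f.left := congrArg (fun k => k.left) g.h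
  rw [hy] at hg
  refine ⟨g.f.left, Over.w g.f, ?_, ?_⟩
  · rw [sumLeaf, Category.assoc, ← hg]
    simp [coprod.inl_desc]
  · intro T a t ht
    rw [sumNode, Category.assoc, ← hg, coprod.inr_map_assoc, coprod.inr_desc, ← Category.assoc,
      secMk_map]

theorem sum_hom_ext {Y : Over I} (l : A₀ ⟶ Y.left) (nd : (secObj φ s Y).left ⟶ Y.left)
    (hl : l ≫ Y.hom = t₀) (hnd : nd ≫ Y.hom = (secObj φ s Y).hom ≫ t₁)
    {g g' : W.left ⟶ Y.left} (hg : g ≫ Y.hom = W.hom) (hg' : g' ≫ Y.hom = W.hom)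
    (e₀ : sumLeaf str ≫ g = l) (e₀' : sumLeaf str ≫ g' = l)
    (e₁ : ∀ ⦃T : E⦄ (a : T ⟶ A) (t : pullback a φ ⟶ W.left)
      (ht : t ≫ W.hom = pullback.snd a φ ≫ s),
        secMk a t ht ≫ sumNode str ≫ g = secMk a (t ≫ g) (by simp [hg, ht]) ≫ nd)
    (e₁' : ∀ ⦃T : E⦄ (a : T ⟶ A) (t : pullback a φ ⟶ W.left)
      (ht : t ≫ W.hom = pullback.snd a φ ≫ s),
        secMk a t ht ≫ sumNode str ≫ g' = secMk a (t ≫ g') (by simp [hg', ht]) ≫ nd) :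
    g = g' := by
  obtain ⟨y, hy⟩ := exists_sumStr_eq l nd hl hnd
  let Yalg : Endofunctor.Algebra (sumFunctor φ s t₀ t₁) := ⟨Y, y⟩
  have key : ∀ (g : W.left ⟶ Y.left) (hg : g ≫ Y.hom = W.hom), sumLeaf str ≫ g = l →
      (∀ ⦃T : E⦄ (a : T ⟶ A) (t : pullback a φ ⟶ W.left)
        (ht : t ≫ W.hom = pullback.snd a φ ≫ s),
        secMk a t ht ≫ sumNode str ≫ g = secMk a (t ≫ g) (by simp [hg, ht]) ≫ nd) →
      (sumFunctor φ s t₀ t₁).map (Over.homMk g hg) ≫ Yalg.str = str ≫ Over.homMk g hg := by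
    intro g hg e₀ e₁
    ext
    change coprod.map (𝟙 A₀) ((Pi φ).map ((Over.pullback s).map (Over.homMk g hg))).left ≫
      sumStr y = sumStr str ≫ g
    rw [hy, ← desc_sumLeaf_sumNode]
    apply coprod.hom_ext
    · rw [coprod.inl_map_assoc, coprod.inl_desc, coprod.inl_desc_assoc, e₀, Category.id_comp]
    · obtain ⟨a, t, ht, e⟩ := exists_eq_secMk (𝟙 (secObj φ s W).left)
      have := e₁ a t ht
      rw [← e, Category.id_comp] at this
      rw [coprod.inr_map_assoc, coprod.inr_desc, coprod.inr_desc_assoc, this]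
      congr 1
      refine Eq.trans ?_ (secMk_map a t ht (Over.homMk g hg))
      rw [← e]
      exact (Category.id_comp _).symm
  have := h.hom_ext (Y := Yalg) ⟨Over.homMk g hg, key g hg e₀ e₁⟩
    ⟨Over.homMk g' hg', key g' hg' e₀' e₁'⟩
  exact congrArg (fun k => k.f.left) this

/-- The subobject representing `ψ` is closed under both constructors; recursion into it, followed by
the inclusion, is the identity by uniqueness. -/
theorem sum_induction {ψ : ElemPred W.left} (hψ : Definable ψ)
    (leaf : ∀ ⦃T : E⦄ (c : T ⟶ A₀), ψ (c ≫ sumLeaf str))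
    (node : ∀ ⦃T : E⦄ (a : T ⟶ A) (t : pullback a φ ⟶ W.left)
      (ht : t ≫ W.hom = pullback.snd a φ ≫ s), ψ t → ψ (secMk a t ht ≫ sumNode str))
    {T : E} (w : T ⟶ W.left) : ψ w := by
  obtain ⟨Z, i, hi, hz⟩ := hψ
  let Y : Over I := Over.mk (i ≫ W.hom)
  obtain ⟨l, hl⟩ := (hz _).1 (leaf (𝟙 A₀))
  rw [Category.id_comp] at hl
  obtain ⟨a, t, ht, e⟩ := exists_eq_secMk (𝟙 (secObj φ s Y).left)
  have ht' : (t ≫ i) ≫ W.hom = pullback.snd a φ ≫ s := (Category.assoc _ _ _).trans ht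
  obtain ⟨nd, hnd⟩ := (hz _).1 (node a (t ≫ i) ht' ((hz _).2 ⟨t, rfl⟩))
  have ha : a = (secObj φ s Y).hom := by
    rw [← secMk_hom a t ht, ← e, Category.id_comp]
  -- The closure under nodes was obtained for the universal element only; naturality carries it to
  -- all others.
  have hnd' : ∀ ⦃T : E⦄ (b : T ⟶ A) (k : pullback b φ ⟶ Z)
      (hk : k ≫ Y.hom = pullback.snd b φ ≫ s) (hk' : (k ≫ i) ≫ W.hom = pullback.snd b φ ≫ s),
      secMk (X := Y) b k hk ≫ nd ≫ i = secMk b (k ≫ i) hk' ≫ sumNode str := by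
    intro T b k hk hk'
    have e1 := secMk_map b k hk (Over.homMk i rfl : Y ⟶ W)
    have e2 := secMk_map a t ht (Over.homMk i rfl : Y ⟶ W)
    rw [← e, Category.id_comp] at e2
    rw [hnd, ← Category.assoc]
    exact congrArg (· ≫ sumNode str) ((congrArg (secMk b k hk ≫ ·) e2.symm).trans e1)
  obtain ⟨g, hg, hg₀, hg₁⟩ := sum_exists_rec h (Y := Y) l nd
    ((Category.assoc _ _ _).symm.trans (by rw [hl, sumLeaf_hom]))
    ((Category.assoc _ _ _).symm.trans (by rw [hnd, Category.assoc, sumNode_hom, ← ha]; simp))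
  have hg' : g ≫ i ≫ W.hom = W.hom := hg
  have : g ≫ i = 𝟙 _ := by
    refine sum_hom_ext h (Y := W) (sumLeaf str) (sumNode str) (sumLeaf_hom _) (sumNode_hom _)
      (by simpa using hg') (Category.id_comp _) (by rw [← Category.assoc, hg₀, hl])
      (Category.comp_id _) (fun T b k hk => ?_) (fun T b k hk => by simp)
    have e1 := hg₁ b k hk
    have e2 := congrArg (· ≫ i) e1
    simp only [Category.assoc] at e2 ⊢
    rw [e2]
    exact (hnd' b (k ≫ g) _ (by simp [hg', hk])).trans (by simp only [Category.assoc])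
  exact (hz w).2 ⟨w ≫ g, by rw [Category.assoc, this, Category.comp_id]⟩

end SumInitial

/-! ### Composition and action on generalised elements -/

section Composition

variable {E : Type u} [Category.{v} E] [HasPullbacks E]

theorem comp_lift_assoc {S T X Y Z V : E} {g : X ⟶ Z} {h : Y ⟶ Z} (q : S ⟶ T) (x : T ⟶ X)
    (y : T ⟶ Y) (w : x ≫ g = y ≫ h) (k : pullback g h ⟶ V) :
    q ≫ pullback.lift x y w ≫ k = pullback.lift (q ≫ x) (q ≫ y) (by simp [w]) ≫ k := by
  rw [← Category.assoc, comp_lift]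

namespace InternalCategory

variable {C : InternalCategory E} {T : E}

theorem IsComp.precomp {g f d : T ⟶ C.Ar} (h : C.IsComp g f d) {T' : E} (r : T' ⟶ T) :
    C.IsComp (r ≫ g) (r ≫ f) (r ≫ d) := by
  obtain ⟨w, rfl⟩ := h
  exact ⟨by simp [w], by rw [← comp_lift_assoc _ _ _ w]⟩

theorem exists_isComp {g f : T ⟶ C.Ar} (w : g ≫ C.dom = f ≫ C.cod) : ∃ d, C.IsComp g f d :=
  ⟨_, w, rfl⟩

theorem IsComp.unique {g f d d' : T ⟶ C.Ar} (h : C.IsComp g f d) (h' : C.IsComp g f d') :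
    d = d' := by
  obtain ⟨_, rfl⟩ := h
  obtain ⟨_, rfl⟩ := h'
  rfl

theorem IsComp.dom_eq_cod {g f d : T ⟶ C.Ar} (h : C.IsComp g f d) : g ≫ C.dom = f ≫ C.cod := h.1

theorem IsComp.dom_eq {g f d : T ⟶ C.Ar} (h : C.IsComp g f d) : d ≫ C.dom = f ≫ C.dom := by
  obtain ⟨w, rfl⟩ := h
  rw [Category.assoc, C.compose_dom, pullback.lift_snd_assoc]

theorem IsComp.cod_eq {g f d : T ⟶ C.Ar} (h : C.IsComp g f d) : d ≫ C.cod = g ≫ C.cod := by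
  obtain ⟨w, rfl⟩ := h
  rw [Category.assoc, C.compose_cod, pullback.lift_fst_assoc]

theorem isComp_ident_left (f : T ⟶ C.Ar) : C.IsComp (f ≫ C.cod ≫ C.ident) f f :=
  ⟨_, C.ident_comp f⟩

theorem isComp_ident_right (f : T ⟶ C.Ar) : C.IsComp f (f ≫ C.dom ≫ C.ident) f :=
  ⟨_, C.comp_ident f⟩

/-- `(h ∘ g) ∘ f = d` implies `h ∘ (g ∘ f) = d`. -/
theorem IsComp.assoc {h g f hg gf d : T ⟶ C.Ar} (h₁ : C.IsComp h g hg) (h₂ : C.IsComp hg f d)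
    (h₃ : C.IsComp g f gf) : C.IsComp h gf d := by
  obtain ⟨w₁, rfl⟩ := h₁
  obtain ⟨w₂, rfl⟩ := h₂
  obtain ⟨w₃, rfl⟩ := h₃
  exact ⟨_, (C.assoc h g f w₁ w₃).symm⟩

/-- `h ∘ (g ∘ f) = d` implies `(h ∘ g) ∘ f = d`. -/
theorem IsComp.assoc' {h g f hg gf d : T ⟶ C.Ar} (h₁ : C.IsComp h g hg) (h₂ : C.IsComp h gf d)
    (h₃ : C.IsComp g f gf) : C.IsComp hg f d := by
  obtain ⟨w₁, rfl⟩ := h₁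
  obtain ⟨w₂, rfl⟩ := h₂
  obtain ⟨w₃, rfl⟩ := h₃
  exact ⟨_, C.assoc h g f w₁ w₃⟩

end InternalCategory

namespace Presheaf

variable {C : InternalCategory E} {P : Presheaf C} {T : E}

theorem IsAct.precomp {x y : T ⟶ P.X} {f : T ⟶ C.Ar} (h : P.IsAct x f y) {T' : E} (r : T' ⟶ T) :
    P.IsAct (r ≫ x) (r ≫ f) (r ≫ y) := by
  obtain ⟨w, rfl⟩ := h
  exact ⟨by simp [w], by rw [← comp_lift_assoc _ _ _ w]⟩

theorem exists_isAct {x : T ⟶ P.X} {f : T ⟶ C.Ar} (w : x ≫ P.π = f ≫ C.cod) :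
    ∃ y, P.IsAct x f y :=
  ⟨_, w, rfl⟩

theorem IsAct.unique {x y y' : T ⟶ P.X} {f : T ⟶ C.Ar} (h : P.IsAct x f y)
    (h' : P.IsAct x f y') : y = y' := by
  obtain ⟨_, rfl⟩ := h
  obtain ⟨_, rfl⟩ := h'
  rfl

theorem IsAct.π_eq_cod {x y : T ⟶ P.X} {f : T ⟶ C.Ar} (h : P.IsAct x f y) :
    x ≫ P.π = f ≫ C.cod := h.1

theorem IsAct.π_eq {x y : T ⟶ P.X} {f : T ⟶ C.Ar} (h : P.IsAct x f y) :
    y ≫ P.π = f ≫ C.dom := by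
  obtain ⟨w, rfl⟩ := h
  rw [Category.assoc, P.act_π, pullback.lift_snd_assoc]

theorem isAct_ident (x : T ⟶ P.X) : P.IsAct x (x ≫ P.π ≫ C.ident) x :=
  ⟨_, P.act_ident x⟩

/-- `(x · f) · g = z` implies `x · (f ∘ g) = z`. -/
theorem IsAct.assoc {x y z : T ⟶ P.X} {f g d : T ⟶ C.Ar} (h₁ : P.IsAct x f y)
    (h₂ : P.IsAct y g z) (h₃ : C.IsComp f g d) : P.IsAct x d z := by
  obtain ⟨w₁, rfl⟩ := h₁
  obtain ⟨w₂, rfl⟩ := h₂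
  obtain ⟨w₃, rfl⟩ := h₃
  exact ⟨_, (P.act_comp x f g w₁ w₃).symm⟩

/-- `x · (f ∘ g) = z` implies `(x · f) · g = z`. -/
theorem IsAct.assoc' {x y z : T ⟶ P.X} {f g d : T ⟶ C.Ar} (h₁ : P.IsAct x f y)
    (h₂ : P.IsAct x d z) (h₃ : C.IsComp f g d) : P.IsAct y g z := by
  obtain ⟨w₁, rfl⟩ := h₁
  obtain ⟨w₂, rfl⟩ := h₂
  obtain ⟨w₃, rfl⟩ := h₃
  exact ⟨_, P.act_comp x f g w₁ w₃⟩

end Presheaf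

theorem Definable.isComp {E : Type u} [Category.{v} E] [HasFiniteLimits E] {C : InternalCategory E}
    {X : E} (g f d : X ⟶ C.Ar) :
    Definable (fun _ x => C.IsComp (x ≫ g) (x ≫ f) (x ≫ d) : ElemPred X) :=
  Definable.op _ _ _ g f d

theorem Definable.isAct {E : Type u} [Category.{v} E] [HasFiniteLimits E] {C : InternalCategory E}
    {P : Presheaf C} {X : E} (x : X ⟶ P.X) (f : X ⟶ C.Ar) (y : X ⟶ P.X) :
    Definable (fun _ t => P.IsAct (t ≫ x) (t ≫ f) (t ≫ y) : ElemPred X) :=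
  Definable.op _ _ _ x f y

end Composition

/-! ### The inductively generated families -/

section Generated

variable {E : Type u} [Category.{v} E] [PiWPretopos E] {C : InternalCategory E}

/-- The families inductively generated from a site. -/
structure GeneratedFamilies (S : Site C) where
  Cov : E
  Fam : E
  φ : Fam ⟶ Cov
  n : Cov ⟶ C.Ob
  m : Fam ⟶ C.Ar
  comm : m ≫ C.cod = φ ≫ n
  str : (sumFunctor S.φ (S.m ≫ C.dom) (𝟙 C.Ob) S.n).obj (Over.mk n) ⟶ Over.mk n
  isInitial : IsInitial (⟨Over.mk n, str⟩ :
    Endofunctor.Algebra (sumFunctor S.φ (S.m ≫ C.dom) (𝟙 C.Ob) S.n))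
  unit : C.Ob ⟶ Fam
  isPullback_unit : IsPullback unit (𝟙 C.Ob) φ (sumLeaf str)
  unit_m : unit ≫ m = C.ident
  pair : pullback (secEv S.φ (S.m ≫ C.dom) (Over.mk n)) φ ⟶ Fam
  isPullback_pair : IsPullback pair (pullback.fst (secEv S.φ (S.m ≫ C.dom) (Over.mk n)) φ ≫
    pullback.fst _ _) φ (sumNode str)
  isComp_pair : C.IsComp
    (pullback.fst (secEv S.φ (S.m ≫ C.dom) (Over.mk n)) φ ≫ pullback.snd _ _ ≫ S.m)
    (pullback.snd (secEv S.φ (S.m ≫ C.dom) (Over.mk n)) φ ≫ m) (pair ≫ m)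

theorem fst_comp_eq_snd {K T : E} (a : T ⟶ K) :
    pullback.fst a (𝟙 K) ≫ a = pullback.snd a (𝟙 K) := by
  rw [pullback.condition, Category.comp_id]

theorem elemToSec_aux {I K Z T : E} (ev : K ⟶ I) (z : Z ⟶ I) (a : T ⟶ K) (t : T ⟶ Z)
    (w : a ≫ ev = t ≫ z) : (pullback.fst a (𝟙 K) ≫ t) ≫ (Over.mk z).hom =
      pullback.snd _ _ ≫ ev := by
  rw [← fst_comp_eq_snd, Category.assoc, Category.assoc, w]
  rfl

/-- For `φ = 𝟙`, sections are elements. -/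
def elemToSec {I K Z : E} (ev : K ⟶ I) (z : Z ⟶ I) :
    pullback ev z ⟶ (secObj (𝟙 K) ev (Over.mk z)).left :=
  secMk (X := Over.mk z) (pullback.fst _ _) (pullback.fst _ _ ≫ pullback.snd _ _)
    (elemToSec_aux ev z _ _ pullback.condition)

@[simp]
theorem elemToSec_hom {I K Z : E} (ev : K ⟶ I) (z : Z ⟶ I) :
    elemToSec ev z ≫ (secObj (𝟙 K) ev (Over.mk z)).hom = pullback.fst _ _ :=
  secMk_hom _ _ _

theorem secApp_elemToSec {I K Z S : E} (ev : K ⟶ I) (z : Z ⟶ I) (r : S ⟶ pullback ev z) (b : S ⟶ K)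
    (w : r ≫ pullback.fst _ _ = b) :
    secApp (X := Over.mk z) (r ≫ elemToSec ev z) b (by simp [w]) = r ≫ pullback.snd _ _ := by
  refine (secApp_secMk (X := Over.mk z) (pullback.fst ev z) (pullback.fst _ _ ≫ pullback.snd _ _)
    (elemToSec_aux ev z _ _ pullback.condition) r b (by simp [w])).trans ?_
  rw [pullback.lift_fst_assoc]

/-- A function on a one-point fibre is its value. With it, nodes of the branch algebra become pairs
`(i, k)`. -/
instance {I K Z : E} (ev : K ⟶ I) (z : Z ⟶ I) : IsIso (elemToSec ev z) := by
  refine ⟨pullback.lift (secObj (𝟙 K) ev (Over.mk z)).hom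
    (secApp (X := Over.mk z) (𝟙 _) (secObj (𝟙 K) ev (Over.mk z)).hom (by simp)) ?_, ?_, ?_⟩
  · exact (secApp_hom (X := Over.mk z) _ _ _).symm
  · apply pullback.hom_ext
    · simp
    · simp only [Category.assoc, pullback.lift_snd, comp_secApp, Category.comp_id]
      refine Eq.trans (secApp_congr (Category.id_comp _).symm (elemToSec_hom _ _) _ (by simp)) ?_
      rw [secApp_elemToSec _ _ _ _ (Category.id_comp _)]
  · refine sec_ext _ (by simp) (Category.id_comp _) ?_
    refine Eq.trans (secApp_congr (Category.assoc _ _ _).symm rfl _ (by simp [fst_comp_eq_snd])) ?_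
    rw [secApp_elemToSec _ _ _ _ (by simp [fst_comp_eq_snd])]
    simp only [Category.assoc, pullback.lift_snd, comp_secApp, Category.comp_id]
    exact secApp_congr rfl (fst_comp_eq_snd _) _ _

/-- Families are trees, and their members are branches: a branch through `*` is trivial, and one
through `sup_U t` is an `i` followed by a branch through `t i`. Both objects are initial algebras.
-/
theorem nonempty_generatedFamilies (S : Site C) : Nonempty (GeneratedFamilies S) := by
  obtain ⟨W, n, str, ⟨hW⟩⟩ := exists_isInitial_sumFunctor S.φ (S.m ≫ C.dom) (𝟙 C.Ob) S.n
  let ev := secEv S.φ (S.m ≫ C.dom) (Over.mk n)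
  let t₁ := pullback.fst (secObj S.φ (S.m ≫ C.dom) (Over.mk n)).hom S.φ ≫ sumNode str
  -- Branches are a family over `W`: a node is indexed by `((U, t), i)`, has one subbranch, lying
  -- over `ev`, that is over `t i`, and itself lies over `sup_U t`.
  obtain ⟨F, Φ, str', ⟨hF⟩⟩ := exists_isInitial_sumFunctor (𝟙 _) ev (sumLeaf str) t₁
  have i₁ := isIso_desc_sumLeaf_sumNode hW
  have i₂ := isIso_desc_sumLeaf_sumNode hF
  -- The constructors decompose `F` and `W` compatibly, so extensivity makes both squares pullbacks;
  -- these are the recursion equations for index sets.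
  have sq := isPullback_of_isIso_desc (sumLeaf str) (sumNode str) (sumLeaf str') (sumNode str')
    (𝟙 _) ((secObj (𝟙 _) ev (Over.mk Φ)).hom ≫ pullback.fst _ _) Φ
    ((Category.id_comp _).trans (sumLeaf_hom str').symm)
    ((Category.assoc _ _ _).trans (sumNode_hom str').symm)
  have hn₀ : sumLeaf str ≫ n = 𝟙 _ := sumLeaf_hom str
  have hn₁ : sumNode str ≫ n = _ ≫ S.n := sumNode_hom str
  have hev : ev ≫ n = _ ≫ S.m ≫ C.dom := secEv_hom
  -- The arrow of a branch is defined by recursion into pairs of a family and an arrow into the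
  -- object it covers, which guarantees that the composites exist.
  let Y : Over W := Over.mk (pullback.fst n C.cod)
  let Z := secObj (𝟙 _) ev Y
  let y : Z.left ⟶ pullback n C.cod := secApp (X := Y) (𝟙 _) Z.hom (by simp [Z])
  have hy : y ≫ pullback.fst _ _ = Z.hom ≫ ev := secApp_hom _ _ _
  obtain ⟨d, hd⟩ := InternalCategory.exists_isComp (C := C)
    (g := Z.hom ≫ pullback.snd _ _ ≫ S.m) (f := y ≫ pullback.snd _ _) (by
      rw [Category.assoc, Category.assoc, ← hev, Category.assoc, ← pullback.condition,
        ← Category.assoc, ← hy, Category.assoc])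
  obtain ⟨g, hg, hg₀, hg₁⟩ := sum_exists_rec hF (Y := Y)
    (pullback.lift (sumLeaf str) C.ident (hn₀.trans C.ident_cod.symm))
    (pullback.lift (Z.hom ≫ pullback.fst _ _ ≫ sumNode str) d (by
      rw [hd.cod_eq, Category.assoc, Category.assoc, hn₁, Category.assoc, Category.assoc, S.comm,
        pullback.condition_assoc]))
    (pullback.lift_fst _ _ _) (pullback.lift_fst _ _ _)
  have hg' : g ≫ pullback.fst n C.cod = Φ := hg
  have isPullback_elemToSec : IsPullback (elemToSec ev Φ) (pullback.fst ev Φ ≫ pullback.fst _ _)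
      ((secObj (𝟙 _) ev (Over.mk Φ)).hom ≫ pullback.fst _ _) (𝟙 _) :=
    IsPullback.of_horiz_isIso ⟨by rw [← Category.assoc, elemToSec_hom, Category.comp_id]⟩
  have pb := isPullback_elemToSec.paste_horiz sq.2
  rw [Category.id_comp] at pb
  refine ⟨{
    Cov := W
    Fam := F
    φ := Φ
    n := n
    m := g ≫ pullback.snd _ _
    comm := by rw [← hg', Category.assoc, Category.assoc, pullback.condition]
    str := str
    isInitial := hW
    unit := sumLeaf str'
    isPullback_unit := sq.1
    unit_m := by rw [← Category.assoc, hg₀, pullback.lift_snd]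
    pair := elemToSec ev Φ ≫ sumNode str'
    isPullback_pair := pb
    isComp_pair := ?_ }⟩
  have e := hg₁ (pullback.fst ev Φ) (pullback.fst _ _ ≫ pullback.snd _ _)
    (elemToSec_aux ev Φ _ _ pullback.condition)
  have e' := congrArg (· ≫ pullback.snd _ _) e
  simp only [Category.assoc, pullback.lift_snd] at e'
  have ht : ((pullback.fst (pullback.fst ev Φ) (𝟙 _) ≫ pullback.snd _ _) ≫ g) ≫ Y.hom =
      pullback.snd _ _ ≫ ev := by
    rw [Category.assoc, Category.assoc]
    refine Eq.trans ?_ (elemToSec_aux ev Φ _ _ pullback.condition)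
    exact (congrArg (fun k => _ ≫ _ ≫ k) hg').trans (Category.assoc _ _ _).symm
  have hd' := hd.precomp (secMk (X := Y) (pullback.fst ev Φ) _ ht)
  have e₁ : secMk (X := Y) (pullback.fst ev Φ) _ ht ≫ Z.hom = pullback.fst _ _ := secMk_hom _ _ _
  have e₂ : secMk (X := Y) (pullback.fst ev Φ) _ ht ≫ y = pullback.snd _ _ ≫ g := by
    rw [comp_secApp]
    refine Eq.trans (secApp_congr ?_ e₁ _ (by simp)) ((secApp_secMk (X := Y) (pullback.fst ev Φ) _
      ht (𝟙 _) (pullback.fst ev Φ) (by simp)).trans ?_)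
    · rw [Category.comp_id, Category.id_comp]
    · simp
  rw [← Category.assoc, e₁, ← Category.assoc (secMk _ _ _) y, e₂] at hd'
  simp only [Category.assoc] at hd' ⊢
  rw [← e'] at hd'
  exact hd'

end Generated

/-! ### The families `sup_a t` and their members at arbitrary stages -/

section GeneratedMembers

variable {E : Type u} [Category.{v} E]

theorem isPullback_of_exists {P X Y Z : E} {f : P ⟶ X} {g : P ⟶ Y} {h : X ⟶ Z} {k : Y ⟶ Z}
    (w : f ≫ h = g ≫ k)
    (ex : ∀ ⦃Q : E⦄ (x : Q ⟶ X) (y : Q ⟶ Y), x ≫ h = y ≫ k → ∃ z : Q ⟶ P, z ≫ f = x ∧ z ≫ g = y)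
    (uniq : ∀ ⦃Q : E⦄ (z z' : Q ⟶ P), z ≫ f = z' ≫ f → z ≫ g = z' ≫ g → z = z') :
    IsPullback f g h k :=
  ⟨⟨w⟩, ⟨PullbackCone.IsLimit.mk _ (fun c => (ex c.fst c.snd c.condition).choose)
    (fun c => (ex c.fst c.snd c.condition).choose_spec.1)
    (fun c => (ex c.fst c.snd c.condition).choose_spec.2) (fun c _ h h' =>
      uniq _ _ (h.trans (ex c.fst c.snd c.condition).choose_spec.1.symm)
        (h'.trans (ex c.fst c.snd c.condition).choose_spec.2.symm))⟩⟩

variable [PiWPretopos E] {C : InternalCategory E} {S : Site C} (G : GeneratedFamilies S)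

namespace GeneratedFamilies

/-- The family `*_c`. -/
def star : C.Ob ⟶ G.Cov := sumLeaf G.str

@[simp]
theorem star_n : G.star ≫ G.n = 𝟙 C.Ob := sumLeaf_hom G.str

theorem unit_φ : G.unit ≫ G.φ = G.star := by
  rw [G.isPullback_unit.w, Category.id_comp]
  rfl

theorem eq_unit {T : E} {c : T ⟶ C.Ob} {l : T ⟶ G.Fam} (h : l ≫ G.φ = c ≫ G.star) :
    l = c ≫ G.unit := by
  have e := G.isPullback_unit.lift_snd l c h
  rw [Category.comp_id] at e
  exact (G.isPullback_unit.lift_fst l c h).symm.trans (congrArg (· ≫ G.unit) e)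

variable {G} {T : E} (a : T ⟶ S.Cov) (t : pullback a S.φ ⟶ G.Cov)
  (ht : t ≫ G.n = pullback.snd a S.φ ≫ S.m ≫ C.dom)

/-- The family `sup_a t`. -/
def sup : T ⟶ G.Cov := secMk (X := Over.mk G.n) a t ht ≫ sumNode G.str

@[simp]
theorem sup_n : sup a t ht ≫ G.n = a ≫ S.n := by
  have : sumNode G.str ≫ G.n = (secObj S.φ (S.m ≫ C.dom) (Over.mk G.n)).hom ≫ S.n :=
    sumNode_hom G.str
  rw [sup, Category.assoc, this, secMk_hom_assoc]

theorem comp_sup {Q : E} (r : Q ⟶ T) :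
    r ≫ sup a t ht = sup (r ≫ a) (reindex r a S.φ ≫ t) (by simp [ht]) := by
  rw [sup, ← Category.assoc, comp_secMk]
  rfl

theorem supMem_aux : pullback.lift (pullback.fst a S.φ ≫ secMk (X := Over.mk G.n) a t ht)
    (pullback.snd a S.φ) (by simp [pullback.condition]) ≫ secEv S.φ (S.m ≫ C.dom) (Over.mk G.n) =
      t :=
  secApp_secMk_self (X := Over.mk G.n) a t ht

/-- The pairs `(i, k)` with `k` a member of `t i`, in terms of the tree `(a, t)`. -/
def supPair : pullback t G.φ ⟶ pullback (secEv S.φ (S.m ≫ C.dom) (Over.mk G.n)) G.φ :=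
  pullback.lift (pullback.fst _ _ ≫ pullback.lift
    (pullback.fst a S.φ ≫ secMk (X := Over.mk G.n) a t ht) (pullback.snd a S.φ)
    (by simp [pullback.condition])) (pullback.snd _ _) (by
      rw [Category.assoc, supMem_aux, pullback.condition])

theorem supPair_snd : supPair a t ht ≫ pullback.snd _ _ = pullback.snd _ _ :=
  pullback.lift_snd _ _ _

theorem supPair_fst_fst : supPair a t ht ≫ pullback.fst _ _ ≫ pullback.fst _ _ =
    pullback.fst t G.φ ≫ pullback.fst a S.φ ≫ secMk (X := Over.mk G.n) a t ht := by
  simp [supPair]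

theorem supPair_fst_snd : supPair a t ht ≫ pullback.fst _ _ ≫ pullback.snd _ _ =
    pullback.fst t G.φ ≫ pullback.snd a S.φ := by
  simp [supPair]

/-- The members of `sup_a t`. -/
def supMem : pullback t G.φ ⟶ G.Fam := supPair a t ht ≫ G.pair

theorem supMem_φ : supMem a t ht ≫ G.φ = pullback.fst t G.φ ≫ pullback.fst a S.φ ≫ sup a t ht := by
  rw [supMem, Category.assoc, G.isPullback_pair.w, sup, ← Category.assoc, supPair_fst_fst]
  simp

theorem isComp_supMem : C.IsComp (pullback.fst t G.φ ≫ pullback.snd _ _ ≫ S.m)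
    (pullback.snd t G.φ ≫ G.m) (supMem a t ht ≫ G.m) := by
  have := G.isComp_pair.precomp (supPair a t ht)
  rwa [← Category.assoc (pullback.fst _ _), ← Category.assoc (supPair a t ht), supPair_fst_snd,
    Category.assoc, ← Category.assoc (supPair a t ht) (pullback.snd _ _), supPair_snd,
    ← Category.assoc (supPair a t ht) G.pair] at this

/-- The square `isPullback_pair` for the universal tree, transported to the tree `(a, t)` at a given
stage. -/
theorem isPullback_supMem :
    IsPullback (supMem a t ht) (pullback.fst _ _ ≫ pullback.fst _ _) G.φ (sup a t ht) := by
  refine isPullback_of_exists (by simp [supMem_φ]) (fun Q l s h => ?_) (fun Q z z' h h' => ?_)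
  · rw [sup, ← Category.assoc] at h
    let z := G.isPullback_pair.lift l _ h
    have hz : z ≫ G.pair = l := G.isPullback_pair.lift_fst l _ h
    have hz' : z ≫ pullback.fst _ _ ≫ pullback.fst _ _ = s ≫ secMk (X := Over.mk G.n) a t ht :=
      G.isPullback_pair.lift_snd l _ h
    obtain ⟨i, hi⟩ : ∃ i, i = z ≫ pullback.fst _ _ ≫ pullback.snd _ _ := ⟨_, rfl⟩
    have w : s ≫ a = i ≫ S.φ := by
      rw [hi, Category.assoc, Category.assoc, ← pullback.condition,
        ← Category.assoc (pullback.fst _ _), ← Category.assoc, hz', Category.assoc, secMk_hom]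
    have e₀ : pullback.lift (s ≫ secMk (X := Over.mk G.n) a t ht) i (by simp [w]) =
        z ≫ pullback.fst _ _ := by
      apply pullback.hom_ext <;> simp [hz', hi]
    have e : pullback.lift s i w ≫ t = (z ≫ pullback.snd _ _) ≫ G.φ := by
      rw [Category.assoc, ← pullback.condition, ← Category.assoc, ← e₀]
      exact (secApp_secMk (X := Over.mk G.n) a t ht s i w).symm
    refine ⟨pullback.lift _ _ e, ?_, by simp⟩
    rw [← hz, supMem, ← Category.assoc]
    congr 1
    apply pullback.hom_ext
    · apply pullback.hom_ext
      · rw [Category.assoc, Category.assoc, supPair_fst_fst, Category.assoc, hz']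
        simp
      · rw [Category.assoc, Category.assoc, supPair_fst_snd, Category.assoc, ← hi]
        simp
    · rw [Category.assoc, supPair_snd, pullback.lift_snd]
  · rw [supMem, ← Category.assoc, ← Category.assoc] at h
    have key := G.isPullback_pair.hom_ext h (by
      rw [Category.assoc, Category.assoc, supPair_fst_fst, ← Category.assoc (pullback.fst _ _),
        ← Category.assoc, h']
      simp only [Category.assoc])
    have k₁ := congrArg (· ≫ pullback.snd _ _) key
    have k₂ := congrArg (· ≫ pullback.fst _ _ ≫ pullback.snd _ _) key
    simp only [Category.assoc] at k₁ k₂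
    rw [supPair_snd] at k₁
    rw [supPair_fst_snd] at k₂
    apply pullback.hom_ext
    · apply pullback.hom_ext
      · simpa only [Category.assoc] using h'
      · simpa only [Category.assoc] using k₂
    · exact k₁

variable {a t ht}

theorem exists_supMem {Q : E} {s : Q ⟶ T} {l : Q ⟶ G.Fam} (h : l ≫ G.φ = s ≫ sup a t ht) :
    ∃ (i : Q ⟶ S.Fam) (w : s ≫ a = i ≫ S.φ) (k : Q ⟶ G.Fam)
      (w' : pullback.lift s i w ≫ t = k ≫ G.φ), pullback.lift _ k w' ≫ supMem a t ht = l := by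
  obtain ⟨y, rfl, hy⟩ : ∃ y, y ≫ supMem a t ht = l ∧ y ≫ pullback.fst _ _ ≫ pullback.fst _ _ = s :=
    ⟨_, (isPullback_supMem a t ht).lift_fst l s h, (isPullback_supMem a t ht).lift_snd l s h⟩
  have w : s ≫ a = (y ≫ pullback.fst _ _ ≫ pullback.snd _ _) ≫ S.φ := by
    rw [← hy]
    simp [pullback.condition]
  have e : pullback.lift s (y ≫ pullback.fst _ _ ≫ pullback.snd _ _) w = y ≫ pullback.fst _ _ := by
    apply pullback.hom_ext <;> simp [hy]
  refine ⟨_, w, y ≫ pullback.snd _ _, by rw [e, Category.assoc, pullback.condition,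
    Category.assoc], ?_⟩
  congr 1
  apply pullback.hom_ext <;> simp [e]

theorem supMem_lift_φ {Q : E} {s : Q ⟶ T} {i : Q ⟶ S.Fam} (w : s ≫ a = i ≫ S.φ) {k : Q ⟶ G.Fam}
    (w' : pullback.lift s i w ≫ t = k ≫ G.φ) :
    (pullback.lift _ k w' ≫ supMem a t ht) ≫ G.φ = s ≫ sup a t ht := by
  rw [Category.assoc, supMem_φ]
  simp

theorem isComp_supMem_lift {Q : E} {s : Q ⟶ T} {i : Q ⟶ S.Fam} (w : s ≫ a = i ≫ S.φ)
    {k : Q ⟶ G.Fam} (w' : pullback.lift s i w ≫ t = k ≫ G.φ) :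
    C.IsComp (i ≫ S.m) (k ≫ G.m) ((pullback.lift _ k w' ≫ supMem a t ht) ≫ G.m) := by
  simpa using (isComp_supMem a t ht).precomp (pullback.lift _ k w')

theorem induction (G : GeneratedFamilies S) {ψ : ElemPred G.Cov} (hψ : Definable ψ)
    (hstar : ∀ ⦃T : E⦄ (c : T ⟶ C.Ob), ψ (c ≫ G.star))
    (hsup : ∀ ⦃T : E⦄ (a : T ⟶ S.Cov) (t : pullback a S.φ ⟶ G.Cov)
      (ht : t ≫ G.n = pullback.snd a S.φ ≫ S.m ≫ C.dom), ψ t → ψ (sup a t ht))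
    {T : E} (w : T ⟶ G.Cov) : ψ w :=
  sum_induction G.isInitial hψ hstar hsup w

end GeneratedFamilies

end GeneratedMembers

attribute [local simp] prod.lift_fst prod.lift_snd prod.lift_fst_assoc prod.lift_snd_assoc

/-! ### Stability and transitivity of the generated families -/

section Covers

variable {E : Type u} [Category.{v} E] [PiWPretopos E] {C : InternalCategory E} {S : Site C}

namespace GeneratedFamilies

open InternalCategory

/-- The sieve `σ` on `c` (at stage `T`) contains all members of some generated family. -/
def Covers (G : GeneratedFamilies S) {T : E} (c : T ⟶ C.Ob)
    (σ : ∀ ⦃Q : E⦄, (Q ⟶ T) → (Q ⟶ C.Ar) → Prop) : Prop :=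
  ∃ (T' : E) (r : T' ⟶ T) (W : T' ⟶ G.Cov), IsCover r ∧ W ≫ G.n = r ≫ c ∧
    ∀ ⦃Q : E⦄ (s : Q ⟶ T') (l : Q ⟶ G.Fam), l ≫ G.φ = s ≫ W → σ (s ≫ r) (l ≫ G.m)

variable {G : GeneratedFamilies S} {T : E}

/-- Only arrows into `c` matter, because members of a family on `c` have codomain `c`. -/
theorem Covers.mono {c : T ⟶ C.Ob} {σ τ : ∀ ⦃Q : E⦄, (Q ⟶ T) → (Q ⟶ C.Ar) → Prop}
    (h : G.Covers c σ) (hστ : ∀ ⦃Q : E⦄ (s : Q ⟶ T) (g : Q ⟶ C.Ar), g ≫ C.cod = s ≫ c →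
      σ s g → τ s g) : G.Covers c τ := by
  obtain ⟨T', r, W, hr, hW, hl⟩ := h
  refine ⟨T', r, W, hr, hW, fun Q s l h => hστ _ _ ?_ (hl s l h)⟩
  rw [Category.assoc, G.comm, ← Category.assoc, h, Category.assoc, hW, Category.assoc]

theorem covers_of_cover {c : T ⟶ C.Ob} {σ : ∀ ⦃Q : E⦄, (Q ⟶ T) → (Q ⟶ C.Ar) → Prop}
    {T' : E} {r : T' ⟶ T} (hr : IsCover r)
    (h : G.Covers (r ≫ c) (fun _ s g => σ (s ≫ r) g)) : G.Covers c σ := by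
  obtain ⟨T'', r', W, hr', hW, hl⟩ := h
  refine ⟨T'', r' ≫ r, W, hr'.comp hr, by simp [hW], fun Q s l h => ?_⟩
  rw [← Category.assoc]
  exact hl s l h

theorem covers_star {c : T ⟶ C.Ob} {σ : ∀ ⦃Q : E⦄, (Q ⟶ T) → (Q ⟶ C.Ar) → Prop}
    (h : ∀ ⦃Q : E⦄ (s : Q ⟶ T), σ s (s ≫ c ≫ C.ident)) : G.Covers c σ := by
  refine ⟨T, 𝟙 _, c ≫ G.star, .of_isIso _, by simp, fun Q s l hl => ?_⟩
  have e : l = (s ≫ c) ≫ G.unit := G.eq_unit (by rw [hl, Category.assoc])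
  rw [e, Category.assoc, Category.assoc, G.unit_m, Category.comp_id]
  exact h s

/-- Transitivity: a sieve is covered if its inverse images along the members of a family of the
original site are covered. -/
theorem covers_trans (hS : S.IsCollection) (U : T ⟶ S.Cov)
    {σ : ∀ ⦃Q : E⦄, (Q ⟶ T) → (Q ⟶ C.Ar) → Prop}
    (h : G.Covers (pullback.snd U S.φ ≫ S.m ≫ C.dom) (fun _ s g => ∀ ⦃d⦄,
      C.IsComp (s ≫ pullback.snd U S.φ ≫ S.m) g d → σ (s ≫ pullback.fst U S.φ) d)) :
    G.Covers (U ≫ S.n) σ := by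
  obtain ⟨Y, e, V, he, hV, hl⟩ := h
  -- The families `V` exist only over a cover `e` of the index set of `U`. The collection property
  -- supplies `U'` with a map from its index set that factors through `e` and preserves members, so
  -- `k ≫ V` is a function to which `sup` applies.
  obtain ⟨T', r, U', h, hr, hU', h₁, h₂, k, rfl⟩ := hS.2 U e he
  have ht : (k ≫ V) ≫ G.n = pullback.snd U' S.φ ≫ S.m ≫ C.dom := by
    rw [Category.assoc, hV, ← Category.assoc, ← Category.assoc (pullback.snd U S.φ),
      ← Category.assoc (k ≫ e), h₂, Category.assoc]
  refine ⟨T', r, sup U' (k ≫ V) ht, hr, by rw [sup_n, hU'], fun Q s l hl' => ?_⟩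
  obtain ⟨i, w, j, w', rfl⟩ := exists_supMem hl'
  have := hl (pullback.lift s i w ≫ k) j (by rw [← w', Category.assoc])
    (d := (pullback.lift (pullback.lift s i w) j w' ≫ supMem U' (k ≫ V) ht) ≫ G.m) (by
      convert! isComp_supMem_lift w w' using 1
      have := congrArg (pullback.lift s i w ≫ ·) h₂
      simpa using this)
  convert! this using 1
  have := congrArg (pullback.lift s i w ≫ ·) h₁
  simpa using this

/-- Being covered is an existential quantifier over families followed by a universal one over
members. -/
theorem definable_covers {X : E} (c : X ⟶ C.Ob) {θ : ElemPred (X ⨯ C.Ar)} (h : Definable θ) :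
    Definable (fun _ x => G.Covers (x ≫ c) (fun _ s g => θ (prod.lift (s ≫ x) g)) :
      ElemPred X) := by
  refine (Definable.ex (pullback.fst c G.n) (Definable.all
    (pullback.fst (pullback.snd c G.n) G.φ) (h.comp (prod.lift
      (pullback.fst (pullback.snd c G.n) G.φ ≫ pullback.fst c G.n)
      (pullback.snd (pullback.snd c G.n) G.φ ≫ G.m))))).congr fun T x => ⟨?_, ?_⟩
  · rintro ⟨T', r, W, hr, hW, hl⟩
    refine ⟨T', r, pullback.lift (r ≫ x) W (by simp [hW]), hr, by simp, fun Q s y hy => ?_⟩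
    have h₁ := congrArg (· ≫ pullback.fst _ _) hy
    have h₂ := congrArg (· ≫ pullback.snd _ _) hy
    simp only [Category.assoc, pullback.lift_fst, pullback.lift_snd] at h₁ h₂
    have := hl s (y ≫ pullback.snd _ _) (by
      rw [Category.assoc, ← pullback.condition, h₂])
    convert! this using 1
    apply Limits.prod.hom_ext <;> simp [prod.lift_fst, prod.lift_snd, h₁]
  · rintro ⟨T', r, y, hr, hy, hθ⟩
    refine ⟨T', r, y ≫ pullback.snd _ _, hr, by rw [Category.assoc, ← pullback.condition,
      ← Category.assoc, hy, Category.assoc], fun Q s l hl => ?_⟩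
    have := hθ s (pullback.lift (s ≫ y) l (by simp [hl])) (by simp)
    convert! this using 1
    apply Limits.prod.hom_ext <;> simp [prod.lift_fst, prod.lift_snd, hy]

/-- The inverse image along `f` of the sieve generated by a family. -/
def PullbackSieve (G : GeneratedFamilies S) {T : E} (U : T ⟶ G.Cov) (f : T ⟶ C.Ar) ⦃Q : E⦄
    (s : Q ⟶ T) (g : Q ⟶ C.Ar) : Prop :=
  ∃ (Q' : E) (r : Q' ⟶ Q) (i : Q' ⟶ G.Fam) (h d : Q' ⟶ C.Ar), IsCover r ∧
    i ≫ G.φ = r ≫ s ≫ U ∧ C.IsComp (r ≫ s ≫ f) (r ≫ g) d ∧ C.IsComp (i ≫ G.m) h d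

theorem definable_pullbackSieve : Definable (fun _ y =>
    G.PullbackSieve (y ≫ prod.fst ≫ pullback.fst G.n C.cod) (y ≫ prod.fst ≫ pullback.snd G.n C.cod)
      (𝟙 _) (y ≫ prod.snd) : ElemPred (pullback G.n C.cod ⨯ C.Ar)) := by
  let P := pullback (pullback.fst G.n C.cod) G.φ
  let Z := (P ⨯ C.Ar) ⨯ (C.Ar ⨯ C.Ar)
  let x : Z ⟶ pullback G.n C.cod := prod.fst ≫ prod.fst ≫ pullback.fst _ _
  let i : Z ⟶ G.Fam := prod.fst ≫ prod.fst ≫ pullback.snd _ _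
  let g : Z ⟶ C.Ar := prod.fst ≫ prod.snd
  let h : Z ⟶ C.Ar := prod.snd ≫ prod.fst
  let d : Z ⟶ C.Ar := prod.snd ≫ prod.snd
  have hi : i ≫ G.φ = x ≫ pullback.fst _ _ := by
    simp [i, x, pullback.condition]
  refine (Definable.ex (prod.lift x g) ((Definable.isComp (x ≫ pullback.snd _ _) g d).and
    (Definable.isComp (i ≫ G.m) h d))).congr fun T y => ⟨?_, ?_⟩
  · rintro ⟨Q', r, i', h', d', hr, hi', h₁, h₂⟩
    let z : Q' ⟶ Z := prod.lift (prod.lift (pullback.lift (r ≫ y ≫ prod.fst) i' (by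
      simpa using hi'.symm)) (r ≫ y ≫ prod.snd)) (prod.lift h' d')
    have zx : z ≫ x = r ≫ y ≫ prod.fst := by simp [z, x, P]
    have zi : z ≫ i = i' := by simp [z, i, P]
    have zg : z ≫ g = r ≫ y ≫ prod.snd := by simp [z, g, P]
    have zh : z ≫ h = h' := by simp [z, h]
    have zd : z ≫ d = d' := by simp [z, d]
    refine ⟨Q', r, z, hr, ?_, ?_, ?_⟩
    · apply Limits.prod.hom_ext <;> simp [zx, zg]
    · rw [← Category.assoc, zx, zg, zd]
      simpa using h₁
    · rw [← Category.assoc, zi, zh, zd]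
      exact h₂
  · rintro ⟨Q', r, z, hr, hz, h₁, h₂⟩
    have zx : z ≫ x = r ≫ y ≫ prod.fst := by simpa using congrArg (· ≫ prod.fst) hz
    have zg : z ≫ g = r ≫ y ≫ prod.snd := by simpa using congrArg (· ≫ prod.snd) hz
    refine ⟨Q', r, z ≫ i, z ≫ h, z ≫ d, hr, ?_, ?_, by simpa using h₂⟩
    · rw [Category.assoc, hi, ← Category.assoc, zx]
      simp
    · rw [← Category.assoc, zx, zg] at h₁
      simpa using h₁

theorem pullbackSieve_precomp {U : T ⟶ G.Cov} {f : T ⟶ C.Ar} {Q Q' : E} (s : Q ⟶ T) (q : Q' ⟶ Q)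
    (g : Q' ⟶ C.Ar) : G.PullbackSieve (s ≫ U) (s ≫ f) q g ↔ G.PullbackSieve U f (q ≫ s) g := by
  simp only [PullbackSieve, Category.assoc]

/-- Condition (C) for the generated families, by induction on `U` with `f` universally quantified.
For `sup_a t`, stability of `S` gives a family `V` whose members `β` satisfy `f ∘ β = α_i ∘ h`; the
induction hypothesis covers the inverse image of `t i` along `h`, and `covers_trans` puts these
together. -/
theorem covers_pullbackSieve (hS : S.IsCollection) (U : T ⟶ G.Cov) (f : T ⟶ C.Ar)
    (hf : f ≫ C.cod = U ≫ G.n) : G.Covers (f ≫ C.dom) (G.PullbackSieve U f) := by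
  have hψ := Definable.all (pullback.fst G.n C.cod)
    (definable_covers (G := G) (pullback.snd G.n C.cod ≫ C.dom) (definable_pullbackSieve (G := G)))
  have key := induction G (hψ.congr (ψ' := fun T U => ∀ ⦃T' : E⦄ (r : T' ⟶ T) (f : T' ⟶ C.Ar),
      f ≫ C.cod = r ≫ U ≫ G.n → G.Covers (f ≫ C.dom) (G.PullbackSieve (r ≫ U) f))
      fun T U => ?_) ?_ ?_ U
  · simpa using key (𝟙 _) f (by simpa using hf)
  · constructor
    · intro H T' r y hy
      have := H r (y ≫ pullback.snd _ _) (by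
        rw [Category.assoc, ← pullback.condition, ← Category.assoc, hy, Category.assoc])
      rw [Category.assoc, ← hy] at this
      refine this.mono fun Q s g _ hg => ?_
      rw [← Category.id_comp s, ← pullbackSieve_precomp] at hg
      simpa [prod.lift_fst, prod.lift_snd] using hg
    · intro H T' r f hf
      have := H r (pullback.lift (r ≫ U) f (by simp [hf])) (by simp)
      simp only [pullback.lift_snd_assoc] at this
      refine this.mono fun Q s g _ hg => ?_
      rw [← Category.id_comp s, ← pullbackSieve_precomp]
      simpa [prod.lift_fst, prod.lift_snd] using hg
  · intro T c T' r f hf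
    refine covers_star fun Q s => ⟨Q, 𝟙 _, (s ≫ r ≫ c) ≫ G.unit, s ≫ f, s ≫ f, .of_isIso _, ?_,
      ?_, ?_⟩
    · simp [G.unit_φ]
    · simpa using isComp_ident_right (s ≫ f)
    · convert! isComp_ident_left (s ≫ f) using 1
      have hf' : f ≫ C.cod = r ≫ c := by simpa using hf
      simp only [Category.assoc]
      rw [← Category.assoc f, hf']
      simp [G.unit_m]
  · intro T a t ht IH T' r f hf
    obtain ⟨T₁, r₁, V, hr₁, hV, hl⟩ := S.stable (r ≫ a) f (by simpa using hf)
    refine covers_of_cover hr₁ ?_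
    rw [← hV]
    refine covers_trans hS V ?_
    obtain ⟨R, ρ, i, h, d, hρ, hi, h₁, h₂⟩ := hl (pullback.fst V S.φ) (pullback.snd V S.φ)
      pullback.condition.symm
    refine covers_of_cover hρ ?_
    have w : (ρ ≫ pullback.fst _ _ ≫ r₁ ≫ r) ≫ a = i ≫ S.φ := by
      rw [hi]; simp only [Category.assoc]
    -- The induction hypothesis for the family `t i` and the arrow `h`.
    have hh := IH (pullback.lift _ i w) h (by
      rw [ht, pullback.lift_snd_assoc, ← h₂.dom_eq_cod, Category.assoc])
    have e : h ≫ C.dom = ρ ≫ pullback.snd _ _ ≫ S.m ≫ C.dom := by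
      rw [← h₂.dom_eq, h₁.dom_eq]
      simp only [Category.assoc]
    rw [e] at hh
    refine hh.mono fun Q s g _ hg d' hd' => ?_
    obtain ⟨Q', r', k, h', d'', hr', hk, h₃, h₄⟩ := hg
    have w' : pullback.lift (r' ≫ s ≫ ρ ≫ pullback.fst _ _ ≫ r₁ ≫ r) (r' ≫ s ≫ i)
        (by simpa using congrArg (fun k => r' ≫ s ≫ k) w) ≫ t = k ≫ G.φ := by
      rw [hk]
      simp only [← Category.assoc]
      congr 1
      apply pullback.hom_ext <;> simp
    have w'' : (r' ≫ s ≫ ρ ≫ pullback.fst _ _ ≫ r₁ ≫ r) ≫ a = (r' ≫ s ≫ i) ≫ S.φ := by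
      simpa using congrArg (fun k => r' ≫ s ≫ k) w
    have hp := isComp_supMem_lift (ht := ht) w'' w'
    have hφ := supMem_lift_φ (ht := ht) w'' w'
    obtain ⟨u, hu⟩ := exists_isComp (C := C) (g := r' ≫ s ≫ d) (f := r' ≫ g) (by
      rw [← h₃.dom_eq_cod]
      simp [h₂.dom_eq])
    refine ⟨Q', r', _, h', u, hr', by simpa using hφ, ?_, hp.assoc' ?_ h₄⟩
    · simpa using (h₁.precomp (r' ≫ s)).assoc (by simpa using hu) (by simpa using hd'.precomp r')
    · simpa using (h₂.precomp (r' ≫ s)).assoc (by simpa using hu) (by simpa using h₃)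

end GeneratedFamilies

end Covers

/-! ### Condition (L) for the generated families -/

section Local

/-- The object of triples `(x, i, j)` of a section `x`, an argument `i` and a point `j` in the fibre
of `ψ` over the value `x i`. -/
theorem exists_secApp_eq {E : Type u} [Category.{v} E] [HasFiniteLimits E] [LCC E] {I A B F : E}
    (φ : B ⟶ A) (s : B ⟶ I) (X : Over I) (ψ : F ⟶ X.left) :
    ∃ (P : E) (x : P ⟶ (secObj φ s X).left) (i : P ⟶ B) (j : P ⟶ F)
      (hi : x ≫ (secObj φ s X).hom = i ≫ φ), secApp x i hi = j ≫ ψ ∧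
      ∀ ⦃Q : E⦄ (x' : Q ⟶ (secObj φ s X).left) (i' : Q ⟶ B) (j' : Q ⟶ F)
      (hi' : x' ≫ (secObj φ s X).hom = i' ≫ φ), secApp x' i' hi' = j' ≫ ψ →
      ∃ z : Q ⟶ P, z ≫ x = x' ∧ z ≫ i = i' ∧ z ≫ j = j' := by
  have hi : (pullback.fst (secEv φ s X) ψ ≫ pullback.fst _ _) ≫ (secObj φ s X).hom =
      (pullback.fst (secEv φ s X) ψ ≫ pullback.snd _ _) ≫ φ := by
    rw [Category.assoc, pullback.condition, Category.assoc]
  refine ⟨pullback (secEv φ s X) ψ, _, _, pullback.snd _ _, hi, ?_,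
    fun Q x' i' j' hi' hj' => ?_⟩
  · have : pullback.lift _ _ hi = pullback.fst (secEv φ s X) ψ := by
      apply pullback.hom_ext
      · exact pullback.lift_fst _ _ _
      · exact pullback.lift_snd _ _ _
    rw [← pullback.condition, secApp, this]
  · rw [secApp] at hj'
    exact ⟨pullback.lift _ j' hj', by simp⟩

variable {E : Type u} [Category.{v} E] [PiWPretopos E] {C : InternalCategory E} {S : Site C}

namespace GeneratedFamilies

open InternalCategory

/-- The object of pairs `(U, V)` of a family `U` and a function `V` assigning a family on the domain
of each member of `U`. -/
abbrev Refinements (G : GeneratedFamilies S) : Over G.Cov :=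
  secObj G.φ (G.m ≫ C.dom) (Over.mk G.n)

/-- The sieve generated by the composites of members of `U` and `V`, where `x = (U, V)`. -/
def CompositeSieve (G : GeneratedFamilies S) {T : E} (x : T ⟶ G.Refinements.left) ⦃Q : E⦄
    (s : Q ⟶ T) (g : Q ⟶ C.Ar) : Prop :=
  ∃ (Q' : E) (r : Q' ⟶ Q) (i j : Q' ⟶ G.Fam) (h d : Q' ⟶ C.Ar), IsCover r ∧
    (∃ w : (r ≫ s ≫ x) ≫ G.Refinements.hom = i ≫ G.φ, secApp (r ≫ s ≫ x) i w = j ≫ G.φ) ∧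
    C.IsComp (i ≫ G.m) (j ≫ G.m) d ∧ C.IsComp d h (r ≫ g)

variable {G : GeneratedFamilies S} {T : E}

theorem definable_compositeSieve : Definable (fun _ y =>
    G.CompositeSieve (y ≫ prod.fst) (𝟙 _) (y ≫ prod.snd) :
      ElemPred (G.Refinements.left ⨯ C.Ar)) := by
  obtain ⟨P, x, i, j, hi, hj, huniv⟩ := exists_secApp_eq G.φ (G.m ≫ C.dom) (Over.mk G.n) G.φ
  obtain ⟨Z, y, g, h, d, huniv'⟩ : ∃ (Z : E) (y : Z ⟶ P) (g h d : Z ⟶ C.Ar),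
      ∀ ⦃Q : E⦄ (y' : Q ⟶ P) (g' h' d' : Q ⟶ C.Ar), ∃ z : Q ⟶ Z, z ≫ y = y' ∧ z ≫ g = g' ∧
        z ≫ h = h' ∧ z ≫ d = d' :=
    ⟨(P ⨯ C.Ar) ⨯ (C.Ar ⨯ C.Ar), prod.fst ≫ prod.fst, prod.fst ≫ prod.snd, prod.snd ≫ prod.fst,
      prod.snd ≫ prod.snd, fun Q y' g' h' d' => ⟨prod.lift (prod.lift y' g') (prod.lift h' d'),
        by simp⟩⟩
  refine (Definable.ex (prod.lift (y ≫ x) g) ((Definable.isComp (y ≫ i ≫ G.m) (y ≫ j ≫ G.m) d).and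
    (Definable.isComp d h g))).congr fun T u => ⟨?_, ?_⟩
  · rintro ⟨Q', r, i', j', h', d', hr, ⟨w, hw⟩, h₁, h₂⟩
    obtain ⟨p, px, rfl, rfl⟩ := huniv _ i' j' w hw
    obtain ⟨z, rfl, zg, rfl, rfl⟩ := huniv' p (r ≫ u ≫ prod.snd) h' d'
    refine ⟨Q', r, z, hr, ?_, by simpa using h₁, by rwa [zg]⟩
    apply Limits.prod.hom_ext
    · simpa using px
    · simpa using zg
  · rintro ⟨Q', r, z, hr, hz, h₁, h₂⟩
    have zx : (z ≫ y) ≫ x = r ≫ 𝟙 _ ≫ u ≫ prod.fst := by simpa using congrArg (· ≫ prod.fst) hz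
    have zg : z ≫ g = r ≫ u ≫ prod.snd := by simpa using congrArg (· ≫ prod.snd) hz
    refine ⟨Q', r, (z ≫ y) ≫ i, (z ≫ y) ≫ j, z ≫ h, z ≫ d, hr, ⟨by
      rw [← zx]; simp only [Category.assoc, hi], ?_⟩, by simpa using h₁, by rwa [zg] at h₂⟩
    refine (secApp_congr zx.symm rfl _ (by simp only [Category.assoc, hi])).trans ?_
    rw [← comp_secApp _ _ _ hi, hj]
    simp only [Category.assoc]

theorem compositeSieve_precomp {x : T ⟶ G.Refinements.left} {Q Q' : E} (s : Q ⟶ T) (q : Q' ⟶ Q)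
    (g : Q' ⟶ C.Ar) : G.CompositeSieve (s ≫ x) q g ↔ G.CompositeSieve x (q ≫ s) g := by
  simp only [CompositeSieve, Category.assoc]

/-- Members of `sup_a t` are pairs `(i, k)`. For fixed `i` the given families, restricted to the
members `k` of `t i`, form a refinement of `t i`; the induction hypothesis covers its composites,
and `covers_trans` combines the results over `i`. -/
theorem covers_compositeSieve_sup (hS : S.IsCollection) {a : T ⟶ S.Cov}
    {t : pullback a S.φ ⟶ G.Cov} {ht : t ≫ G.n = pullback.snd a S.φ ≫ S.m ≫ C.dom}
    {x : T ⟶ G.Refinements.left} (hx : x ≫ G.Refinements.hom = sup a t ht)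
    (IH : ∀ ⦃Q : E⦄ (q : Q ⟶ pullback a S.φ) (x' : Q ⟶ G.Refinements.left),
      x' ≫ G.Refinements.hom = q ≫ t →
      G.Covers (x' ≫ G.Refinements.hom ≫ G.n) (G.CompositeSieve x')) :
    G.Covers (x ≫ G.Refinements.hom ≫ G.n) (G.CompositeSieve x) := by
  rw [← Category.assoc, hx, sup_n]
  refine covers_trans hS a ?_
  have w : (pullback.fst t G.φ ≫ pullback.fst a S.φ ≫ x) ≫ G.Refinements.hom =
      supMem a t ht ≫ G.φ := by
    rw [supMem_φ, ← hx]
    simp only [Category.assoc]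
  have hV : secApp _ _ w ≫ G.n = pullback.snd t G.φ ≫ G.m ≫ C.dom := by
    refine (secApp_hom _ _ w).trans ?_
    rw [← Category.assoc, (isComp_supMem a t ht).dom_eq, Category.assoc]
  -- The stage is the index set of `a`, so one application treats all `i` simultaneously.
  have hh := IH (𝟙 _) (secMk (X := Over.mk G.n) t _ hV) ((secMk_hom _ _ _).trans
    (Category.id_comp _).symm)
  rw [secMk_hom_assoc, ht] at hh
  refine hh.mono fun Q s g _ hg d' hd' => ?_
  obtain ⟨Q', r, i, j, h, d, hr, ⟨w₁, hj⟩, h₁, h₂⟩ := hg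
  have w₂ : (r ≫ s) ≫ t = i ≫ G.φ := by simpa using w₁
  have hi : (pullback.lift _ i w₂ ≫ supMem a t ht) ≫ G.φ =
      (r ≫ (s ≫ pullback.fst _ _) ≫ x) ≫ G.Refinements.hom := by
    rw [Category.assoc, supMem_φ, ← hx]
    simp
  have hp := (isComp_supMem a t ht).precomp (pullback.lift _ i w₂)
  simp only [pullback.lift_fst_assoc, pullback.lift_snd_assoc] at hp
  obtain ⟨u, hu⟩ := exists_isComp (h₁.dom_eq_cod ▸ hp.dom_eq)
  rw [← Category.assoc] at hu
  refine ⟨Q', r, _, j, h, u, hr, ⟨hi.symm, ?_⟩, hu, ?_⟩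
  · rw [← hj]
    rw [← Category.assoc] at w₁
    refine Eq.trans ?_ (secApp_congr (Category.assoc r s _) rfl w₁ _)
    refine Eq.trans ?_ (secApp_secMk (X := Over.mk G.n) t _ hV (r ≫ s) i w₂).symm
    rw [comp_secApp]
    exact secApp_congr (by simp) rfl _ _
  · rw [← Category.assoc (pullback.lift _ _ _)] at hp
    refine (hp.assoc hu h₁).assoc' ?_ h₂
    simpa using hd'.precomp r

theorem covers_compositeSieve (hS : S.IsCollection) (x : T ⟶ G.Refinements.left) :
    G.Covers (x ≫ G.Refinements.hom ≫ G.n) (G.CompositeSieve x) := by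
  have hψ := Definable.all G.Refinements.hom
    (definable_covers (G := G) (G.Refinements.hom ≫ G.n) (definable_compositeSieve (G := G)))
  have key := induction G (hψ.congr (ψ' := fun T U => ∀ ⦃T' : E⦄ (r : T' ⟶ T)
      (x : T' ⟶ G.Refinements.left), x ≫ G.Refinements.hom = r ≫ U →
      G.Covers (x ≫ G.Refinements.hom ≫ G.n) (G.CompositeSieve x))
      fun T U => ?_) ?_ ?_ (x ≫ G.Refinements.hom)
  · exact key (𝟙 _) x (Category.id_comp _).symm
  · refine forall_congr' fun T' => forall_congr' fun r => forall_congr' fun y =>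
      forall_congr' fun hy => ?_
    constructor
    · refine fun H => H.mono fun Q s g _ hg => ?_
      rw [← Category.id_comp s, ← compositeSieve_precomp] at hg
      simpa using hg
    · refine fun H => H.mono fun Q s g _ hg => ?_
      rw [← Category.id_comp s, ← compositeSieve_precomp]
      simpa using hg
  · intro T c T' r x hx
    have w : x ≫ G.Refinements.hom = (r ≫ c ≫ G.unit) ≫ G.φ := by
      simp [hx, G.unit_φ]
    have hW : secApp x _ w ≫ G.n = (r ≫ c ≫ G.unit) ≫ G.m ≫ C.dom := secApp_hom _ _ _
    -- The only member of `*` is the identity, so the family assigned to it serves as the composite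
    -- family.
    refine ⟨T', 𝟙 _, secApp x _ w, .of_isIso _, ?_, fun Q s l hl => ?_⟩
    · rw [hW, ← Category.assoc x, hx]
      simp only [Category.assoc, ← Category.assoc G.unit, G.unit_m, C.ident_dom, star_n]
      simp
    · have hc : l ≫ G.m ≫ C.cod = s ≫ r ≫ c := by
        rw [G.comm, ← Category.assoc, hl, Category.assoc, hW]
        simp only [Category.assoc, ← Category.assoc G.unit, G.unit_m, C.ident_dom]
        simp
      refine ⟨Q, 𝟙 _, s ≫ r ≫ c ≫ G.unit, l, l ≫ G.m ≫ C.dom ≫ C.ident, l ≫ G.m, .of_isIso _,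
        ⟨?_, ?_⟩, ?_, ?_⟩
      · simp [hx, G.unit_φ]
      · rw [hl, comp_secApp]
        exact secApp_congr (by simp) rfl _ _
      · convert! isComp_ident_left (l ≫ G.m) using 1
        simp only [Category.assoc]
        rw [G.unit_m, ← Category.assoc G.m, ← Category.assoc l, hc]
        simp
      · simpa using isComp_ident_right (l ≫ G.m)
  · intro T a t ht IH T' r x hx
    rw [comp_sup] at hx
    exact covers_compositeSieve_sup hS hx fun Q q x' hx' =>
      IH (q ≫ reindex r a S.φ) x' (by simpa using hx')

end GeneratedFamilies

end Local

/-! ### The generated Grothendieck site -/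

section GeneratedSite

variable {E : Type u} [Category.{v} E] [PiWPretopos E] {C : InternalCategory E} {S : Site C}

namespace GeneratedFamilies

open InternalCategory

/-- The generated families form a site. -/
def site (G : GeneratedFamilies S) (hS : S.IsCollection) : Site C where
  Cov := G.Cov
  Fam := G.Fam
  φ := G.φ
  n := G.n
  m := G.m
  comm := G.comm
  stable T U f hf := by
    obtain ⟨T', r, V, hr, hV, hl⟩ := covers_pullbackSieve hS U f hf
    refine ⟨T', r, V, hr, hV, fun Q s j hj => ?_⟩
    simpa only [PullbackSieve, Category.assoc] using hl s j hj

theorem exists_composite_family {G : GeneratedFamilies S} (hS : S.IsCollection) {T : E}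
    (U : T ⟶ G.Cov) (V : pullback U G.φ ⟶ G.Cov)
    (hV : V ≫ G.n = pullback.snd U G.φ ≫ G.m ≫ C.dom) :
    ∃ (T' : E) (r : T' ⟶ T) (W : T' ⟶ G.Cov), IsCover r ∧ W ≫ G.n = r ≫ U ≫ G.n ∧
      ∀ ⦃Q : E⦄ (s : Q ⟶ T') (l : Q ⟶ G.Fam), l ≫ G.φ = s ≫ W →
        ∃ (Q' : E) (r' : Q' ⟶ Q) (i : Q' ⟶ pullback U G.φ) (j : Q' ⟶ G.Fam)
          (h d : Q' ⟶ C.Ar), IsCover r' ∧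
          i ≫ pullback.fst U G.φ = r' ≫ s ≫ r ∧ j ≫ G.φ = i ≫ V ∧
          C.IsComp (i ≫ pullback.snd U G.φ ≫ G.m) (j ≫ G.m) d ∧
          C.IsComp d h (r' ≫ l ≫ G.m) := by
  obtain ⟨T', r, W, hr, hW, hl⟩ := covers_compositeSieve hS (secMk (X := Over.mk G.n) U V hV)
  refine ⟨T', r, W, hr, by rwa [secMk_hom_assoc] at hW, fun Q s l h => ?_⟩
  obtain ⟨Q', r', i, j, h, d, hr', ⟨w, hj⟩, h₁, h₂⟩ := hl s l h
  have w' : (r' ≫ s ≫ r) ≫ U = i ≫ G.φ := by simpa using w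
  refine ⟨Q', r', pullback.lift _ i w', j, h, d, hr', pullback.lift_fst _ _ _, ?_, ?_, h₂⟩
  · refine hj.symm.trans (Eq.trans ?_ (secApp_secMk (X := Over.mk G.n) U V hV _ i w'))
    exact secApp_congr (by simp) rfl _ _
  · rwa [pullback.lift_snd_assoc]

variable (G : GeneratedFamilies S) (hS : S.IsCollection)

theorem isGrothendieck_site : (G.site hS).IsGrothendieck where
  maximal T c := ⟨T, 𝟙 _, c ≫ G.star, c ≫ G.unit, .of_isIso _, by simp [site],
    by simp [site, G.unit_φ], by simp [site, G.unit_m]⟩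
  isLocal _ U V hV := exists_composite_family hS U V hV

/-- `Site.coverFunctor` and `Site.eval` unfold to `sumFunctor` and `secEv`, so the fields of `G`
apply as they stand. -/
theorem isGeneratedBy_site : (G.site hS).IsGeneratedBy S :=
  ⟨G.str, ⟨G.isInitial⟩, ⟨G.unit, G.isPullback_unit, G.unit_m⟩, ⟨G.pair, G.isPullback_pair,
    G.isComp_pair⟩⟩

end GeneratedFamilies

theorem isDepPoly_coverFunctor (S : Site C) : IsDepPoly S.coverFunctor :=
  ⟨_, _, S.m ≫ C.dom, S.φ ≫ coprod.inr, coprod.desc (𝟙 C.Ob) S.n,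
    nonempty_sumFunctor_iso S.φ (S.m ≫ C.dom) (𝟙 C.Ob) S.n⟩

end GeneratedSite

/-! ### Collection squares -/

section Collection

variable {E : Type u} [Category.{v} E] [HasPullbacks E]

/-- Collection squares, strong ones if `b` holds. -/
def IsCollSquare (b : Prop) {D B C A : E} (q : D ⟶ B) (g : D ⟶ C) (f : B ⟶ A) (p : C ⟶ A) :
    Prop :=
  g ≫ p = q ≫ f ∧
  ∀ ⦃T : E⦄ (c : T ⟶ C) ⦃Y : E⦄ (e : Y ⟶ pullback c g), IsCover e →
    ∃ (T' : E) (r : T' ⟶ T) (c' : T' ⟶ C) (h : pullback c' g ⟶ pullback c g),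
      IsCover r ∧ c' ≫ p = r ≫ c ≫ p ∧
      (∃ w : pullback.fst c' g ≫ r = h ≫ pullback.fst c g,
        b → IsCover (pullback.lift (pullback.fst c' g) h w :
          pullback c' g ⟶ pullback r (pullback.fst c g))) ∧
      h ≫ pullback.snd c g ≫ q = pullback.snd c' g ≫ q ∧
      ∃ k : pullback c' g ⟶ Y, k ≫ e = h

variable {D B C A : E} {q : D ⟶ B} {g : D ⟶ C} {f : B ⟶ A} {p : C ⟶ A}

theorem isCollSquare_false_iff : IsCollSquare False q g f p ↔ IsCollectionSquare q g f p := by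
  simp [IsCollSquare, IsCollectionSquare]

theorem isCollSquare_true_iff : IsCollSquare True q g f p ↔ IsStrongCollectionSquare q g f p := by
  simp [IsCollSquare, IsStrongCollectionSquare]

theorem IsCollSquare.isCollectionSquare {b : Prop} (h : IsCollSquare b q g f p) :
    IsCollectionSquare q g f p := by
  refine ⟨h.1, fun T c Y e he => ?_⟩
  obtain ⟨T', r, c', h, hr, hc', ⟨w, -⟩, h₁, h₂⟩ := h.2 c e he
  exact ⟨T', r, c', h, hr, hc', w, h₁, h₂⟩

end Collection

/-! ### A definable form of the collection property -/

section CollectionDefinable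

variable {E : Type u} [Category.{v} E] [PiWPretopos E]

theorem IsCover.exists_local_lift {X Y : E} {f : X ⟶ Y} (hf : IsCover f) {Q : E}
    (y : Q ⟶ Y) : ∃ (Q' : E) (t : Q' ⟶ Q) (x : Q' ⟶ X), IsCover t ∧ x ≫ f = t ≫ y :=
  ⟨_, pullback.fst y f, pullback.snd y f, hf.pullback_fst y, pullback.condition.symm⟩

theorem isCover_iff_forall_local_lift {X Y : E} {f : X ⟶ Y} : IsCover f ↔
    ∀ ⦃Q : E⦄ (y : Q ⟶ Y), ∃ (Q' : E) (t : Q' ⟶ Q) (x : Q' ⟶ X), IsCover t ∧ x ≫ f = t ≫ y := by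
  refine ⟨fun h Q y => h.exists_local_lift y, fun h => isCover_of_locally_lift ?_⟩
  obtain ⟨Q', t, x, ht, hx⟩ := h (𝟙 Y)
  exact ⟨Q', t, x, ht, by rw [hx, Category.comp_id]⟩

variable {F A B O : E} (φ : F ⟶ A) (m : F ⟶ B) (n : A ⟶ O)

/-- Surjectivity of a map between fibres, in terms of elements. -/
theorem isCover_lift_iff {T T' : E} {W : T ⟶ A} {W' : T' ⟶ A} {r : T' ⟶ T}
    {h : pullback W' φ ⟶ pullback W φ} (w : pullback.fst W' φ ≫ r = h ≫ pullback.fst W φ) :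
    IsCover (pullback.lift (pullback.fst W' φ) h w : pullback W' φ ⟶ pullback r (pullback.fst W φ)) ↔
    ∀ ⦃Q : E⦄ (s : Q ⟶ T') (l : Q ⟶ F), s ≫ r ≫ W = l ≫ φ → ∃ (Q' : E) (t : Q' ⟶ Q) (l' : Q' ⟶ F),
      IsCover t ∧ ∃ w : (t ≫ s) ≫ W' = l' ≫ φ,
        pullback.lift _ l' w ≫ h ≫ pullback.snd W φ = t ≫ l := by
  rw [isCover_iff_forall_local_lift]
  constructor
  · intro H Q s l hl
    obtain ⟨Q', t, x, ht, hx⟩ := H (pullback.lift s (pullback.lift (s ≫ r) l (by simpa using hl))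
      (by simp))
    have h₁ := congrArg (· ≫ pullback.fst _ _) hx
    have h₂ := congrArg (· ≫ pullback.snd _ _ ≫ pullback.snd _ _) hx
    simp only [Category.assoc, pullback.lift_fst, pullback.lift_snd, pullback.lift_snd_assoc]
      at h₁ h₂
    have e : pullback.lift (t ≫ s) (x ≫ pullback.snd _ _)
        (by rw [← h₁, Category.assoc, pullback.condition, Category.assoc]) = x := by
      apply pullback.hom_ext <;> simp [h₁]
    exact ⟨Q', t, x ≫ pullback.snd _ _, ht, by rw [← h₁, Category.assoc, pullback.condition,
      Category.assoc], by rw [e, h₂]⟩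
  · intro H Q y
    obtain ⟨Q', t, l', ht, w', hl⟩ := H (y ≫ pullback.fst _ _) (y ≫ pullback.snd _ _ ≫
      pullback.snd _ _) (by
        simp only [Category.assoc]
        rw [← pullback.condition (f := W), pullback.condition_assoc])
    refine ⟨Q', t, pullback.lift _ l' w', ht, ?_⟩
    · apply pullback.hom_ext
      · simp
      · apply pullback.hom_ext
        · simp only [Category.assoc, pullback.lift_snd_assoc, ← w, pullback.lift_fst_assoc,
            pullback.condition]
        · simpa using hl

/-- `W` satisfies the condition defining collection squares, strong ones if `b` holds. -/
def CollectsAt (b : Prop) {T : E} (W : T ⟶ A) : Prop :=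
  ∀ ⦃Y : E⦄ (e : Y ⟶ pullback W φ), IsCover e →
    ∃ (T' : E) (r : T' ⟶ T) (W' : T' ⟶ A) (h : pullback W' φ ⟶ pullback W φ),
      IsCover r ∧ W' ≫ n = r ≫ W ≫ n ∧
      (∃ w : pullback.fst W' φ ≫ r = h ≫ pullback.fst W φ,
        b → IsCover (pullback.lift (pullback.fst W' φ) h w :
          pullback W' φ ⟶ pullback r (pullback.fst W φ))) ∧
      h ≫ pullback.snd W φ ≫ m = pullback.snd W' φ ≫ m ∧
      ∃ k : pullback W' φ ⟶ Y, k ≫ e = h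

variable {D A' : E} (q : D ⟶ F) (g : D ⟶ A') (p : A' ⟶ A)

/-- The section `z` is a function to the fibre of `g` over `c`, with surjective image in the fibre of
`φ` if `b` holds. -/
def IsFibreLift (b : Prop) {T : E} (c : T ⟶ A') (z : T ⟶ (secObj φ m (Over.mk (q ≫ m))).left) :
    Prop :=
  (∀ ⦃Q : E⦄ (s : Q ⟶ T) (l : Q ⟶ F)
    (w : (s ≫ z) ≫ (secObj φ m (Over.mk (q ≫ m))).hom = l ≫ φ), secApp (s ≫ z) l w ≫ g = s ≫ c) ∧
  (b → ∀ ⦃Q : E⦄ (s : Q ⟶ T) (l : Q ⟶ F), s ≫ c ≫ p = l ≫ φ →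
    ∃ (Q' : E) (t : Q' ⟶ Q) (l' : Q' ⟶ F), IsCover t ∧
      ∃ w : ((t ≫ s) ≫ z) ≫ (secObj φ m (Over.mk (q ≫ m))).hom = l' ≫ φ,
        secApp ((t ≫ s) ≫ z) l' w ≫ q = t ≫ l)

theorem isFibreLift_secMk {b : Prop} {T : E} {c : T ⟶ A'} {W' : T ⟶ A} {k : pullback W' φ ⟶ D}
    (hk : k ≫ q ≫ m = pullback.snd W' φ ≫ m) (hg : k ≫ g = pullback.fst W' φ ≫ c)
    (hb : b → ∀ ⦃Q : E⦄ (s : Q ⟶ T) (l : Q ⟶ F), s ≫ c ≫ p = l ≫ φ →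
      ∃ (Q' : E) (t : Q' ⟶ Q) (l' : Q' ⟶ F), IsCover t ∧ ∃ w : (t ≫ s) ≫ W' = l' ≫ φ,
        pullback.lift _ l' w ≫ k ≫ q = t ≫ l) :
    IsFibreLift φ m q g p b c (secMk (X := Over.mk (q ≫ m)) W' k hk) := by
  refine ⟨fun Q s l w => ?_, fun h Q s l hl => ?_⟩
  · rw [Category.assoc, secMk_hom] at w
    rw [secApp_secMk (X := Over.mk (q ≫ m)) W' k hk s l w]
    refine (Category.assoc _ _ _).trans ?_
    rw [hg]
    simp
  · obtain ⟨Q', t, l', ht, w, e⟩ := hb h s l hl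
    refine ⟨Q', t, l', ht, by simpa using w, ?_⟩
    rw [secApp_secMk (X := Over.mk (q ≫ m)) W' k hk _ l' w]
    exact (Category.assoc _ _ _).trans e

/-- The reformulation of `CollectsAt` with a bounded quantifier, in terms of a collection square
`(q, g, φ, p)`. -/
def BoundedCollectsAt (b : Prop) {T : E} (W : T ⟶ A) : Prop :=
  ∀ ⦃T' : E⦄ (r : T' ⟶ T) (c : T' ⟶ A'), c ≫ p = r ≫ W →
    ∃ (T'' : E) (r' : T'' ⟶ T') (z : T'' ⟶ (secObj φ m (Over.mk (q ≫ m))).left), IsCover r' ∧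
      z ≫ (secObj φ m (Over.mk (q ≫ m))).hom ≫ n = r' ≫ c ≫ p ≫ n ∧
      IsFibreLift φ m q g p b (r' ≫ c) z

theorem definable_isFibreLift (b : Prop) {Z : E} (c : Z ⟶ A')
    (z : Z ⟶ (secObj φ m (Over.mk (q ≫ m))).left) :
    Definable (fun _ x => IsFibreLift φ m q g p b (x ≫ c) (x ≫ z) : ElemPred Z) := by
  have w₁ : (pullback.fst (z ≫ (secObj φ m (Over.mk (q ≫ m))).hom) φ ≫ z) ≫
      (secObj φ m (Over.mk (q ≫ m))).hom = pullback.snd _ _ ≫ φ := by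
    rw [Category.assoc, pullback.condition]
  have w₂ : (pullback.fst (pullback.fst (c ≫ p) φ ≫ z ≫ (secObj φ m (Over.mk (q ≫ m))).hom) φ ≫
      pullback.fst _ _ ≫ z) ≫ (secObj φ m (Over.mk (q ≫ m))).hom = pullback.snd _ _ ≫ φ := by
    rw [Category.assoc, Category.assoc, pullback.condition]
  have h₁ := Definable.all (pullback.fst _ _) (Definable.eq (secApp _ _ w₁ ≫ g)
    (pullback.fst _ _ ≫ c))
  have h₂ : Definable (fun T x => b → ∀ ⦃Q : E⦄ (s : Q ⟶ T) (l : Q ⟶ F), s ≫ (x ≫ c) ≫ p = l ≫ φ →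
      ∃ (Q' : E) (t : Q' ⟶ Q) (l' : Q' ⟶ F), IsCover t ∧
        ∃ w : ((t ≫ s) ≫ x ≫ z) ≫ (secObj φ m (Over.mk (q ≫ m))).hom = l' ≫ φ,
          secApp ((t ≫ s) ≫ x ≫ z) l' w ≫ q = t ≫ l : ElemPred Z) := by
    -- `b` is an external proposition: either the surjectivity clause is present throughout or it is
    -- vacuous.
    by_cases hb : b
    · refine (Definable.all (pullback.fst (c ≫ p) φ) (Definable.ex (pullback.fst _ _)
        (Definable.eq (secApp _ _ w₂ ≫ q) (pullback.fst _ _ ≫ pullback.snd _ _)))).congr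
        fun T x => ⟨fun H Q s y hy => ?_, fun H _ Q s l hl => ?_⟩
      · obtain ⟨Q', t, l', ht, w, e⟩ := H hb s (y ≫ pullback.snd _ _) (by
          rw [Category.assoc y, ← pullback.condition, ← Category.assoc y, hy]
          simp only [Category.assoc])
        refine ⟨Q', t, pullback.lift (t ≫ y) l' (by
          rw [← w, Category.assoc, ← Category.assoc y, hy]; simp only [Category.assoc]), ht,
          pullback.lift_fst _ _ _, ?_⟩
        rw [← Category.assoc, comp_secApp]
        refine Eq.trans (congrArg (· ≫ q) (secApp_congr (by simp [reassoc_of% hy]) (by simp) _ _))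
          (e.trans ?_)
        rw [pullback.lift_fst_assoc, Category.assoc]
      · obtain ⟨Q', t, y, ht, hy, e⟩ := H s (pullback.lift (s ≫ x) l (by simpa using hl)) (by simp)
        have hy₁ := congrArg (· ≫ pullback.fst _ _) hy
        have hy₂ := congrArg (· ≫ pullback.snd _ _) hy
        simp only [Category.assoc, pullback.lift_fst, pullback.lift_snd] at hy₁ hy₂
        refine ⟨Q', t, y ≫ pullback.snd _ _, ht, ?_, ?_⟩
        · rw [Category.assoc y, ← w₂]
          simp only [Category.assoc, reassoc_of% hy₁]
        · refine Eq.trans ?_ (e.trans hy₂)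
          refine Eq.trans ?_ (Category.assoc _ _ _)
          rw [comp_secApp]
          exact congrArg (· ≫ q) (secApp_congr (by simp [reassoc_of% hy₁]) rfl _ _)
    · exact (Definable.eq (𝟙 Z) (𝟙 Z)).congr fun T x => by simp [hb]
  refine (h₁.congr fun T x => ⟨fun H Q s y hy => ?_, fun H Q s l w => ?_⟩).and h₂
  · refine Eq.trans (Category.assoc _ _ _).symm (Eq.trans ?_ ((H s (y ≫ pullback.snd _ _) (by
      rw [Category.assoc y, ← w₁, ← Category.assoc s, ← hy]; simp only [Category.assoc])).trans
      (by rw [← Category.assoc s, ← hy, Category.assoc])))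
    rw [comp_secApp]
    exact congrArg (· ≫ g) (secApp_congr (by simp [reassoc_of% hy]) rfl _ _)
  · have := H s (pullback.lift (s ≫ x) l (by simpa using w)) (by simp)
    rw [pullback.lift_fst_assoc, ← Category.assoc, comp_secApp] at this
    refine Eq.trans ?_ (this.trans (Category.assoc _ _ _))
    exact congrArg (· ≫ g) (secApp_congr (by simp) (by simp) _ _)

theorem definable_boundedCollectsAt (b : Prop) :
    Definable (fun _ W => BoundedCollectsAt φ m n q g p b W : ElemPred A) := by
  refine (Definable.all p (Definable.ex (pullback.fst (p ≫ n)
    ((secObj φ m (Over.mk (q ≫ m))).hom ≫ n)) (definable_isFibreLift φ m q g p b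
      (pullback.fst _ _) (pullback.snd _ _)))).congr fun T W => ?_
  refine forall_congr' fun T' => forall_congr' fun r => forall_congr' fun c =>
      forall_congr' fun hc => ?_
  constructor
  · rintro ⟨T'', r', z, hr', hz, h⟩
    exact ⟨T'', r', pullback.lift (r' ≫ c) z (by simpa using hz.symm), hr', by simp, by simpa⟩
  · rintro ⟨T'', r', z, hr', hz, h⟩
    refine ⟨T'', r', z ≫ pullback.snd _ _, hr', ?_, by rwa [hz] at h⟩
    rw [Category.assoc, ← pullback.condition, ← Category.assoc, hz, Category.assoc]

end CollectionDefinable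

/-! ### The collection property of the generated families -/

section CollectionInduction

variable {E : Type u} [Category.{v} E] [PiWPretopos E]
variable {F A B O : E} {φ : F ⟶ A} {m : F ⟶ B} {n : A ⟶ O}
variable {D A' : E} {q : D ⟶ F} {g : D ⟶ A'} {p : A' ⟶ A} {b : Prop}

/-- The fibres of `g` suffice for testing: a map from some fibre `D_c` to the index set of `W`
factors through the given cover, and the bounded condition at `c` gives a family whose index set
maps to `D_c`. In the strong case the composite is still surjective. -/
theorem BoundedCollectsAt.collectsAt (hcol : IsCollectionSquare q g φ p) (hp : IsCover p)
    {T : E} {W : T ⟶ A} (H : BoundedCollectsAt φ m n q g p b W) : CollectsAt φ m n b W := by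
  intro Y e he
  obtain ⟨sq, hcol⟩ := hcol
  obtain ⟨T₁, ρ, c₁, hρ, hc₁⟩ : ∃ (T₁ : E) (ρ : T₁ ⟶ T) (c₁ : T₁ ⟶ A'), IsCover ρ ∧
      c₁ ≫ p = ρ ≫ W := ⟨_, _, _, hp.pullback_fst W, pullback.condition.symm⟩
  obtain ⟨μ, hμ₁, hμ₂⟩ : ∃ μ : pullback c₁ g ⟶ pullback W φ,
      μ ≫ pullback.fst _ _ = pullback.fst _ _ ≫ ρ ∧
      μ ≫ pullback.snd _ _ = pullback.snd _ _ ≫ q :=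
    ⟨pullback.lift _ _ (by rw [Category.assoc, ← hc₁, pullback.condition_assoc, sq, Category.assoc]),
      pullback.lift_fst _ _ _, pullback.lift_snd _ _ _⟩
  -- `e` is first pulled back along the comparison `μ` to a cover of the fibre over `c₁`, where the
  -- collection square applies.
  obtain ⟨T₂, r₂, c₂, h₂, hr₂, hc₂, hf₂, hq₂, k₂, hk₂⟩ := hcol c₁ _ (he.pullback_fst μ)
  obtain ⟨T₃, r₃, z, hr₃, hz, hL⟩ := H (r₂ ≫ ρ) c₂ (by rw [hc₂, hc₁, Category.assoc])
  have w : (pullback.fst (z ≫ (secObj φ m (Over.mk (q ≫ m))).hom) φ ≫ z) ≫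
      (secObj φ m (Over.mk (q ≫ m))).hom = pullback.snd _ _ ≫ φ := by
    rw [Category.assoc, pullback.condition]
  have hk : secApp _ _ w ≫ q ≫ m = pullback.snd _ _ ≫ m := secApp_hom _ _ w
  obtain ⟨κ, hκ₁, hκ₂⟩ : ∃ κ : pullback (z ≫ (secObj φ m (Over.mk (q ≫ m))).hom) φ ⟶ pullback c₂ g,
      κ ≫ pullback.fst _ _ = pullback.fst _ _ ≫ r₃ ∧ κ ≫ pullback.snd _ _ = secApp _ _ w :=
    ⟨pullback.lift _ _ ((Category.assoc _ _ _).trans (hL.1 _ _ w).symm),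
      pullback.lift_fst _ _ _, pullback.lift_snd _ _ _⟩
  have hsnd : (κ ≫ h₂ ≫ μ) ≫ pullback.snd _ _ = secApp _ _ w ≫ q := by
    simp only [Category.assoc, hμ₂, hq₂, reassoc_of% hκ₂]
  have hfst : pullback.fst _ _ ≫ r₃ ≫ r₂ ≫ ρ = (κ ≫ h₂ ≫ μ) ≫ pullback.fst _ _ := by
    simp only [Category.assoc, hμ₁, ← reassoc_of% hf₂, reassoc_of% hκ₁]
  refine ⟨T₃, r₃ ≫ r₂ ≫ ρ, z ≫ (secObj φ m (Over.mk (q ≫ m))).hom, κ ≫ h₂ ≫ μ,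
    hr₃.comp (hr₂.comp hρ), ?_, ⟨hfst, fun hb => (isCover_lift_iff φ hfst).2 ?_⟩, ?_,
    κ ≫ k₂ ≫ pullback.snd _ _, ?_⟩
  · rw [Category.assoc, hz, ← Category.assoc c₂, hc₂]
    simp only [Category.assoc, reassoc_of% hc₁]
  · intro Q s l hl
    obtain ⟨Q', t, l', ht, w', hl'⟩ := hL.2 hb s l (by
      rw [← hl]; simp only [Category.assoc, hc₂, hc₁])
    refine ⟨Q', t, l', ht, by rw [← w']; simp only [Category.assoc], Eq.trans ?_ hl'⟩
    rw [hsnd, ← Category.assoc, comp_secApp]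
    exact congrArg (· ≫ q) (secApp_congr (by simp) (by simp) _ _)
  · rw [← Category.assoc, hsnd, Category.assoc, hk]
  · rw [Category.assoc, Category.assoc, ← pullback.condition, reassoc_of% hk₂]

theorem boundedCollectsAt_of_collectsAt (hcov : IsCoveringSquare q g φ p) {T : E} {W : T ⟶ A}
    (H : ∀ ⦃T' : E⦄ (r : T' ⟶ T), CollectsAt φ m n b (r ≫ W)) :
    BoundedCollectsAt φ m n q g p b W := by
  intro T' r c hc
  obtain ⟨-, sq, hD⟩ := hcov
  obtain ⟨e, he₁, he₂⟩ : ∃ e : pullback c g ⟶ pullback (r ≫ W) φ,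
      e ≫ pullback.fst _ _ = pullback.fst _ _ ∧ e ≫ pullback.snd _ _ = pullback.snd _ _ ≫ q :=
    ⟨pullback.lift _ _ (by rw [← hc, pullback.condition_assoc, sq, Category.assoc]),
      pullback.lift_fst _ _ _, pullback.lift_snd _ _ _⟩
  -- Because the square is covering, each fibre `D_c` covers the corresponding fibre of `φ`, so
  -- `D_c` is itself an instance to which the collection property applies.
  have he : IsCover e := isCover_iff_forall_local_lift.2 fun Q y => by
    obtain ⟨Q', t, x, ht, hx⟩ := hD.exists_local_lift (pullback.lift (y ≫ pullback.fst _ _ ≫ c)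
      (y ≫ pullback.snd _ _) (by simp [hc, pullback.condition]))
    have hx₁ := congrArg (· ≫ pullback.fst _ _) hx
    have hx₂ := congrArg (· ≫ pullback.snd _ _) hx
    simp only [Category.assoc, pullback.lift_fst, pullback.lift_snd] at hx₁ hx₂
    refine ⟨Q', t, pullback.lift (t ≫ y ≫ pullback.fst _ _) x (by simp [hx₁]), ht, ?_⟩
    apply pullback.hom_ext
    · simp [he₁]
    · simp [he₂, hx₂]
  obtain ⟨T'', r', W', h, hr', hn, ⟨w, hb⟩, hm, k, rfl⟩ := H r e he
  have hk : (k ≫ pullback.snd _ _) ≫ q ≫ m = pullback.snd W' φ ≫ m := by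
    rw [← hm, Category.assoc, Category.assoc, reassoc_of% he₂]
  refine ⟨T'', r', secMk (X := Over.mk (q ≫ m)) W' _ hk, hr', ?_, isFibreLift_secMk φ m q g p hk ?_
    fun b' Q s l hl => ?_⟩
  · rw [secMk_hom_assoc, hn, ← Category.assoc c, hc, Category.assoc]
  · rw [Category.assoc, ← pullback.condition, ← he₁, ← Category.assoc, ← Category.assoc, ← w,
      Category.assoc]
  · obtain ⟨Q', t, l', ht, w', e'⟩ := (isCover_lift_iff φ w).1 (hb b') s l (by
      rw [← hl, Category.assoc, hc])
    refine ⟨Q', t, l', ht, w', Eq.trans ?_ e'⟩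
    simp only [Category.assoc, he₂]

namespace GeneratedFamilies

open InternalCategory

variable {C : InternalCategory E} {S : Site C} {G : GeneratedFamilies S}

/-- The family `*` has a single index, so it suffices to lift one element to `D`, which is possible
locally; the new family is `*` again. -/
theorem boundedCollectsAt_star {q : D ⟶ G.Fam} {p : A' ⟶ G.Cov}
    (hcov : IsCoveringSquare q g G.φ p) {T : E} (c : T ⟶ C.Ob) :
    BoundedCollectsAt G.φ G.m G.n q g p b (c ≫ G.star) := by
  intro T' r a ha
  obtain ⟨-, sq, hD⟩ := hcov
  obtain ⟨T'', t, x, ht, hx⟩ := hD.exists_local_lift (pullback.lift a (r ≫ c ≫ G.unit) (by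
    simp [ha, G.unit_φ]))
  have hx₁ := congrArg (· ≫ pullback.fst _ _) hx
  have hx₂ := congrArg (· ≫ pullback.snd _ _) hx
  simp only [Category.assoc, pullback.lift_fst, pullback.lift_snd] at hx₁ hx₂
  have hs : pullback.snd ((t ≫ r ≫ c) ≫ G.star) G.φ =
      pullback.fst _ _ ≫ t ≫ r ≫ c ≫ G.unit := by
    have := G.eq_unit (c := pullback.fst ((t ≫ r ≫ c) ≫ G.star) G.φ ≫ t ≫ r ≫ c)
      (pullback.condition.symm.trans (Category.assoc _ _ _).symm)
    simpa only [Category.assoc] using this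
  have hk : (pullback.fst ((t ≫ r ≫ c) ≫ G.star) G.φ ≫ x) ≫ q ≫ G.m =
      pullback.snd _ _ ≫ G.m := by
    rw [hs]
    simp only [Category.assoc, reassoc_of% hx₂]
  refine ⟨T'', t, secMk (X := Over.mk (q ≫ G.m)) ((t ≫ r ≫ c) ≫ G.star) _ hk, ht, ?_,
    isFibreLift_secMk G.φ G.m q g p hk ?_ fun _ Q s l hl => ?_⟩
  · rw [secMk_hom_assoc, reassoc_of% ha]
    simp
  · exact (Category.assoc _ _ _).trans (congrArg (_ ≫ ·) hx₁)
  · have w : s ≫ (t ≫ r ≫ c) ≫ G.star = l ≫ G.φ := by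
      rw [← hl]; simp only [Category.assoc, ha]
    have e := G.eq_unit (c := s ≫ t ≫ r ≫ c) (w.symm.trans (Category.assoc _ _ _).symm)
    refine ⟨Q, 𝟙 _, l, .of_isIso _, by simpa using w, ?_⟩
    simp only [Category.assoc]
    rw [pullback.lift_fst_assoc, hx₂, e]
    simp

/-- The collection property is used on two levels: for the families `t i`, by hypothesis, and then
for `a`, to turn the resulting local choices into a function. -/
theorem collectsAt_sup (hS : IsCollSquare b S.m S.φ C.cod S.n) {T : E} {a : T ⟶ S.Cov}
    {t : pullback a S.φ ⟶ G.Cov} {ht : t ≫ G.n = pullback.snd a S.φ ≫ S.m ≫ C.dom}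
    (IH : CollectsAt G.φ G.m G.n b t) : CollectsAt G.φ G.m G.n b (sup a t ht) := by
  intro Y e he
  obtain ⟨μ, hμ₁, hμ₂⟩ : ∃ μ : pullback t G.φ ⟶ pullback (sup a t ht) G.φ,
      μ ≫ pullback.fst _ _ = pullback.fst _ _ ≫ pullback.fst _ _ ∧
      μ ≫ pullback.snd _ _ = supMem a t ht :=
    ⟨pullback.lift _ _ (by rw [supMem_φ, Category.assoc]),
      pullback.lift_fst _ _ _, pullback.lift_snd _ _ _⟩
  -- `V` replaces the families `t i`, but only over a cover `ρ` of the index set of `a`.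
  obtain ⟨R', ρ, V, h₁, hρ, hV, ⟨w₁, hb₁⟩, hm₁, k₁, hk₁⟩ := IH _ (he.pullback_fst μ)
  -- `a'` maps through `ρ`, so `k₂ ≫ V` is a function and `sup a' (k₂ ≫ V)` is the required family.
  obtain ⟨T', r, a', h₂, hr, ha', ⟨w₂, hb₂⟩, hm₂, k₂, rfl⟩ := hS.2 a ρ hρ
  have ht' : (k₂ ≫ V) ≫ G.n = pullback.snd a' S.φ ≫ S.m ≫ C.dom := by
    rw [Category.assoc, hV, ht, reassoc_of% hm₂]
  obtain ⟨j, hj₁, hj₂⟩ : ∃ j : pullback (sup a' (k₂ ≫ V) ht') G.φ ⟶ pullback (k₂ ≫ V) G.φ,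
      j ≫ supMem _ _ ht' = pullback.snd _ _ ∧
      j ≫ pullback.fst _ _ ≫ pullback.fst _ _ = pullback.fst _ _ :=
    ⟨_, (isPullback_supMem a' _ ht').lift_fst _ _ pullback.condition.symm,
      (isPullback_supMem a' _ ht').lift_snd _ _ pullback.condition.symm⟩
  obtain ⟨i, hi₁, hi₂⟩ : ∃ i : pullback (k₂ ≫ V) G.φ ⟶ pullback V G.φ,
      i ≫ pullback.fst _ _ = pullback.fst _ _ ≫ k₂ ∧ i ≫ pullback.snd _ _ = pullback.snd _ _ :=
    ⟨pullback.lift _ _ (by rw [Category.assoc, pullback.condition]),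
      pullback.lift_fst _ _ _, pullback.lift_snd _ _ _⟩
  have w : pullback.fst _ _ ≫ r = (j ≫ i ≫ h₁ ≫ μ) ≫ pullback.fst _ _ := by
    simp only [Category.assoc] at w₂
    simp only [Category.assoc, hμ₁, ← reassoc_of% w₁, reassoc_of% hi₁, ← w₂, reassoc_of% hj₂]
  refine ⟨T', r, sup a' (k₂ ≫ V) ht', j ≫ i ≫ h₁ ≫ μ, hr, by simpa using ha',
    ⟨w, fun hb => (isCover_lift_iff G.φ w).2 ?_⟩, ?_, j ≫ i ≫ k₁ ≫ pullback.snd _ _, ?_⟩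
  -- Surjectivity in the strong case: of an index `(i, k)`, first `i` is lifted along the index map
  -- of `a'`, then `k` along that of `V`.
  · intro Q s l hl
    obtain ⟨y, hy, hy'⟩ : ∃ y, y ≫ supMem a t ht = l ∧
        y ≫ pullback.fst _ _ ≫ pullback.fst _ _ = s ≫ r :=
      ⟨_, (isPullback_supMem a t ht).lift_fst l (s ≫ r) (by rw [← hl, Category.assoc]),
        (isPullback_supMem a t ht).lift_snd l (s ≫ r) (by rw [← hl, Category.assoc])⟩
    obtain ⟨Q₂, t₂, l₂, ht₂, v₂, e₂⟩ := (isCover_lift_iff S.φ w₂).1 (hb₂ hb) s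
      (y ≫ pullback.fst _ _ ≫ pullback.snd _ _) (by
        rw [← Category.assoc, ← hy']
        simp only [Category.assoc, pullback.condition])
    obtain ⟨x, hx₁, hx₂⟩ : ∃ x : Q₂ ⟶ pullback a' S.φ, x ≫ pullback.fst _ _ = t₂ ≫ s ∧
        x ≫ k₂ ≫ ρ = t₂ ≫ y ≫ pullback.fst _ _ := by
      refine ⟨_, pullback.lift_fst _ _ v₂, ?_⟩
      apply pullback.hom_ext
      · simp only [Category.assoc] at w₂ ⊢
        rw [← w₂, pullback.lift_fst_assoc, hy', Category.assoc]
      · simpa only [Category.assoc] using e₂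
    obtain ⟨Q₁, t₁, l₁, ht₁, v₁, e₁⟩ := (isCover_lift_iff G.φ w₁).1 (hb₁ hb) (x ≫ k₂)
      (t₂ ≫ y ≫ pullback.snd _ _) (by
        simp only [Category.assoc, reassoc_of% hx₂, pullback.condition])
    obtain ⟨u, hu₁, hu₂⟩ : ∃ u : Q₁ ⟶ pullback (k₂ ≫ V) G.φ,
        u ≫ pullback.fst _ _ = t₁ ≫ x ∧ u ≫ i = pullback.lift _ l₁ v₁ := by
      refine ⟨pullback.lift (t₁ ≫ x) l₁ (by simpa using v₁), pullback.lift_fst _ _ _, ?_⟩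
      apply pullback.hom_ext
      · simp [hi₁]
      · simp [hi₂]
    have v : ((t₁ ≫ t₂) ≫ s) ≫ sup a' (k₂ ≫ V) ht' = (u ≫ supMem _ _ ht') ≫ G.φ := by
      rw [Category.assoc u, supMem_φ, reassoc_of% hu₁, reassoc_of% hx₁]
      simp only [Category.assoc]
    have hj : pullback.lift _ _ v ≫ j = u := by
      apply (isPullback_supMem a' _ ht').hom_ext
      · rw [Category.assoc, hj₁, pullback.lift_snd]
      · rw [Category.assoc, hj₂, pullback.lift_fst, reassoc_of% hu₁, hx₁]
        simp only [Category.assoc]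
    have hh : u ≫ i ≫ h₁ = t₁ ≫ t₂ ≫ y := by
      rw [reassoc_of% hu₂]
      apply pullback.hom_ext
      · rw [Category.assoc, ← w₁, pullback.lift_fst_assoc]
        simp [hx₂]
      · simpa using e₁
    refine ⟨Q₁, t₁ ≫ t₂, _, ht₁.comp ht₂, v, ?_⟩
    simp only [Category.assoc, reassoc_of% hj, reassoc_of% hh, hμ₂, hy]
  -- Corresponding members are equal arrows, being composites of the same two arrows.
  · have c₁ := (isComp_supMem a t ht).precomp (j ≫ i ≫ h₁)
    have c₂ := (isComp_supMem a' (k₂ ≫ V) ht').precomp j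
    simp only [Category.assoc] at c₁ c₂ hm₂
    rw [← reassoc_of% w₁, reassoc_of% hi₁, hm₂, hm₁, reassoc_of% hi₂] at c₁
    simp only [Category.assoc, reassoc_of% hμ₂]
    rw [c₁.unique c₂, reassoc_of% hj₁]
  · simp only [Category.assoc, ← pullback.condition, reassoc_of% hk₁]

/-- The generated families form a (strong) collection square if those of the original site do. -/
theorem isCollSquare (G : GeneratedFamilies S) (hE : AMC E)
    (hS : IsCollSquare b S.m S.φ C.cod S.n) : IsCollSquare b G.m G.φ C.cod G.n := by
  -- This square only serves to make the induction predicate definable; a plain collection square is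
  -- enough even when `b` holds.
  obtain ⟨D, A', q, g, p, hcov, hcol⟩ := hE G.φ
  refine ⟨G.comm.symm, fun T W => BoundedCollectsAt.collectsAt (m := G.m) (n := G.n) (b := b) hcol
    hcov.1 ?_⟩
  refine G.induction (definable_boundedCollectsAt G.φ G.m G.n q g p b) (fun T c =>
    boundedCollectsAt_star hcov c) (fun T a t ht IH => ?_) W
  -- The induction runs on the bounded form, while the step for `sup` is carried out with the
  -- unbounded one.
  refine boundedCollectsAt_of_collectsAt hcov fun T' r => ?_
  rw [comp_sup]
  exact collectsAt_sup hS (BoundedCollectsAt.collectsAt hcol hcov.1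
    ((definable_boundedCollectsAt G.φ G.m G.n q g p b).precomp (reindex r a S.φ) IH))

end GeneratedFamilies

end CollectionInduction

/-! ### Sheaves and refinements -/

section Sheaves

variable {E : Type u} [Category.{v} E] [PiWPretopos E]

theorem IsCover.cancel {X Y Z : E} {f : X ⟶ Y} (hf : IsCover f) {a b : Y ⟶ Z}
    (h : f ≫ a = f ≫ b) : a = b := by
  have : Epi f := (isCover_iff_strongEpi.1 hf).epi
  exact (cancel_epi f).1 h

variable {C : InternalCategory E} {P : Presheaf C}

theorem Presheaf.IsAct.of_cover {T T' : E} {r : T' ⟶ T} (hr : IsCover r) {x y : T ⟶ P.X}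
    {f : T ⟶ C.Ar} (h : P.IsAct (r ≫ x) (r ≫ f) (r ≫ y)) : P.IsAct x f y := by
  obtain ⟨y', hy'⟩ := Presheaf.exists_isAct (P := P) (x := x) (f := f)
    (hr.cancel (by simpa using h.π_eq_cod))
  rwa [hr.cancel (h.unique (hy'.precomp r))]

section Families

variable (P) {F A : E} (φ : F ⟶ A) (n : A ⟶ C.Ob) (m : F ⟶ C.Ar)

/-- Two elements of `P` over the same object agree on all members of a family. -/
def AgreeOn {T : E} (W : T ⟶ A) (p p' : T ⟶ P.X) : Prop :=
  ∀ ⦃Q : E⦄ (s : Q ⟶ T) (i : Q ⟶ F), i ≫ φ = s ≫ W → ∀ ⦃u u' : Q ⟶ P.X⦄,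
    P.IsAct (s ≫ p) (i ≫ m) u → P.IsAct (s ≫ p') (i ≫ m) u' → u = u'

/-- Elements of `P` are determined by their restrictions to the members of the family `W`. -/
def SeparatedAt {T : E} (W : T ⟶ A) : Prop :=
  ∀ ⦃Q : E⦄ (r : Q ⟶ T) (p p' : Q ⟶ P.X), p ≫ P.π = r ≫ W ≫ n → p' ≫ P.π = r ≫ W ≫ n →
    AgreeOn P φ m (r ≫ W) p p' → p = p'

end Families

variable {S S' : Site C}

/-- The restrictions of an element form a compatible family, of which both elements are
amalgamations. -/
theorem Site.IsSheaf.separatedAt (hP : S.IsSheaf P) {T : E} (U : T ⟶ S.Cov) :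
    SeparatedAt P S.φ S.n S.m U := by
  intro Q r p p' hp hp' H
  have hw : ∀ p : Q ⟶ P.X, p ≫ P.π = r ≫ U ≫ S.n →
      (pullback.fst (r ≫ U) S.φ ≫ p) ≫ P.π = (pullback.snd _ _ ≫ S.m) ≫ C.cod := by
    intro p hp
    rw [Category.assoc, Category.assoc, hp, S.comm, ← pullback.condition_assoc, Category.assoc]
  obtain ⟨x, hx⟩ := Presheaf.exists_isAct (hw p hp)
  obtain ⟨x', hx'⟩ := Presheaf.exists_isAct (hw p' hp')
  obtain rfl := H _ _ pullback.condition.symm hx hx'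
  refine (hP (r ≫ U) x ⟨hx.π_eq.trans (Category.assoc _ _ _), ?_⟩).unique
    ⟨by rw [hp, Category.assoc], hx⟩ ⟨by rw [hp', Category.assoc], hx'⟩
  intro T' i j f g d y z hij hf hg hy hz
  have hi := hx.precomp i
  have hj := hx.precomp j
  rw [← Category.assoc, hij, Category.assoc] at hi
  exact (hi.assoc hy hf).unique (hj.assoc hz hg)

/-- Every covering family of `S` is locally refined by a covering family of `S'`. -/
def Site.IsRefinedBy (S S' : Site C) : Prop :=
  ∀ ⦃T : E⦄ (U : T ⟶ S.Cov), ∃ (T' : E) (r : T' ⟶ T) (V : T' ⟶ S'.Cov), IsCover r ∧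
    V ≫ S'.n = r ≫ U ≫ S.n ∧ ∀ ⦃Q : E⦄ (s : Q ⟶ T') (j : Q ⟶ S'.Fam), j ≫ S'.φ = s ≫ V →
      ∃ (Q' : E) (r' : Q' ⟶ Q) (i : Q' ⟶ S.Fam) (h : Q' ⟶ C.Ar), IsCover r' ∧
        i ≫ S.φ = r' ≫ s ≫ r ≫ U ∧ C.IsComp (i ≫ S.m) h (r' ≫ j ≫ S'.m)

/-- Agreement on `U` gives agreement on every arrow that factors locally through `U`, in particular
on a refining family of `S'`. -/
theorem Site.IsRefinedBy.separatedAt (h : S.IsRefinedBy S') (hP : S'.IsSheaf P) {T : E}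
    (U : T ⟶ S.Cov) : SeparatedAt P S.φ S.n S.m U := by
  intro T₁ r₁ p p' hp hp' H
  obtain ⟨T', r, V, hr, hV, hj⟩ := h (r₁ ≫ U)
  simp only [Category.assoc] at hV
  refine hr.cancel (hP.separatedAt V (𝟙 _) _ _ (by simp [hp, hV]) (by simp [hp', hV]) ?_)
  intro Q s j hs u u' hu hu'
  rw [Category.id_comp] at hs
  obtain ⟨Q', r', i, k, hr', hi, hk⟩ := hj s j hs
  have hπ : ∀ q : T₁ ⟶ P.X, q ≫ P.π = r₁ ≫ U ≫ S.n →
      (r' ≫ s ≫ r ≫ q) ≫ P.π = (i ≫ S.m) ≫ C.cod := by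
    intro q hq
    rw [Category.assoc i, S.comm, reassoc_of% hi]
    simp [hq]
  obtain ⟨x, hx⟩ := Presheaf.exists_isAct (hπ p hp)
  obtain ⟨x', hx'⟩ := Presheaf.exists_isAct (hπ p' hp')
  obtain rfl := H (r' ≫ s ≫ r) i (by simpa using hi) (by simpa using hx) (by simpa using hx')
  exact hr'.cancel ((hx.assoc' (hu.precomp r') hk).unique (hx'.assoc' (hu'.precomp r') hk))

/-- Compatible families restrict along refinements. -/
theorem Site.IsCompatible.exists_restrict {T T' : E} {U : T ⟶ S.Cov} {x : pullback U S.φ ⟶ P.X}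
    (hx : S.IsCompatible P U x) {r : T' ⟶ T} {V : T' ⟶ S'.Cov}
    (hj : ∀ ⦃Q : E⦄ (s : Q ⟶ T') (j : Q ⟶ S'.Fam), j ≫ S'.φ = s ≫ V →
      ∃ (Q' : E) (r' : Q' ⟶ Q) (i : Q' ⟶ S.Fam) (h : Q' ⟶ C.Ar), IsCover r' ∧
        i ≫ S.φ = r' ≫ s ≫ r ≫ U ∧ C.IsComp (i ≫ S.m) h (r' ≫ j ≫ S'.m)) :
    ∃ y : pullback V S'.φ ⟶ P.X, S'.IsCompatible P V y ∧
      ∀ ⦃Q : E⦄ (s : Q ⟶ pullback V S'.φ) (i : Q ⟶ pullback U S.φ) (f g d : Q ⟶ C.Ar)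
        (u u' : Q ⟶ P.X), s ≫ pullback.fst _ _ ≫ r = i ≫ pullback.fst _ _ →
        C.IsComp (s ≫ pullback.snd V S'.φ ≫ S'.m) f d → C.IsComp (i ≫ pullback.snd U S.φ ≫ S.m) g d →
        P.IsAct (s ≫ y) f u → P.IsAct (i ≫ x) g u' → u = u' := by
  obtain ⟨Q, ρ, i, h, hρ, hi, hh⟩ := hj (pullback.fst V S'.φ) (pullback.snd V S'.φ)
    pullback.condition.symm
  obtain ⟨ι, hι₁, hι₂⟩ : ∃ ι : Q ⟶ pullback U S.φ,
      ι ≫ pullback.fst _ _ = ρ ≫ pullback.fst _ _ ≫ r ∧ ι ≫ pullback.snd _ _ = i :=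
    ⟨pullback.lift _ i (by simp [hi]), pullback.lift_fst _ _ _, pullback.lift_snd _ _ _⟩
  rw [← hι₂, Category.assoc] at hh
  obtain ⟨y', hy'⟩ := Presheaf.exists_isAct (P := P) (x := ι ≫ x) (f := h) (by
    rw [Category.assoc, hx.1, ← hh.dom_eq_cod, Category.assoc, Category.assoc])
  -- the action on `y'` is an action on `x`
  have key : ∀ ⦃R : E⦄ (a : R ⟶ Q) (i' : R ⟶ pullback U S.φ) (f g d : R ⟶ C.Ar) (u u' : R ⟶ P.X),
      a ≫ ρ ≫ pullback.fst _ _ ≫ r = i' ≫ pullback.fst _ _ →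
      C.IsComp (a ≫ ρ ≫ pullback.snd V S'.φ ≫ S'.m) f d →
      C.IsComp (i' ≫ pullback.snd U S.φ ≫ S.m) g d →
      P.IsAct (a ≫ y') f u → P.IsAct (i' ≫ x) g u' → u = u' := by
    intro R a i' f g d u u' e hf hg hu hu'
    obtain ⟨k, hk⟩ := InternalCategory.exists_isComp (C := C) (g := a ≫ h) (f := f) (by
      rw [← hf.dom_eq_cod, ← (hh.precomp a).dom_eq])
    refine hx.2 (a ≫ ι) i' k g d u u' (by rw [← e, Category.assoc, hι₁]) ?_ hg ?_ hu'
    · simpa using (hh.precomp a).assoc hf hk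
    · simpa using (hy'.precomp a).assoc hu hk
  -- The factorisations exist only over the cover `ρ`. Compatibility of `x` makes the restricted
  -- values independent of the factorisation, so they descend.
  obtain ⟨y, rfl⟩ := hρ.exists_desc y' (fun R a b hab => by
    have hyb := hy'.precomp b
    rw [← Category.assoc] at hyb
    refine key a (b ≫ ι) (a ≫ ρ ≫ pullback.snd V S'.φ ≫ S'.m ≫ C.dom ≫ C.ident) (b ≫ h)
      (a ≫ ρ ≫ pullback.snd V S'.φ ≫ S'.m) _ _ ?_ ?_ ?_ ?_ hyb
    · rw [Category.assoc, hι₁, reassoc_of% hab]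
    · simpa using InternalCategory.isComp_ident_right (C := C)
        (a ≫ ρ ≫ pullback.snd V S'.φ ≫ S'.m)
    · simpa [← reassoc_of% hab] using hh.precomp b
    · have := Presheaf.isAct_ident (a ≫ y')
      convert! this using 1
      have e := hy'.π_eq
      have e' := hh.dom_eq
      simp only [Category.assoc] at e e' ⊢
      rw [reassoc_of% e, ← reassoc_of% e'])
  have key' : ∀ ⦃Q : E⦄ (s : Q ⟶ pullback V S'.φ) (i : Q ⟶ pullback U S.φ) (f g d : Q ⟶ C.Ar)
        (u u' : Q ⟶ P.X), s ≫ pullback.fst _ _ ≫ r = i ≫ pullback.fst _ _ →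
        C.IsComp (s ≫ pullback.snd V S'.φ ≫ S'.m) f d → C.IsComp (i ≫ pullback.snd U S.φ ≫ S.m) g d →
        P.IsAct (s ≫ y) f u → P.IsAct (i ≫ x) g u' → u = u' := by
    intro R s i' f g d u u' e hf hg hu hu'
    obtain ⟨R', t, a, ht, ha⟩ := hρ.exists_local_lift s
    refine ht.cancel (key a (t ≫ i') (t ≫ f) (t ≫ g) (t ≫ d) _ _ ?_ ?_ ?_ ?_ ?_)
    · rw [reassoc_of% ha, e, Category.assoc]
    · simpa [reassoc_of% ha] using hf.precomp t
    · simpa using hg.precomp t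
    · simpa [reassoc_of% ha] using hu.precomp t
    · simpa using hu'.precomp t
  refine ⟨y, ⟨?_, ?_⟩, key'⟩
  · apply hρ.cancel
    have e := hy'.π_eq
    have e' := hh.dom_eq
    simp only [Category.assoc] at e e' ⊢
    rw [e, e']
  · intro R s s' f g d u u' e hf hg hu hu'
    obtain ⟨R', t, a, ht, ha⟩ := hρ.exists_local_lift s'
    obtain ⟨k, hk⟩ := InternalCategory.exists_isComp (C := C) (g := a ≫ h) (f := t ≫ g) (by
      rw [← (hg.precomp t).dom_eq_cod, ← (hh.precomp a).dom_eq]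
      simp only [Category.assoc, reassoc_of% ha])
    have hg' := hg.precomp t
    have hu'' := hu'.precomp t
    rw [← reassoc_of% ha] at hg' hu''
    refine ht.cancel (key' (t ≫ s) (a ≫ ι) (t ≫ f) k (t ≫ d) _ _ ?_ ?_ ?_ ?_ ?_)
    · simp only [Category.assoc, hι₁, reassoc_of% ha, reassoc_of% e]
    · simpa using hf.precomp t
    · simpa using (hh.precomp a).assoc hg' hk
    · simpa using hu.precomp t
    · simpa using (hy'.precomp a).assoc hu'' hk

/-- If the families of `S` are refined by families of `S'`, then `S'`-sheaves are `S`-sheaves. -/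
theorem Site.IsRefinedBy.isSheaf (h : S.IsRefinedBy S') (hP : S'.IsSheaf P) : S.IsSheaf P := by
  intro T U x hx
  obtain ⟨T', r, V, hr, hV, hj⟩ := h U
  obtain ⟨y, hy, hxy⟩ := hx.exists_restrict hj
  obtain ⟨p', ⟨hp', hp'y⟩, -⟩ := hP V y hy
  -- The amalgamation over `V` also restricts to `x` on members of `U`. Stability of `S'` pulls `V`
  -- back along such a member; on the result both sides are given by `x`, and separatedness
  -- concludes.
  have key : ∀ ⦃Q : E⦄ (i : Q ⟶ pullback U S.φ) (s : Q ⟶ T'), s ≫ r = i ≫ pullback.fst _ _ →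
      P.IsAct (s ≫ p') (i ≫ pullback.snd _ _ ≫ S.m) (i ≫ x) := by
    intro Q i s hs
    have hf : (i ≫ pullback.snd _ _ ≫ S.m) ≫ C.cod = (s ≫ V) ≫ S'.n := by
      simp only [Category.assoc, hV, reassoc_of% hs, pullback.condition_assoc, S.comm]
    obtain ⟨w, hw⟩ := Presheaf.exists_isAct (P := P) (x := s ≫ p')
      (f := i ≫ pullback.snd _ _ ≫ S.m) (by rw [Category.assoc, hp', hf, Category.assoc])
    obtain ⟨R, ρ, V', hρ, hV', hl⟩ := S'.stable _ _ hf
    suffices e : w = i ≫ x by rwa [e] at hw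
    refine hρ.cancel (hP.separatedAt V' (𝟙 _) _ _ ?_ ?_ ?_)
    · rw [Category.id_comp, hV', Category.assoc, hw.π_eq]
    · rw [Category.id_comp, hV', Category.assoc, Category.assoc, hx.1]
      simp only [Category.assoc]
    intro Q₁ t k hk u u' hu hu'
    rw [Category.id_comp] at hk
    obtain ⟨Q', r', j, g, d, hr', hj', h₁, h₂⟩ := hl t k hk
    have hj'' : (r' ≫ t ≫ ρ ≫ s) ≫ V = j ≫ S'.φ := by simp [hj']
    have hyj := hp'y.precomp (pullback.lift _ j hj'')
    rw [pullback.lift_fst_assoc, pullback.lift_snd_assoc] at hyj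
    have hw' := hw.precomp (r' ≫ t ≫ ρ)
    simp only [Category.assoc] at hw' hyj
    refine hr'.cancel (hxy (pullback.lift _ j hj'') (r' ≫ t ≫ ρ ≫ i) g (r' ≫ k ≫ S'.m) d _ _
      ?_ ?_ ?_ ?_ ?_)
    · rw [pullback.lift_fst_assoc]
      simp only [Category.assoc, hs]
    · rwa [pullback.lift_snd_assoc]
    · simpa using h₁
    · have := hw'.assoc (hu.precomp r') (by simpa using h₁)
      exact hyj.assoc' this h₂
    · simpa using hu'.precomp r'
  -- `p'` lives over the cover `r`; its two restrictions agree on the members of `U`, hence are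
  -- equal, and `p'` descends.
  have glue : ∀ ⦃Q : E⦄ (a b : Q ⟶ T'), a ≫ r = b ≫ r → a ≫ p' = b ≫ p' := by
    intro Q a b hab
    refine h.separatedAt hP U (a ≫ r) _ _ ?_ ?_ ?_
    · rw [Category.assoc, hp', hV, Category.assoc]
    · rw [Category.assoc, hp', hV, hab, Category.assoc]
    intro Q' s i hi u u' hu hu'
    have w : (s ≫ a ≫ r) ≫ U = i ≫ S.φ := by rw [hi]; simp only [Category.assoc]
    have ha := key (pullback.lift _ i w) (s ≫ a) (by simp)
    have hb := key (pullback.lift _ i w) (s ≫ b) (by simp [hab])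
    rw [pullback.lift_snd_assoc, Category.assoc] at ha hb
    exact (hu.unique ha).trans (hb.unique hu')
  obtain ⟨p, rfl⟩ := hr.exists_desc p' glue
  have hpπ : p ≫ P.π = U ≫ S.n := hr.cancel (by rw [← hV, ← hp', Category.assoc])
  refine ⟨p, ⟨hpπ, ?_⟩, ?_⟩
  · obtain ⟨Q, t, a, ht, ha⟩ := hr.exists_local_lift (pullback.fst U S.φ)
    refine Presheaf.IsAct.of_cover ht ?_
    rw [← reassoc_of% ha]
    simpa only [Category.assoc] using key t a ha
  · rintro p₂ ⟨hp₂, hx₂⟩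
    refine h.separatedAt hP U (𝟙 _) _ _ (by simp [hp₂]) (by simp [hpπ]) ?_
    intro Q s i hi u u' hu hu'
    rw [Category.id_comp] at hi
    have h₂ := hx₂.precomp (pullback.lift s i hi.symm)
    rw [pullback.lift_fst_assoc, pullback.lift_snd_assoc] at h₂
    obtain ⟨Q', t, a, ht, ha⟩ := hr.exists_local_lift s
    have h₃ := key (t ≫ pullback.lift s i hi.symm) a (by rw [ha, Category.assoc, pullback.lift_fst])
    rw [Category.assoc, Category.assoc, pullback.lift_snd_assoc, reassoc_of% ha] at h₃
    exact (hu.unique h₂).trans (ht.cancel (h₃.unique (hu'.precomp t)))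

theorem Site.equivalent_of_isSheaf_iff (h : ∀ P : Presheaf C, S.IsSheaf P ↔ S'.IsSheaf P) :
    S.Equivalent S' := by
  refine ⟨h, ?_⟩
  have e : S.IsSheaf = S'.IsSheaf := funext fun P => propext (h P)
  unfold Sheaves
  rw [e]
  exact ⟨CategoryTheory.Equivalence.refl⟩

theorem Site.Equivalent.trans {S'' : Site C} (h : S.Equivalent S') (h' : S'.Equivalent S'') :
    S.Equivalent S'' :=
  equivalent_of_isSheaf_iff fun P => (h.1 P).trans (h'.1 P)

end Sheaves

/-! ### Sheaves for the generated families -/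

section DefinableSheaf

variable {E : Type u} [Category.{v} E] [PiWPretopos E] {C : InternalCategory E} (P : Presheaf C)
  {F A : E} (φ : F ⟶ A) (n : A ⟶ C.Ob) (m : F ⟶ C.Ar) (hm : m ≫ C.cod = φ ≫ n)

include hm in
theorem definable_separatedAt :
    Definable (fun _ W => SeparatedAt P φ n m W : ElemPred A) := by
  obtain ⟨Z, w, p, p', hp, hp', huniv⟩ : ∃ (Z : E) (w : Z ⟶ A) (p p' : Z ⟶ P.X),
      p ≫ P.π = w ≫ n ∧ p' ≫ P.π = w ≫ n ∧ ∀ ⦃Q : E⦄ (w₀ : Q ⟶ A) (p₀ p₀' : Q ⟶ P.X),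
        p₀ ≫ P.π = w₀ ≫ n → p₀' ≫ P.π = w₀ ≫ n →
        ∃ z : Q ⟶ Z, z ≫ w = w₀ ∧ z ≫ p = p₀ ∧ z ≫ p' = p₀' :=
    ⟨pullback (pullback.fst n P.π) (pullback.fst n P.π), pullback.fst _ _ ≫ pullback.fst _ _,
      pullback.fst _ _ ≫ pullback.snd _ _, pullback.snd _ _ ≫ pullback.snd _ _,
      by rw [Category.assoc, Category.assoc, pullback.condition],
      by rw [Category.assoc, pullback.condition, Category.assoc, pullback.condition],
      fun Q w₀ p₀ p₀' h h' => ⟨pullback.lift (pullback.lift w₀ p₀ h.symm)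
        (pullback.lift w₀ p₀' h'.symm) (by simp), by simp⟩⟩
  have hw : ∀ p : Z ⟶ P.X, p ≫ P.π = w ≫ n →
      (pullback.fst w φ ≫ p) ≫ P.π = (pullback.snd _ _ ≫ m) ≫ C.cod := by
    intro p hp
    rw [Category.assoc, Category.assoc, hp, hm, ← pullback.condition_assoc]
  obtain ⟨u, hu⟩ := Presheaf.exists_isAct (hw p hp)
  obtain ⟨u', hu'⟩ := Presheaf.exists_isAct (hw p' hp')
  refine (Definable.all w ((Definable.all (pullback.fst w φ) (Definable.eq u u')).imp
    (Definable.eq p p'))).congr fun T W => ⟨fun H T' r z hz T'' r' h => ?_, fun H Q r q q' hq hq' h => ?_⟩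
  · refine H (r' ≫ r) _ _ ?_ ?_ ?_
    · rw [Category.assoc, hp, Category.assoc, reassoc_of% hz, Category.assoc]
    · rw [Category.assoc, hp', Category.assoc, reassoc_of% hz, Category.assoc]
    intro Q s i hi v v' hv hv'
    have e : (s ≫ r' ≫ z) ≫ w = i ≫ φ := by simp [hi, hz]
    have hl := hu.precomp (pullback.lift _ i e)
    have hl' := hu'.precomp (pullback.lift _ i e)
    simp only [pullback.lift_fst_assoc, pullback.lift_snd_assoc, Category.assoc] at hl hl'
    rw [Category.assoc] at hv hv'
    rw [hv.unique hl, hv'.unique hl', h s _ (pullback.lift_fst _ _ _)]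
  · obtain ⟨z, hz, rfl, rfl⟩ := huniv (r ≫ W) q q' (by simp [hq]) (by simp [hq'])
    have := H r z hz (𝟙 _) (fun Q' s y hy => h s (y ≫ pullback.snd _ _) ?_ ?_ ?_)
    · simpa using this
    · rw [Category.assoc, ← pullback.condition, reassoc_of% hy, hz]
    · simpa [reassoc_of% hy] using hu.precomp y
    · simpa [reassoc_of% hy] using hu'.precomp y

/-- The object of pairs `(W, x)` of a family `W` and a function `x` assigning an element of `P` to
each member of `W`. -/
abbrev Presheaf.Values : Over A := secObj φ (m ≫ C.dom) (Over.mk P.π)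

variable {T : E}

/-- The function `z` is a compatible family. -/
def CompatibleValues (z : T ⟶ (P.Values φ m).left) : Prop :=
  ∀ ⦃Q : E⦄ (r : Q ⟶ T) (i j : Q ⟶ F) (f g d : Q ⟶ C.Ar) (y y' : Q ⟶ P.X)
    (hi : (r ≫ z) ≫ (P.Values φ m).hom = i ≫ φ) (hj : (r ≫ z) ≫ (P.Values φ m).hom = j ≫ φ),
    C.IsComp (i ≫ m) f d → C.IsComp (j ≫ m) g d → P.IsAct (secApp (r ≫ z) i hi) f y →
    P.IsAct (secApp (r ≫ z) j hj) g y' → y = y'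

/-- `p` is an amalgamation of the function `z`. -/
def AmalgamatesValues (z : T ⟶ (P.Values φ m).left) (p : T ⟶ P.X) : Prop :=
  p ≫ P.π = z ≫ (P.Values φ m).hom ≫ n ∧
  ∀ ⦃Q : E⦄ (s : Q ⟶ T) (i : Q ⟶ F) (hi : (s ≫ z) ≫ (P.Values φ m).hom = i ≫ φ),
    P.IsAct (s ≫ p) (i ≫ m) (secApp (s ≫ z) i hi)

/-- All compatible families for `W` have an amalgamation. -/
def AmalgamableAt (W : T ⟶ A) : Prop :=
  ∀ ⦃Q : E⦄ (r : Q ⟶ T) (z : Q ⟶ (P.Values φ m).left), z ≫ (P.Values φ m).hom = r ≫ W →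
    CompatibleValues P φ m z → ∃ p, AmalgamatesValues P φ n m z p

theorem definable_compatibleValues :
    Definable (fun _ z => CompatibleValues P φ m z : ElemPred (P.Values φ m).left) := by
  obtain ⟨Z, z, i, j, f, g, d, y, y', hi, hj, huniv⟩ : ∃ (Z : E) (z : Z ⟶ (P.Values φ m).left)
      (i j : Z ⟶ F) (f g d : Z ⟶ C.Ar) (y y' : Z ⟶ P.X),
      z ≫ (P.Values φ m).hom = i ≫ φ ∧ z ≫ (P.Values φ m).hom = j ≫ φ ∧
      ∀ ⦃Q : E⦄ (z₀ : Q ⟶ (P.Values φ m).left) (i₀ j₀ : Q ⟶ F) (f₀ g₀ d₀ : Q ⟶ C.Ar)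
      (y₀ y₀' : Q ⟶ P.X), z₀ ≫ (P.Values φ m).hom = i₀ ≫ φ → z₀ ≫ (P.Values φ m).hom = j₀ ≫ φ →
      ∃ k : Q ⟶ Z, k ≫ z = z₀ ∧ k ≫ i = i₀ ∧ k ≫ j = j₀ ∧ k ≫ f = f₀ ∧ k ≫ g = g₀ ∧ k ≫ d = d₀ ∧
        k ≫ y = y₀ ∧ k ≫ y' = y₀' := by
    let V := pullback (pullback.fst (P.Values φ m).hom φ) (pullback.fst (P.Values φ m).hom φ)
    let R := (C.Ar ⨯ C.Ar) ⨯ (C.Ar ⨯ (P.X ⨯ P.X))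
    refine ⟨V ⨯ R, prod.fst ≫ pullback.fst _ _ ≫ pullback.fst _ _,
      prod.fst ≫ pullback.fst _ _ ≫ pullback.snd _ _,
      prod.fst ≫ pullback.snd _ _ ≫ pullback.snd _ _, prod.snd ≫ prod.fst ≫ prod.fst,
      prod.snd ≫ prod.fst ≫ prod.snd, prod.snd ≫ prod.snd ≫ prod.fst,
      prod.snd ≫ prod.snd ≫ prod.snd ≫ prod.fst, prod.snd ≫ prod.snd ≫ prod.snd ≫ prod.snd,
      ?_, ?_, fun Q z₀ i₀ j₀ f₀ g₀ d₀ y₀ y₀' h h' => ⟨prod.lift (pullback.lift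
        (pullback.lift z₀ i₀ h) (pullback.lift z₀ j₀ h') (by simp))
        (prod.lift (prod.lift f₀ g₀) (prod.lift d₀ (prod.lift y₀ y₀'))), by simp⟩⟩
    · simp only [Category.assoc]
      rw [pullback.condition (f := (P.Values φ m).hom)]
    · rw [pullback.condition]
      simp only [Category.assoc, pullback.condition]
  refine (Definable.all z (((Definable.isComp (i ≫ m) f d).and ((Definable.isComp (j ≫ m) g d).and
    ((Definable.isAct (secApp z i hi) f y).and (Definable.isAct (secApp z j hj) g y')))).imp
    (Definable.eq y y'))).congr fun T x => ⟨fun H Q r k hk Q' r' h => ?_,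
      fun H Q r i₀ j₀ f₀ g₀ d₀ y₀ y₀' hi₀ hj₀ h₁ h₂ h₃ h₄ => ?_⟩
  · obtain ⟨h₁, h₂, h₃, h₄⟩ := h
    have e : (r' ≫ k) ≫ z = (r' ≫ r) ≫ x := by rw [Category.assoc, hk, Category.assoc]
    have hi' : ((r' ≫ r) ≫ x) ≫ (P.Values φ m).hom = ((r' ≫ k) ≫ i) ≫ φ := by
      rw [← e, Category.assoc, hi, Category.assoc (r' ≫ k)]
    have hj' : ((r' ≫ r) ≫ x) ≫ (P.Values φ m).hom = ((r' ≫ k) ≫ j) ≫ φ := by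
      rw [← e, Category.assoc, hj, Category.assoc (r' ≫ k)]
    refine H (r' ≫ r) ((r' ≫ k) ≫ i) ((r' ≫ k) ≫ j) ((r' ≫ k) ≫ f)
      ((r' ≫ k) ≫ g) ((r' ≫ k) ≫ d) _ _ hi' hj' (by simpa using h₁) (by simpa using h₂) ?_ ?_
    · rw [comp_secApp] at h₃
      convert! h₃ using 1
      exact secApp_congr e.symm rfl _ _
    · rw [comp_secApp] at h₄
      convert! h₄ using 1
      exact secApp_congr e.symm rfl _ _
  · obtain ⟨k, hk, rfl, rfl, rfl, rfl, rfl, rfl, rfl⟩ := huniv (r ≫ x) i₀ j₀ f₀ g₀ d₀ y₀ y₀' hi₀ hj₀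
    have := H r k hk (𝟙 _)
    rw [Category.id_comp] at this
    refine this ⟨by simpa using h₁, by simpa using h₂, ?_, ?_⟩
    · rw [comp_secApp]
      convert! h₃ using 1
      exact secApp_congr hk rfl _ _
    · rw [comp_secApp]
      convert! h₄ using 1
      exact secApp_congr hk rfl _ _

theorem definable_amalgamatesValues :
    Definable (fun _ x => AmalgamatesValues P φ n m (x ≫ prod.fst) (x ≫ prod.snd) :
      ElemPred ((P.Values φ m).left ⨯ P.X)) := by
  obtain ⟨Z, x, i, hi, huniv⟩ : ∃ (Z : E) (x : Z ⟶ (P.Values φ m).left ⨯ P.X) (i : Z ⟶ F),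
      (x ≫ prod.fst) ≫ (P.Values φ m).hom = i ≫ φ ∧
      ∀ ⦃Q : E⦄ (x₀ : Q ⟶ (P.Values φ m).left ⨯ P.X) (i₀ : Q ⟶ F),
        (x₀ ≫ prod.fst) ≫ (P.Values φ m).hom = i₀ ≫ φ → ∃ k : Q ⟶ Z, k ≫ x = x₀ ∧ k ≫ i = i₀ :=
    ⟨pullback (prod.fst ≫ (P.Values φ m).hom) φ, pullback.fst _ _, pullback.snd _ _,
      by rw [Category.assoc, pullback.condition], fun Q x₀ i₀ h => ⟨pullback.lift x₀ i₀ (by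
        rw [← h, Category.assoc]), pullback.lift_fst _ _ _, pullback.lift_snd _ _ _⟩⟩
  refine ((Definable.eq (prod.snd ≫ P.π) (prod.fst ≫ (P.Values φ m).hom ≫ n)).and
    (Definable.all x (Definable.isAct (x ≫ prod.snd) (i ≫ m) (secApp _ i hi)))).congr
    fun T y => and_congr (by simp only [Category.assoc]) ⟨fun H Q r k hk => ?_, fun H Q s i₀ h => ?_⟩
  · have w : (r ≫ y ≫ prod.fst) ≫ (P.Values φ m).hom = (k ≫ i) ≫ φ := by
      rw [← reassoc_of% hk, Category.assoc, hi, Category.assoc]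
    have := H r (k ≫ i) w
    rw [comp_secApp]
    convert! this using 1
    · rw [reassoc_of% hk]
    · simp
    · exact secApp_congr (by rw [reassoc_of% hk]) rfl _ _
  · obtain ⟨k, hk, rfl⟩ := huniv (s ≫ y) i₀ (by simpa using h)
    have := H s k hk
    rw [comp_secApp] at this
    convert! this using 1
    · rw [reassoc_of% hk]
    · simp
    · exact secApp_congr (by rw [reassoc_of% hk]) rfl _ _

variable {P φ n m}

theorem AmalgamatesValues.unique {z : T ⟶ (P.Values φ m).left} {p p' : T ⟶ P.X}
    (h : AmalgamatesValues P φ n m z p) (h' : AmalgamatesValues P φ n m z p')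
    (hs : SeparatedAt P φ n m (z ≫ (P.Values φ m).hom)) : p = p' := by
  refine hs (𝟙 _) p p' (by simp [h.1]) (by simp [h'.1]) fun Q s i hi u u' hu hu' => ?_
  have w : (s ≫ z) ≫ (P.Values φ m).hom = i ≫ φ := by simpa using hi.symm
  exact (hu.unique (h.2 s i w)).trans ((h'.2 s i w).unique hu')

/-- Separatedness makes the amalgamation unique, so its existence at the given stage, without
passing to a cover, is definable by `Definable.exUnique`. -/
theorem definable_amalgamableAt (hs : ∀ ⦃T : E⦄ (W : T ⟶ A), SeparatedAt P φ n m W) :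
    Definable (fun _ W => AmalgamableAt P φ n m W : ElemPred A) := by
  have h := Definable.exUnique prod.fst (definable_amalgamatesValues P φ n m) (fun T y y' h h' e => by
    refine Limits.prod.hom_ext e ?_
    rw [← e] at h'
    exact h.unique h' (hs _))
  refine (Definable.all (P.Values φ m).hom ((definable_compatibleValues P φ m).imp h)).congr
    fun T W => ⟨fun H Q r z hz Q' r' hc => ?_, fun H Q r z hz hc => ?_⟩
  · obtain ⟨p, hp⟩ := H (r' ≫ r) (r' ≫ z) (by simp [hz]) hc
    exact ⟨prod.lift _ p, prod.lift_fst _ _, by simpa using hp⟩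
  · obtain ⟨x, hx, h⟩ := H r z hz (𝟙 _) (by simpa using hc)
    rw [hx, Category.id_comp] at h
    exact ⟨_, h⟩

end DefinableSheaf

/-! ### The sheaf condition by induction on generated families -/

section GeneratedSheaf

variable {E : Type u} [Category.{v} E] [PiWPretopos E] {C : InternalCategory E} {S : Site C}
  {P : Presheaf C} {T : E}

namespace GeneratedFamilies

open InternalCategory

variable {G : GeneratedFamilies S}

theorem separatedAt_star (c : T ⟶ C.Ob) : SeparatedAt P G.φ G.n G.m (c ≫ G.star) := by
  intro Q r p p' hp hp' H
  simp only [Category.assoc, star_n, Category.comp_id] at hp hp'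
  refine H (𝟙 _) (r ≫ c ≫ G.unit) (by simp [G.unit_φ]) ?_ ?_
  · have := Presheaf.isAct_ident p
    rw [reassoc_of% hp] at this
    simpa [G.unit_m] using this
  · have := Presheaf.isAct_ident p'
    rw [reassoc_of% hp'] at this
    simpa [G.unit_m] using this

/-- Elements that agree on all composites of members `m i` and `m k` have restrictions along `m i`
that agree on `t i`; these are equal by hypothesis, and the sheaf condition for `a` finishes. -/
theorem separatedAt_sup (hP : S.IsSheaf P) {a : T ⟶ S.Cov} {t : pullback a S.φ ⟶ G.Cov}
    {ht : t ≫ G.n = pullback.snd a S.φ ≫ S.m ≫ C.dom} (IH : SeparatedAt P G.φ G.n G.m t) :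
    SeparatedAt P G.φ G.n G.m (sup a t ht) := by
  intro Q r p p' hp hp' H
  rw [sup_n] at hp hp'
  refine hP.separatedAt a r p p' hp hp' fun Q₁ s i hi u u' hu hu' => ?_
  have w : (s ≫ r) ≫ a = i ≫ S.φ := by rw [hi, Category.assoc]
  have hn : (pullback.lift _ i w ≫ t) ≫ G.n = i ≫ S.m ≫ C.dom := by
    rw [Category.assoc, ht, pullback.lift_snd_assoc]
  rw [Category.assoc] at hn
  refine IH (pullback.lift _ i w) u u' (by rw [hu.π_eq, hn, Category.assoc])
    (by rw [hu'.π_eq, hn, Category.assoc]) fun Q₂ s₂ k hk v v' hv hv' => ?_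
  have w₂ : (s₂ ≫ s ≫ r) ≫ a = (s₂ ≫ i) ≫ S.φ := by simp [hi]
  have hk' : pullback.lift _ _ w₂ ≫ t = k ≫ G.φ :=
    (comp_lift_assoc s₂ _ _ w t).symm.trans hk.symm
  have hl := isComp_supMem_lift (ht := ht) w₂ hk'
  refine H (s₂ ≫ s) (pullback.lift (pullback.lift _ _ w₂) k hk' ≫ supMem a t ht) ?_ ?_ ?_
  · rw [supMem_lift_φ]
    simp only [Category.assoc]
  · exact Presheaf.IsAct.assoc (by simpa using hu.precomp s₂) hv hl
  · exact Presheaf.IsAct.assoc (by simpa using hu'.precomp s₂) hv' hl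

theorem separatedAt (hP : S.IsSheaf P) (W : T ⟶ G.Cov) : SeparatedAt P G.φ G.n G.m W :=
  G.induction (definable_separatedAt P G.φ G.n G.m G.comm) (fun _ c => separatedAt_star c)
    (fun _ _ _ _ IH => separatedAt_sup hP IH) W

/-- Elements of an `S`-sheaf are determined by their restrictions to a covering sieve. -/
theorem Covers.eq_of_forall_isAct (hP : S.IsSheaf P) {c : T ⟶ C.Ob}
    {σ : ∀ ⦃Q : E⦄, (Q ⟶ T) → (Q ⟶ C.Ar) → Prop} (hσ : G.Covers c σ) {p p' : T ⟶ P.X}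
    (hp : p ≫ P.π = c) (hp' : p' ≫ P.π = c)
    (H : ∀ ⦃Q : E⦄ (s : Q ⟶ T) (g : Q ⟶ C.Ar), σ s g → ∀ ⦃u u' : Q ⟶ P.X⦄,
      P.IsAct (s ≫ p) g u → P.IsAct (s ≫ p') g u' → u = u') : p = p' := by
  obtain ⟨T', r, W, hr, hW, hl⟩ := hσ
  refine hr.cancel (separatedAt hP W (𝟙 _) _ _ (by simp [hp, hW]) (by simp [hp', hW]) ?_)
  intro Q s i hi u u' hu hu'
  exact H (s ≫ r) _ (hl s i (by simpa using hi)) (by simpa using hu) (by simpa using hu')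

theorem amalgamableAt_star (c : T ⟶ C.Ob) : AmalgamableAt P G.φ G.n G.m (c ≫ G.star) := by
  intro Q r z hz hc
  have w : z ≫ (P.Values G.φ G.m).hom = (r ≫ c ≫ G.unit) ≫ G.φ := by simp [hz, G.unit_φ]
  have hp : secApp z _ w ≫ P.π = r ≫ c := by
    refine (secApp_hom _ _ _).trans ?_
    simp only [Category.assoc]
    rw [← Category.assoc G.unit, G.unit_m, C.ident_dom]
    simp
  refine ⟨secApp z _ w, by rw [hp, reassoc_of% hz]; simp, fun Q' s i hi => ?_⟩
  obtain rfl : i = (s ≫ r ≫ c) ≫ G.unit := G.eq_unit (by rw [← hi, Category.assoc, hz]; simp)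
  have := (Presheaf.isAct_ident (secApp z _ w)).precomp s
  rw [reassoc_of% hp] at this
  convert! this using 1
  · simp [G.unit_m]
  · rw [comp_secApp]
    exact secApp_congr rfl (by simp) _ _

/-- The amalgamations for the families `t i` form a compatible family. -/
theorem isCompatible_of_amalgamates (hS : S.IsCollection) (hP : S.IsSheaf P) {a : T ⟶ S.Cov}
    {t : pullback a S.φ ⟶ G.Cov} {ht : t ≫ G.n = pullback.snd a S.φ ≫ S.m ≫ C.dom}
    {z : T ⟶ (P.Values G.φ G.m).left} (hc : CompatibleValues P G.φ G.m z)
    (hz : z ≫ (P.Values G.φ G.m).hom = sup a t ht) {p : pullback a S.φ ⟶ P.X}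
    (hp : p ≫ P.π = t ≫ G.n)
    (H : ∀ ⦃Q : E⦄ (s : Q ⟶ T) (i : Q ⟶ S.Fam) (w : s ≫ a = i ≫ S.φ) (k : Q ⟶ G.Fam)
      (w' : pullback.lift s i w ≫ t = k ≫ G.φ) (hl : (s ≫ z) ≫ (P.Values G.φ G.m).hom =
        (pullback.lift _ k w' ≫ supMem a t ht) ≫ G.φ),
      P.IsAct (pullback.lift s i w ≫ p) (k ≫ G.m) (secApp (s ≫ z) _ hl)) :
    S.IsCompatible P a p := by
  refine ⟨hp.trans ht, fun Q i j f g d y y' hij hf hg hy hy' => ?_⟩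
  have hfg : f ≫ C.dom = g ≫ C.dom := by rw [← hf.dom_eq, hg.dom_eq]
  have hcod : ∀ (i : Q ⟶ pullback a S.φ) (f d : Q ⟶ C.Ar),
      C.IsComp (i ≫ pullback.snd _ _ ≫ S.m) f d → f ≫ C.cod = (i ≫ t) ≫ G.n := by
    intro i f d h
    rw [Category.assoc, ht, ← h.dom_eq_cod]
    simp only [Category.assoc]
  -- The equality is tested first on arrows `β` for which `f ∘ β` factors through a member of `t i`.
  refine (covers_pullbackSieve hS (i ≫ t) f (hcod i f d hf)).eq_of_forall_isAct hP hy.π_eq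
    (hy'.π_eq.trans hfg.symm) ?_
  rintro Q₁ s β ⟨Q₂, r, k, h, e, hr, hk, h₁, h₂⟩ u u' hu hu'
  refine hr.cancel ?_
  obtain ⟨e', he'⟩ := exists_isComp (C := C) (g := r ≫ s ≫ g) (f := r ≫ β) (by
    rw [← h₁.dom_eq_cod]
    simp only [Category.assoc, hfg])
  -- It is then tested on arrows `γ` for which `g ∘ β ∘ γ` factors through a member of `t j`.
  refine (covers_pullbackSieve hS (r ≫ s ≫ j ≫ t) e' ?_).eq_of_forall_isAct hP
    (c := e' ≫ C.dom) ?_ ?_ ?_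
  · rw [he'.cod_eq]
    simpa using congrArg (fun x => r ≫ s ≫ x) (hcod j g d hg)
  · rw [he'.dom_eq, Category.assoc, hu.π_eq, Category.assoc]
  · rw [he'.dom_eq, Category.assoc, hu'.π_eq, Category.assoc]
  rintro Q₃ s₂ γ ⟨Q₄, r₂, k₂, h', e₂, hr₂, hk₂, h₃, h₄⟩ v v' hv hv'
  refine hr₂.cancel ?_
  -- everything is now pulled back along `ω`
  obtain ⟨ω, hω⟩ : ∃ ω, ω = r₂ ≫ s₂ ≫ r ≫ s := ⟨_, rfl⟩
  have hω' : ∀ {X : E} (x : Q ⟶ X), r₂ ≫ s₂ ≫ r ≫ s ≫ x = ω ≫ x := by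
    intro X x
    simp only [hω, Category.assoc]
  have lift_eq : ∀ i : Q ⟶ pullback a S.φ, ∃ w : (ω ≫ i ≫ pullback.fst _ _) ≫ a =
      (ω ≫ i ≫ pullback.snd _ _) ≫ S.φ, pullback.lift _ _ w = ω ≫ i := by
    intro i
    refine ⟨by simp only [Category.assoc, pullback.condition], ?_⟩
    apply pullback.hom_ext <;> simp
  obtain ⟨wi, hwi⟩ := lift_eq i
  obtain ⟨wj, hwj⟩ := lift_eq j
  have hki : pullback.lift _ _ wi ≫ t = (r₂ ≫ s₂ ≫ k) ≫ G.φ := by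
    rw [hwi]
    simp [hk, hω]
  have hkj : pullback.lift _ _ wj ≫ t = k₂ ≫ G.φ := by
    rw [hwj]
    simp [hk₂, hω]
  have hz' : ∀ s : Q₄ ⟶ T, s ≫ sup a t ht = (s ≫ z) ≫ (P.Values G.φ G.m).hom := fun s => by
    rw [← hz, Category.assoc]
  have hli := (supMem_lift_φ (ht := ht) wi hki).trans (hz' _)
  have hlj := (supMem_lift_φ (ht := ht) wj hkj).trans (hz' _)
  have Hi := H _ _ wi _ hki hli.symm
  have Hj := H _ _ wj _ hkj hlj.symm
  have ci := isComp_supMem_lift (ht := ht) wi hki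
  have cj := isComp_supMem_lift (ht := ht) wj hkj
  have h₁' := h₁.precomp (r₂ ≫ s₂)
  have h₂' := h₂.precomp (r₂ ≫ s₂)
  have he'' := he'.precomp (r₂ ≫ s₂)
  have hf' := hf.precomp ω
  have hg' := hg.precomp ω
  have hy₁ := hy.precomp ω
  have hy₂ := hy'.precomp ω
  have hu₁ := hu.precomp (r₂ ≫ s₂ ≫ r)
  have hu₂ := hu'.precomp (r₂ ≫ s₂ ≫ r)
  have hv₁ := hv.precomp r₂
  have hv₂ := hv'.precomp r₂
  simp only [Category.assoc, hω'] at h₁' h₂' he'' hf' hg' hy₁ hy₂ hu₁ hu₂ hv₁ hv₂ h₃ ci cj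
  rw [(congrArg (· ≫ p) hwi).trans (Category.assoc _ _ _), Category.assoc r₂ (s₂ ≫ k) G.m,
    Category.assoc s₂ k G.m] at Hi
  rw [(congrArg (· ≫ p) hwj).trans (Category.assoc _ _ _)] at Hj
  -- the common composite
  obtain ⟨hγ, hhγ⟩ := exists_isComp (C := C) (g := r₂ ≫ s₂ ≫ h) (f := r₂ ≫ γ) (by
    rw [← h₃.dom_eq_cod, ← h₂'.dom_eq, h₁'.dom_eq, he''.dom_eq])
  obtain ⟨βγ, hβγ⟩ := exists_isComp (C := C) (g := r₂ ≫ s₂ ≫ r ≫ β) (f := r₂ ≫ γ) (by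
    rw [← h₃.dom_eq_cod, he''.dom_eq])
  obtain ⟨D, hD⟩ := exists_isComp (C := C) (g := ω ≫ d) (f := βγ) (by
    rw [hβγ.cod_eq, hf'.dom_eq, h₁'.dom_eq_cod])
  obtain ⟨eγ, heγ⟩ := exists_isComp (C := C) (g := r₂ ≫ s₂ ≫ e) (f := r₂ ≫ γ) (by
    rw [← h₃.dom_eq_cod, h₁'.dom_eq, he''.dom_eq])
  have heγ₁ := h₁'.assoc heγ hβγ
  have heγ₂ := h₂'.assoc heγ hhγ
  have heγ₃ := he''.assoc h₃ hβγ
  have cD₁ := ci.assoc' (hf'.assoc hD heγ₁) heγ₂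
  have cD₂ := cj.assoc' (hg'.assoc hD heγ₃) h₄
  have ai := Hi.assoc' (hy₁.assoc (hu₁.assoc hv₁ hβγ) heγ₁) heγ₂
  have aj := Hj.assoc' (hy₂.assoc (hu₂.assoc hv₂ hβγ) heγ₃) h₄
  obtain ⟨ri, hri⟩ : ∃ ri, ri = ω ≫ i ≫ pullback.fst _ _ := ⟨_, rfl⟩
  have hrj : ω ≫ j ≫ pullback.fst _ _ = ri := by rw [hri, hij]
  have hlj' : (ri ≫ z) ≫ (P.Values G.φ G.m).hom =
      (pullback.lift (pullback.lift _ _ wj) k₂ hkj ≫ supMem a t ht) ≫ G.φ := by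
    rw [← hrj, hlj]
  -- Both sides are now restrictions of values of `z` at two members of `sup_a t`, along arrows with
  -- the common composite `D`.
  refine hc (ω ≫ i ≫ pullback.fst _ _) _
    (pullback.lift (pullback.lift _ _ wj) k₂ hkj ≫ supMem a t ht) hγ h' D _ _ hli.symm (by rw [← hri]; exact hlj')
    (by simpa using cD₁) (by simpa using cD₂) ai ?_
  convert! aj using 1
  exact secApp_congr (by rw [hij]) rfl _ _

/-- The values of `z` at the members `(i, k)` with `i` fixed are amalgamated by hypothesis, and the
resulting elements are amalgamated over `a` in the `S`-sheaf. -/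
theorem amalgamableAt_sup (hS : S.IsCollection) (hP : S.IsSheaf P) {a : T ⟶ S.Cov}
    {t : pullback a S.φ ⟶ G.Cov} {ht : t ≫ G.n = pullback.snd a S.φ ≫ S.m ≫ C.dom}
    (IH : AmalgamableAt P G.φ G.n G.m t) {z : T ⟶ (P.Values G.φ G.m).left}
    (hz : z ≫ (P.Values G.φ G.m).hom = sup a t ht) (hc : CompatibleValues P G.φ G.m z) :
    ∃ p, AmalgamatesValues P G.φ G.n G.m z p := by
  have w : (pullback.fst t G.φ ≫ pullback.fst a S.φ ≫ z) ≫ (P.Values G.φ G.m).hom =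
      supMem a t ht ≫ G.φ := by
    rw [supMem_φ, ← hz]
    simp only [Category.assoc]
  have hx : secApp _ _ w ≫ P.π = pullback.snd t G.φ ≫ G.m ≫ C.dom := by
    refine (secApp_hom _ _ w).trans ?_
    rw [← Category.assoc, (isComp_supMem a t ht).dom_eq, Category.assoc]
  have app : ∀ ⦃Q : E⦄ (s : Q ⟶ pullback a S.φ) (k : Q ⟶ G.Fam)
      (hk : (s ≫ secMk (X := Over.mk P.π) t _ hx) ≫ (P.Values G.φ G.m).hom = k ≫ G.φ)
      (w' : s ≫ t = k ≫ G.φ) (hl : ((s ≫ pullback.fst _ _) ≫ z) ≫ (P.Values G.φ G.m).hom =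
        (pullback.lift s k w' ≫ supMem a t ht) ≫ G.φ),
      secApp (s ≫ secMk (X := Over.mk P.π) t _ hx) k hk = secApp _ _ hl := by
    intro Q s k hk w' hl
    refine (secApp_secMk (X := Over.mk P.π) t _ hx s k w').trans ?_
    rw [comp_secApp]
    exact secApp_congr (by simp) rfl _ _
  have hl : ∀ ⦃Q : E⦄ (s : Q ⟶ pullback a S.φ) (k : Q ⟶ G.Fam) (w' : s ≫ t = k ≫ G.φ),
      ((s ≫ pullback.fst _ _) ≫ z) ≫ (P.Values G.φ G.m).hom =
        (pullback.lift s k w' ≫ supMem a t ht) ≫ G.φ := by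
    intro Q s k w'
    rw [Category.assoc _ (supMem a t ht), supMem_φ, pullback.lift_fst_assoc, ← hz]
    simp only [Category.assoc]
  have hz₁ : secMk (X := Over.mk P.π) t _ hx ≫ (P.Values G.φ G.m).hom = t := secMk_hom _ _ _
  -- Since amalgamability gives an element at the stage itself, here the index set of `a`, `p` is
  -- already a function of `i` and no choice is involved.
  obtain ⟨p, hp, hpx⟩ := IH (𝟙 _) (secMk (X := Over.mk P.π) t _ hx) (by
      rw [hz₁, Category.id_comp]) (by
    intro Q r k k' f g d y y' hk hk' hf hg hy hy'
    have w₁ : r ≫ t = k ≫ G.φ := by rw [← hk, Category.assoc, hz₁]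
    have w₂ : r ≫ t = k' ≫ G.φ := by rw [← hk', Category.assoc, hz₁]
    have c₁ := (isComp_supMem a t ht).precomp (pullback.lift r k w₁)
    have c₂ := (isComp_supMem a t ht).precomp (pullback.lift r k' w₂)
    simp only [pullback.lift_fst_assoc, pullback.lift_snd_assoc] at c₁ c₂
    rw [← Category.assoc (pullback.lift _ _ _)] at c₁ c₂
    obtain ⟨D, hD⟩ := exists_isComp (C := C) (g := r ≫ pullback.snd _ _ ≫ S.m) (f := d) (by
      rw [hf.cod_eq, c₁.dom_eq_cod])
    rw [app r k hk w₁ (hl r k w₁)] at hy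
    rw [app r k' hk' w₂ (hl r k' w₂)] at hy'
    exact hc (r ≫ pullback.fst _ _) _ _ f g D y y' (hl r k w₁) (hl r k' w₂)
      (c₁.assoc' hD hf) (c₂.assoc' hD hg) hy hy')
  rw [reassoc_of% hz₁] at hp
  have hpx' : ∀ ⦃Q : E⦄ (s : Q ⟶ pullback a S.φ) (k : Q ⟶ G.Fam) (w' : s ≫ t = k ≫ G.φ),
      P.IsAct (s ≫ p) (k ≫ G.m) (secApp _ _ (hl s k w')) := by
    intro Q s k w'
    have hk : (s ≫ secMk (X := Over.mk P.π) t _ hx) ≫ (P.Values G.φ G.m).hom = k ≫ G.φ := by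
      rw [Category.assoc, hz₁, w']
    rw [← app s k hk w' (hl s k w')]
    exact hpx s k hk
  have H : ∀ ⦃Q : E⦄ (s : Q ⟶ T) (i : Q ⟶ S.Fam) (w : s ≫ a = i ≫ S.φ) (k : Q ⟶ G.Fam)
      (w' : pullback.lift s i w ≫ t = k ≫ G.φ) (hl : (s ≫ z) ≫ (P.Values G.φ G.m).hom =
        (pullback.lift _ k w' ≫ supMem a t ht) ≫ G.φ),
      P.IsAct (pullback.lift s i w ≫ p) (k ≫ G.m) (secApp (s ≫ z) _ hl) := by
    intro Q s i w k w' hl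
    convert! hpx' _ k w' using 1
    exact secApp_congr (by simp) rfl _ _
  obtain ⟨p₀, ⟨hp₀, hp₀x⟩, -⟩ := hP a p (isCompatible_of_amalgamates hS hP hc hz hp H)
  refine ⟨p₀, by rw [hp₀, reassoc_of% hz, sup_n], fun Q s l h => ?_⟩
  obtain ⟨i, v, k, w', rfl⟩ := exists_supMem (a := a) (t := t) (ht := ht) (s := s) (l := l) (by
    rw [← h, ← hz, Category.assoc])
  refine Presheaf.IsAct.assoc ?_ (H s i v k w' h) (isComp_supMem_lift v w')
  simpa using hp₀x.precomp (pullback.lift s i v)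

theorem amalgamableAt (hS : S.IsCollection) (hP : S.IsSheaf P) (W : T ⟶ G.Cov) :
    AmalgamableAt P G.φ G.n G.m W := by
  refine G.induction (definable_amalgamableAt fun _ => separatedAt hP) (fun _ c =>
    amalgamableAt_star c) (fun T a t ht IH => ?_) W
  intro Q r z hz hc
  rw [comp_sup] at hz
  refine amalgamableAt_sup hS hP ?_ hz hc
  exact (definable_amalgamableAt fun _ => separatedAt hP).precomp (reindex r a S.φ) IH

variable (G)

theorem isSheaf_site (hS : S.IsCollection) (hP : S.IsSheaf P) : (G.site hS).IsSheaf P := by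
  intro T (W : T ⟶ G.Cov) (x : pullback W G.φ ⟶ P.X) ⟨hx, hxc⟩
  have hx' : x ≫ P.π = pullback.snd W G.φ ≫ G.m ≫ C.dom := hx
  have hz : secMk (X := Over.mk P.π) W x hx' ≫ (P.Values G.φ G.m).hom = W := secMk_hom _ _ _
  have app : ∀ ⦃Q : E⦄ (s : Q ⟶ T) (i : Q ⟶ G.Fam)
      (hi : (s ≫ secMk (X := Over.mk P.π) W x hx') ≫ (P.Values G.φ G.m).hom = i ≫ G.φ)
      (w : s ≫ W = i ≫ G.φ), secApp (s ≫ secMk (X := Over.mk P.π) W x hx') i hi =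
        pullback.lift s i w ≫ x :=
    fun Q s i hi w => secApp_secMk (X := Over.mk P.π) W x hx' s i w
  obtain ⟨p, hp, hpx⟩ := amalgamableAt hS hP W (𝟙 _) (secMk (X := Over.mk P.π) W x hx') (by
      rw [hz, Category.id_comp]) (by
    intro Q r i j f g d y y' hi hj hf hg hy hy'
    have wi : r ≫ W = i ≫ G.φ := by rw [← hi, Category.assoc, hz]
    have wj : r ≫ W = j ≫ G.φ := by rw [← hj, Category.assoc, hz]
    rw [app r i hi wi] at hy
    rw [app r j hj wj] at hy'
    refine hxc (pullback.lift r i wi) (pullback.lift r j wj) f g d y y' ?_ ?_ ?_ hy hy'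
    · exact (pullback.lift_fst _ _ _).trans (pullback.lift_fst _ _ _).symm
    · convert! hf using 1
      exact pullback.lift_snd_assoc _ _ _ _
    · convert! hg using 1
      exact pullback.lift_snd_assoc _ _ _ _)
  rw [reassoc_of% hz] at hp
  refine ⟨p, ⟨hp, ?_⟩, fun p' ⟨hp', hpx'⟩ => ?_⟩
  · have := hpx (pullback.fst W G.φ) (pullback.snd _ _) (by
      rw [Category.assoc, hz, pullback.condition])
    have e : pullback.lift (pullback.fst W G.φ) (pullback.snd W G.φ) pullback.condition = 𝟙 _ := by
      apply pullback.hom_ext <;> simp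
    rwa [(app _ _ _ pullback.condition).trans ((congrArg (· ≫ x) e).trans (Category.id_comp x))]
      at this
  · refine separatedAt hP W (𝟙 _) _ _ (by rw [Category.id_comp]; exact hp')
      (by rw [Category.id_comp]; exact hp) fun Q s i hi u u' hu hu' => ?_
    rw [Category.id_comp] at hi
    have h := hpx s i (by rw [Category.assoc, hz, hi])
    rw [app s i _ hi.symm] at h
    have h' := hpx'.precomp (pullback.lift s i hi.symm)
    have e₁ : pullback.lift s i hi.symm ≫ pullback.fst W G.φ ≫ p' = s ≫ p' :=
      pullback.lift_fst_assoc _ _ _ _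
    have e₂ : pullback.lift s i hi.symm ≫ pullback.snd W G.φ ≫ G.m = i ≫ G.m :=
      pullback.lift_snd_assoc _ _ _ _
    exact ((e₁ ▸ e₂ ▸ h' : P.IsAct (s ≫ p') (i ≫ G.m) _).unique hu).symm.trans (h.unique hu')

/-- The family `sup_U t` with every `t i` equal to `*` refines `U`. -/
theorem isRefinedBy_site (hS : S.IsCollection) : S.IsRefinedBy (G.site hS) := by
  intro T U
  have ht : ((pullback.snd U S.φ ≫ S.m ≫ C.dom) ≫ G.star) ≫ G.n =
      pullback.snd U S.φ ≫ S.m ≫ C.dom := by simp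
  refine ⟨T, 𝟙 _, sup U _ ht, .of_isIso _, (sup_n U _ ht).trans (Category.id_comp _).symm,
    fun Q s l hl => ?_⟩
  obtain ⟨i, w, k, w', rfl⟩ := exists_supMem hl
  have hl' := isComp_supMem_lift (ht := ht) w w'
  refine ⟨Q, 𝟙 _, i, k ≫ G.m, .of_isIso _, by simp [w], ?_⟩
  rw [Category.id_comp]
  exact hl'

theorem equivalent_site (hS : S.IsCollection) : S.Equivalent (G.site hS) :=
  Site.equivalent_of_isSheaf_iff fun _ => ⟨G.isSheaf_site hS, (G.isRefinedBy_site hS).isSheaf⟩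

end GeneratedFamilies

end GeneratedSheaf

/-! ### Collection sites from the axiom of multiple choice -/

section CollectionSite

variable {E : Type u} [Category.{v} E] [PiWPretopos E] {C : InternalCategory E} (S : Site C)
  {D A : E} {q : D ⟶ S.Fam} {g : D ⟶ A} {p : A ⟶ S.Cov}

/-- The site obtained by reindexing the families of `S` along a covering square. -/
def Site.reindexed (h : IsCoveringSquare q g S.φ p) : Site C where
  Cov := A
  Fam := D
  φ := g
  n := p ≫ S.n
  m := q ≫ S.m
  comm := by
    obtain ⟨-, w, -⟩ := h
    rw [Category.assoc, S.comm, ← Category.assoc, ← w, Category.assoc]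
  stable T U f hf := by
    obtain ⟨hp, w, hD⟩ := h
    obtain ⟨T₁, r₁, V, hr₁, hV, hl⟩ := S.stable (U ≫ p) f (by simpa using hf)
    obtain ⟨T₂, r₂, V', hr₂, hV'⟩ := hp.exists_local_lift V
    refine ⟨T₂, r₂ ≫ r₁, V', hr₂.comp hr₁, ?_, fun Q s j hj => ?_⟩
    · rw [← Category.assoc V', hV', Category.assoc, hV, Category.assoc]
    obtain ⟨Q₁, t, i, k, d, ht, hi, h₁, h₂⟩ := hl (s ≫ r₂) (j ≫ q) (by
      rw [Category.assoc, ← w, reassoc_of% hj, hV', Category.assoc])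
    -- Members of the original family lift locally to `D`, because the square is covering.
    obtain ⟨Q₂, t', x, ht', hx⟩ := hD.exists_local_lift
      (pullback.lift (t ≫ s ≫ r₂ ≫ r₁ ≫ U) i (by simp [hi]))
    have hx₁ := congrArg (· ≫ pullback.fst _ _) hx
    have hx₂ := congrArg (· ≫ pullback.snd _ _) hx
    simp only [Category.assoc, pullback.lift_fst, pullback.lift_snd] at hx₁ hx₂
    refine ⟨Q₂, t' ≫ t, x, t' ≫ k, t' ≫ d, ht'.comp ht, by simp [hx₁], ?_, ?_⟩
    · simpa using h₁.precomp t'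
    · have := h₂.precomp t'
      rwa [← Category.assoc t' i, ← hx₂, Category.assoc] at this

/-- A family `U` of the reindexed site and the family `U ≫ p` have the same members up to
repetition, and locally every family is of the form `U ≫ p`; so the two sites refine each other. -/
theorem Site.equivalent_reindexed (h : IsCoveringSquare q g S.φ p) :
    S.Equivalent (S.reindexed h) := by
  obtain ⟨hp, w, hD⟩ := id h
  have h₁ : ∀ ⦃T : E⦄ (U : T ⟶ A), ∃ (T' : E) (r : T' ⟶ T) (V : T' ⟶ S.Cov), IsCover r ∧
      V ≫ S.n = r ≫ U ≫ p ≫ S.n ∧ ∀ ⦃Q : E⦄ (s : Q ⟶ T') (j : Q ⟶ S.Fam), j ≫ S.φ = s ≫ V →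
        ∃ (Q' : E) (r' : Q' ⟶ Q) (i : Q' ⟶ D) (k : Q' ⟶ C.Ar), IsCover r' ∧
          i ≫ g = r' ≫ s ≫ r ≫ U ∧ C.IsComp (i ≫ q ≫ S.m) k (r' ≫ j ≫ S.m) := by
    intro T U
    refine ⟨T, 𝟙 _, U ≫ p, .of_isIso _, by simp, fun Q s j hj => ?_⟩
    obtain ⟨Q', t, x, ht, hx⟩ := hD.exists_local_lift
      (pullback.lift (s ≫ U) j (by simpa using hj.symm))
    have hx₁ := congrArg (· ≫ pullback.fst _ _) hx
    have hx₂ := congrArg (· ≫ pullback.snd _ _) hx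
    simp only [Category.assoc, pullback.lift_fst, pullback.lift_snd] at hx₁ hx₂
    refine ⟨Q', t, x, t ≫ j ≫ S.m ≫ C.dom ≫ C.ident, ht, by simpa using hx₁, ?_⟩
    rw [reassoc_of% hx₂]
    simpa using InternalCategory.isComp_ident_right (C := C) (t ≫ j ≫ S.m)
  have h₂ : ∀ ⦃T : E⦄ (U : T ⟶ S.Cov), ∃ (T' : E) (r : T' ⟶ T) (V : T' ⟶ A), IsCover r ∧
      V ≫ p ≫ S.n = r ≫ U ≫ S.n ∧ ∀ ⦃Q : E⦄ (s : Q ⟶ T') (j : Q ⟶ D), j ≫ g = s ≫ V →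
        ∃ (Q' : E) (r' : Q' ⟶ Q) (i : Q' ⟶ S.Fam) (k : Q' ⟶ C.Ar), IsCover r' ∧
          i ≫ S.φ = r' ≫ s ≫ r ≫ U ∧ C.IsComp (i ≫ S.m) k (r' ≫ j ≫ q ≫ S.m) := by
    intro T U
    obtain ⟨T', r, V, hr, hV⟩ := hp.exists_local_lift U
    refine ⟨T', r, V, hr, by rw [reassoc_of% hV], fun Q s j hj =>
      ⟨Q, 𝟙 _, j ≫ q, (j ≫ q) ≫ S.m ≫ C.dom ≫ C.ident, .of_isIso _, ?_, ?_⟩⟩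
    · rw [Category.assoc, ← w, reassoc_of% hj, hV, Category.id_comp]
    · simpa using InternalCategory.isComp_ident_right (C := C) ((j ≫ q) ≫ S.m)
  exact equivalent_of_isSheaf_iff fun P =>
    ⟨IsRefinedBy.isSheaf (S := S.reindexed h) (S' := S) h₁,
      IsRefinedBy.isSheaf (S := S) (S' := S.reindexed h) h₂⟩

variable {S}

/-- Maps over `S.Fam` are maps over `C.Ar`, and families with equal images under `p` cover the same
object. -/
theorem Site.isCollSquare_reindexed {b : Prop} (h : IsCoveringSquare q g S.φ p)
    (hc : IsCollSquare b q g S.φ p) : IsCollSquare b (S.reindexed h).m (S.reindexed h).φ C.cod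
      (S.reindexed h).n := by
  refine ⟨(S.reindexed h).comm.symm, fun T (c : T ⟶ A) Y (e : Y ⟶ pullback c g) he => ?_⟩
  obtain ⟨T', r, c', k, hr, hc', hk, hq, l⟩ := hc.2 c e he
  have hc'' : c' ≫ p ≫ S.n = r ≫ c ≫ p ≫ S.n := by
    have := congrArg (· ≫ S.n) hc'
    simpa only [Category.assoc] using this
  have hq' : k ≫ pullback.snd c g ≫ q ≫ S.m = pullback.snd c' g ≫ q ≫ S.m := by
    have := congrArg (· ≫ S.m) hq
    simpa only [Category.assoc] using this
  exact ⟨T', r, c', k, hr, hc'', hk, hq', l⟩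

variable (C) in
/-- The theorem for predicative toposes, strong ones if `b` holds. -/
theorem exists_equivalent_isCollSquare {b : Prop} (hE : ∀ ⦃B A : E⦄ (f : B ⟶ A),
    ∃ (D C : E) (q : D ⟶ B) (g : D ⟶ C) (p : C ⟶ A),
      IsCoveringSquare q g f p ∧ IsCollSquare b q g f p) :
    (∀ S : Site C, ∃ S' : Site C, IsCollSquare b S'.m S'.φ C.cod S'.n ∧ S.Equivalent S') ∧
    (∀ S : Site C, IsDepPoly S.coverFunctor) ∧
    (∀ S : Site C, IsCollSquare b S.m S.φ C.cod S.n → ∃ S' : Site C, S'.IsGrothendieck ∧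
      IsCollSquare b S'.m S'.φ C.cod S'.n ∧ S.Equivalent S' ∧ S'.IsGeneratedBy S) ∧
    (∀ S : Site C, ∃ S' : Site C, S'.IsGrothendieck ∧ IsCollSquare b S'.m S'.φ C.cod S'.n ∧
      S.Equivalent S') := by
  have h₁ : ∀ S : Site C, ∃ S' : Site C, IsCollSquare b S'.m S'.φ C.cod S'.n ∧
      S.Equivalent S' := by
    intro S
    obtain ⟨D, A, q, g, p, h, hc⟩ := hE S.φ
    exact ⟨S.reindexed h, Site.isCollSquare_reindexed h hc, S.equivalent_reindexed h⟩
  have h₂ : ∀ S : Site C, IsCollSquare b S.m S.φ C.cod S.n → ∃ S' : Site C, S'.IsGrothendieck ∧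
      IsCollSquare b S'.m S'.φ C.cod S'.n ∧ S.Equivalent S' ∧ S'.IsGeneratedBy S := by
    intro S hS
    obtain ⟨G⟩ := nonempty_generatedFamilies S
    have hS' : S.IsCollection := hS.isCollectionSquare
    refine ⟨G.site hS', G.isGrothendieck_site hS', G.isCollSquare ?_ hS, G.equivalent_site hS',
      G.isGeneratedBy_site hS'⟩
    intro B A f
    obtain ⟨D, A', q, g, p, h, hc⟩ := hE f
    exact ⟨D, A', q, g, p, h, hc.isCollectionSquare⟩
  refine ⟨h₁, isDepPoly_coverFunctor, h₂, fun S => ?_⟩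
  obtain ⟨S₁, hS₁, e₁⟩ := h₁ S
  obtain ⟨S₂, hG, hS₂, e₂, -⟩ := h₂ S₁ hS₁
  exact ⟨S₂, hG, hS₂, e₁.trans e₂⟩

end CollectionSite

end PredTopos

end

theorem mainTheorem8 (E : Type u) [Category.{v} E] :
    (∀ [PredTopos.PredicativeTopos E] (C : PredTopos.InternalCategory E),
      (∀ S : PredTopos.Site C, ∃ S' : PredTopos.Site C, S'.IsCollection ∧ S.Equivalent S') ∧
      (∀ S : PredTopos.Site C, PredTopos.IsDepPoly S.coverFunctor) ∧
      (∀ S : PredTopos.Site C, S.IsCollection → ∃ S' : PredTopos.Site C,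
        S'.IsGrothendieck ∧ S'.IsCollection ∧ S.Equivalent S' ∧ S'.IsGeneratedBy S) ∧
      (∀ S : PredTopos.Site C, ∃ S' : PredTopos.Site C,
        S'.IsGrothendieck ∧ S'.IsCollection ∧ S.Equivalent S')) ∧
    (∀ [PredTopos.StrongPredicativeTopos E] (C : PredTopos.InternalCategory E),
      (∀ S : PredTopos.Site C, ∃ S' : PredTopos.Site C,
        S'.IsStrongCollection ∧ S.Equivalent S') ∧
      (∀ S : PredTopos.Site C, PredTopos.IsDepPoly S.coverFunctor) ∧
      (∀ S : PredTopos.Site C, S.IsStrongCollection → ∃ S' : PredTopos.Site C,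
        S'.IsGrothendieck ∧ S'.IsStrongCollection ∧ S.Equivalent S' ∧ S'.IsGeneratedBy S) ∧
      (∀ S : PredTopos.Site C, ∃ S' : PredTopos.Site C,
        S'.IsGrothendieck ∧ S'.IsStrongCollection ∧ S.Equivalent S')) := by
  constructor
  · intro _ C
    have h := PredTopos.exists_equivalent_isCollSquare C (b := False)
      (by simpa only [PredTopos.isCollSquare_false_iff, PredTopos.AMC] using
        PredTopos.PredicativeTopos.amc (E := E))
    simp only [PredTopos.isCollSquare_false_iff] at h
    exact h
  · intro _ C
    have h := PredTopos.exists_equivalent_isCollSquare C (b := True)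
      (by simpa only [PredTopos.isCollSquare_true_iff, PredTopos.SAMC] using
        PredTopos.StrongPredicativeTopos.samc (E := E))
    simp only [PredTopos.isCollSquare_true_iff] at h
    exact h
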